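/- **Setting.** Programs are terms of the $\lambda$-calculus in A-normal form: expressions $e ::= \mathtt{let}\ v=(f\ a)\ \mathtt{in}\ e \mid (f\ a)\mid a$, where the atoms $f,a$ are variables $v$ or $\lambda$-terms $\lambda v.e$. The size $n$ of a program is the number of nodes of its syntax tree. In pushdown 0CFA (monovariant allocation) the abstract addresses are the variables, and a variable is allocated at itself. Environments $\rho$ are partial maps from variables to addresses, closures are pairs $(\lambda v.e,\rho)$, stores $\sigma$ map addresses to sets of closures (ordered pointwise by inclusion), frames are triples $(v,e,\rho)$, and continuations $\kappa$ are finite lists of frames. Put $\mathcal A(\lambda v.e,\rho,\sigma)=\{(\lambda v.e,\rho)\}$ and $\mathcal A(v,\rho,\sigma)=\sigma(\rho(v))$ (empty if $v\notin\mathrm{dom}\,\rho$). The abstract machine has the transitions * $((f\ a),\rho,\sigma,\kappa)\Rightarrow(e,\rho'[v\mapsto v],\sigma\sqcup[v\mapsto\mathcal A(a,\rho,\sigma)],\kappa)$ for each $(\lambda v.e,\rho')\in\mathcal A(f,\rho,\sigma)$; * $(\mathtt{let}\ v=(f\ a)\ \mathtt{in}\ e,\rho,\sigma,\kappa)\Rightarrow((f\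 a),\rho,\sigma,(v,e,\rho):\kappa)$; * $(a,\rho,\sigma,(v,e,\rho'):\kappa)\Rightarrow(e,\rho'[v\mapsto v],\sigma\sqcup[v\mapsto\mathcal A(a,\rho,\sigma)],\kappa)$. *The store-widened analysis* of a program $e_0$ is the least fixed point $(Q,\tau)$ of the map that sends $(Q,\sigma)$, with $Q$ a set of triples $(e,\rho,\kappa)$, to $(Q',\sigma')$, where $Q'$ consists of $(e_0,[\,],\langle\rangle)$ and all $(e',\rho',\kappa')$ with $(e,\rho,\sigma,\kappa)\Rightarrow(e',\rho',\sigma'',\kappa')$ for some $(e,\rho,\kappa)\in Q$ and some store $\sigma''$, and $\sigma'$ is the join of all these $\sigma''$. *The $\epsilon$-closure-graph iteration function.* A state is a pair $\psi=(e,\rho)$. For a stack action $g\in\{\epsilon,\phi_+,\phi_-\}$ write $\psi\Downarrow^\sigma_g(\psi',\sigma')$ if for all $\kappa$ the machine steps from $\psi$ with store $\sigma$ to $\psi'$ with store $\sigma'$, the continuation going from $\kappa$ to $\kappa$, from $\kappa$ to $\phi:\kappa$, or from $\phi:\kappa$ to $\kappa$, respectively. A system is $((P,E),H,\sigma)$ with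 $P$ a set of states, $E$ a set of triples $(\psi,g,\psi')$, $H$ a set of pairs of states and $\sigma$ a store; systems are ordered componentwise, and $\bot$ has all components empty. Let $F_{e_0}((P,E),H,\sigma)=((P',E'),H',\sigma'')$, where * $T_+=\{((\psi,\phi_+,\psi'),\sigma'):\psi\in P,\ \psi\Downarrow^\sigma_{\phi_+}(\psi',\sigma')\}$ and $T_\epsilon=\{((\psi,\epsilon,\psi'),\sigma'):\psi\in P,\ \psi\Downarrow^\sigma_{\epsilon}(\psi',\sigma')\}$; * $T_-=\{((\psi'',\phi_-,\psi'''),\sigma'):\psi''\Downarrow^\sigma_{\phi_-}(\psi''',\sigma'),\ (\psi,\phi_+,\psi')\in E\text{ and }(\psi',\psi'')\in H\text{ for some }\psi,\psi'\}$; * with $T'=T_+\cup T_\epsilon\cup T_-$: $E'=\{g:(g,\sigma')\in T'\text{ for some }\sigma'\}$ and $\sigma''=\bigsqcup\{\sigma':(g,\sigma')\in T'\text{ for some }g\}$; * $P'=P\cup\{(e_0,[\,])\}\cup\{\psi':(\psi,g,\psi')\in E'\text{ for some }\psi,g\}$; * $H'$ consists of all pairs $(\psi,\psi'')$ with $(\psi,\psi'),(\psi',\psi'')\in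 H$ for some $\psi'$; all $(\psi,\psi''')$ with $(\psi,\phi_+,\psi')\in E$, $(\psi',\psi'')\in H$, $(\psi'',\phi_-,\psi''')\in E$ for some $\phi,\psi',\psi''$; all $(\psi,\psi')$ with $(\psi,\epsilon,\psi')\in E'$; and all $(\psi,\psi)$ with $\psi\in P'$. *Cost model.* A unit-cost random access machine: structured programs (sequence, conditional, while) over finitely many registers and finitely many unbounded arrays of natural numbers, in which each assignment of a constant, addition, truncated subtraction, array read, array write and zero test costs one step. The input is $n$ together with the list of the nodes of the syntax tree in preorder (kind and identifier of each). A system is held in memory as characteristic tables of $P$, of the $\epsilon$-, push and pop edges of $E$, of $H$ and of $\sigma$, indexed by the nodes of the program, where a node stands for the subexpression there with the environment mapping each variable in scope to itself, a $\mathtt{let}$ node also for the frame it pushes, a $\lambda$ node also for its closure, and a binding node for its variable. **Theorem (pushdown 0CFA can be computed in $O(n^6)$ time).** There are machine programs *setup* and *iter*, a register *flag* and a constant $C$ such that for every program $e_0$ of size $n$ there is $K\le Cn^3$ for which: 1. $F_{e_0}^{K}(\bot)$ is the least fixed point of $F_{e_0}$. 2. On input $e_0$, *setup* halts in a machine state $m_0$,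 and there are machine states $m_1,\dots,m_K$ such that *iter* goes from $m_i$ to $m_{i+1}$ in at most $Cn^3$ steps for $i<K$; for all $i\le K$, $m_i$ holds the system $F_{e_0}^{i}(\bot)$, all of whose states, frames, closures and addresses come from nodes of $e_0$. 3. The program "*setup*; while *flag* $\neq 0$ do *iter*" halts on input $e_0$ in the state $m_K$ after at most $Cn^6$ steps. 4. The result is the store-widened pushdown 0CFA: if $F_{e_0}^{K}(\bot)=((P,E),H,\sigma)$ and $(Q,\tau)$ is the store-widened analysis of $e_0$ (which exists), then $P=\{(e,\rho):(e,\rho,\kappa)\in Q\text{ for some }\kappa\}$ and $\sigma=\tau$. -/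

import Mathlib

namespace PDCFA

/-! ## Programs: the lambda-calculus in A-normal form -/

/-- Identifiers. -/
abbrev Var := ℕ

mutual
/-- Expressions: `let v = (f a) in e`, a call `(f a)` in tail position, or a returned atom. -/
inductive Exp : Type
  | letin (v : Var) (f a : Atom) (body : Exp) : Exp
  | call (f a : Atom) : Exp
  | ret (a : Atom) : Exp
/-- Atomic expressions: a variable or a lambda term `λ v. e`. -/
inductive Atom : Type
  | var (v : Var) : Atom
  | lam (v : Var) (body : Exp) : Atom
end

/-- The lambda term `λ v. e`, as the pair `(v, e)`. -/
abbrev Lam := Var × Exp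

mutual
/-- The size of a program: the number of nodes of its syntax tree
(the call inside a `let` is a node of its own; a returned atom is the same node as the atom). -/
def Exp.size : Exp → ℕ
  | .letin _ f a e => 2 + f.size + a.size + e.size
  | .call f a => 1 + f.size + a.size
  | .ret a => a.size
def Atom.size : Atom → ℕ
  | .var _ => 1
  | .lam _ e => 1 + e.size
end

/-! ## The abstract CESK machine, over a set `A` of abstract addresses -/

section Machine

variable {A : Type}

/-- Environments: partial maps from variables to addresses. -/
abbrev Env (A : Type) := Var → Option A
/-- Closures. -/
abbrev Clo (A : Type) := Lam × Env A
/-- Abstract stores, ordered pointwise by inclusion; `⊥` is the empty store. -/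
abbrev Store (A : Type) := A → Set (Clo A)
/-- Stack frames `(v, e, ρ)`. -/
abbrev Frame (A : Type) := Var × Exp × Env A
/-- Continuations: the head of the list is the top of the stack. -/
abbrev Kont (A : Type) := List (Frame A)

/-- Abstract configurations. -/
structure Conf (A : Type) where
  exp : Exp
  env : Env A
  store : Store A
  kont : Kont A

/-- The empty environment. -/
def Env.empty : Env A := fun _ => none

/-- `ρ[v ↦ a]`. -/
def Env.bind (ρ : Env A) (v : Var) (a : A) : Env A := Function.update ρ v (some a)

/-- The store `[a ↦ D]`, empty at every other address. -/
def Store.single (a : A) (D : Set (Clo A)) : Store A := fun b => {c | b = a ∧ c ∈ D}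

/-- Abstract evaluation of atomic expressions; an unbound variable has no values. -/
def aeval : Atom → Env A → Store A → Set (Clo A)
  | .lam v e, ρ, _ => {((v, e), ρ)}
  | .var v, ρ, σ => {c | ∃ a, ρ v = some a ∧ c ∈ σ a}

/-- The abstract transition relation, for the allocation function `alloc`. -/
inductive AStep (alloc : Var → Conf A → A) : Conf A → Conf A → Prop
  /-- tail call -/
  | call (f a : Atom) (ρ : Env A) (σ : Store A) (κ : Kont A) (v : Var) (e : Exp) (ρ' : Env A)
      (h : ((v, e), ρ') ∈ aeval f ρ σ) :
      AStep alloc ⟨.call f a, ρ, σ, κ⟩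
        ⟨e, ρ'.bind v (alloc v ⟨.call f a, ρ, σ, κ⟩),
          σ ⊔ Store.single (alloc v ⟨.call f a, ρ, σ, κ⟩) (aeval a ρ σ), κ⟩
  /-- non-tail call: push a frame -/
  | push (v : Var) (f a : Atom) (e : Exp) (ρ : Env A) (σ : Store A) (κ : Kont A) :
      AStep alloc ⟨.letin v f a e, ρ, σ, κ⟩ ⟨.call f a, ρ, σ, (v, e, ρ) :: κ⟩
  /-- return: pop a frame -/
  | pop (a : Atom) (ρ : Env A) (σ : Store A) (v : Var) (e : Exp) (ρ' : Env A) (κ : Kont A) :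
      AStep alloc ⟨.ret a, ρ, σ, (v, e, ρ') :: κ⟩
        ⟨e, ρ'.bind v (alloc v ⟨.ret a, ρ, σ, (v, e, ρ') :: κ⟩),
          σ ⊔ Store.single (alloc v ⟨.ret a, ρ, σ, (v, e, ρ') :: κ⟩) (aeval a ρ σ), κ⟩

/-! ## Widening: a single-threaded store -/

/-- Partial configurations. -/
abbrev PConf (A : Type) := Exp × Env A × Kont A

/-- The transition relation with the store factored out:
`FStep alloc σ p (p', σ')` is `p ⇝^σ (p', σ')`. -/
def FStep (alloc : Var → Conf A → A) (σ : Store A) (p : PConf A) (r : PConf A × Store A) : Prop :=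
  AStep alloc ⟨p.1, p.2.1, σ, p.2.2⟩ ⟨r.1.1, r.1.2.1, r.2, r.1.2.2⟩

/-- The iteration function, on sets of partial configurations with one global store,
of the store-widened analysis of the program `e`. -/
def wideStep (alloc : Var → Conf A → A) (e : Exp) (s : Set (PConf A) × Store A) :
    Set (PConf A) × Store A :=
  ({p' | ∃ p ∈ s.1, ∃ σ', FStep alloc s.2 p (p', σ')} ∪ {(e, Env.empty, [])},
    sSup {σ' | ∃ p ∈ s.1, ∃ p', FStep alloc s.2 p (p', σ')})

/-! ## The iteration function with an ε-closure graph -/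

/-- Partial control states. -/
abbrev PState (A : Type) := Exp × Env A

/-- Stack actions. -/
inductive Act (A : Type) : Type
  | eps : Act A
  | push (φ : Frame A) : Act A
  | pop (φ : Frame A) : Act A

/-- Labelled edges. -/
abbrev Edge (A : Type) := PState A × Act A × PState A

/-- `((P, E), H, σ)`: nodes and edges of a Dyck state control-flow graph, the edges of an
ε-closure graph, and the global store. It is ordered componentwise; `⊥` has all components empty. -/
abbrev System (A : Type) :=
  (Set (PState A) × Set (Edge A)) × Set (PState A × PState A) × Store A

/-- The stack- and action-factored transition relation under the store `σ`. -/
def PStep (alloc : Var → Conf A → A) (σ : Store A) (ψ : PState A) :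
    Act A → PState A × Store A → Prop
  | .push φ, r => ∀ κ, AStep alloc ⟨ψ.1, ψ.2, σ, κ⟩ ⟨r.1.1, r.1.2, r.2, φ :: κ⟩
  | .pop φ, r => ∀ κ, AStep alloc ⟨ψ.1, ψ.2, σ, φ :: κ⟩ ⟨r.1.1, r.1.2, r.2, κ⟩
  | .eps, r => ∀ κ, AStep alloc ⟨ψ.1, ψ.2, σ, κ⟩ ⟨r.1.1, r.1.2, r.2, κ⟩

section Transfer

variable (alloc : Var → Conf A → A) (e : Exp) (P : Set (PState A)) (E : Set (Edge A))
  (H : Set (PState A × PState A)) (σ : Store A)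

/-- `T₊`: push transitions of the known states, each with its resulting store. -/
def pushT : Set (Edge A × Store A) :=
  {t | ∃ ψ φ ψ' σ', t = ((ψ, .push φ, ψ'), σ') ∧ ψ ∈ P ∧ PStep alloc σ ψ (.push φ) (ψ', σ')}

/-- `T_ε`: transitions of the known states that leave the stack unchanged. -/
def epsT : Set (Edge A × Store A) :=
  {t | ∃ ψ ψ' σ', t = ((ψ, .eps, ψ'), σ') ∧ ψ ∈ P ∧ PStep alloc σ ψ .eps (ψ', σ')}

/-- `T₋`: pop transitions enabled by a push edge followed by an ε-closure edge. -/
def popT : Set (Edge A × Store A) :=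
  {t | ∃ ψ φ ψ' ψ₂ ψ₃ σ', t = ((ψ₂, .pop φ, ψ₃), σ') ∧
    PStep alloc σ ψ₂ (.pop φ) (ψ₃, σ') ∧ (ψ, .push φ, ψ') ∈ E ∧ (ψ', ψ₂) ∈ H}

/-- `T' = T₊ ∪ T_ε ∪ T₋`. -/
def allT : Set (Edge A × Store A) := pushT alloc P σ ∪ epsT alloc P σ ∪ popT alloc E H σ

/-- `E'`: the edges of the transitions. -/
def edges' : Set (Edge A) := {g | ∃ σ', (g, σ') ∈ allT alloc P E H σ}

/-- `σ''`: the join of the stores of the transitions. -/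
def store' : Store A := sSup {σ' | ∃ g, (g, σ') ∈ allT alloc P E H σ}

/-- `P'`: the old nodes, the initial one, and the targets of the new edges. -/
def nodes' : Set (PState A) :=
  P ∪ {(e, Env.empty)} ∪ {ψ' | ∃ ψ g, (ψ, g, ψ') ∈ edges' alloc P E H σ}

/-- `H'`: compositions of two ε-closure edges; a push, an ε-closure edge and the matching pop;
the ε-edges of the graph; and a self-loop at every node. -/
def closure' : Set (PState A × PState A) :=
  {h | ∃ ψ', (h.1, ψ') ∈ H ∧ (ψ', h.2) ∈ H} ∪
  {h | ∃ φ ψ' ψ₂, (h.1, .push φ, ψ') ∈ E ∧ (ψ', ψ₂) ∈ H ∧ (ψ₂, .pop φ, h.2) ∈ E} ∪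
  {h | (h.1, .eps, h.2) ∈ edges' alloc P E H σ} ∪
  {h | h.1 ∈ nodes' alloc e P E H σ ∧ h.2 = h.1}

end Transfer

/-- The ε-closure-graph iteration function for the program `e`. -/
def transfer (alloc : Var → Conf A → A) (e : Exp) (s : System A) : System A :=
  ((nodes' alloc e s.1.1 s.1.2 s.2.1 s.2.2, edges' alloc s.1.1 s.1.2 s.2.1 s.2.2),
    closure' alloc e s.1.1 s.1.2 s.2.1 s.2.2, store' alloc s.1.1 s.1.2 s.2.1 s.2.2)

end Machine

/-- The monovariant (0CFA) allocation function: addresses are variables. -/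
def mono : Var → Conf Var → Var := fun v _ => v

/-! ## The cost model: structured programs for a unit-cost random access machine

A program has finitely many registers and finitely many unbounded arrays, all of natural numbers.
Every assignment, addition, (truncated) subtraction, array access and test costs one step. -/

/-- Programs. -/
inductive Cmd : Type
  /-- do nothing -/
  | skip : Cmd
  /-- `x := c` -/
  | const (x c : ℕ) : Cmd
  /-- `x := y + z` -/
  | add (x y z : ℕ) : Cmd
  /-- `x := y - z` (zero if `y < z`) -/
  | sub (x y z : ℕ) : Cmd
  /-- `x := a[i]`, with the contents of register `i` as index -/
  | load (x a i : ℕ) : Cmd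
  /-- `a[i] := x`, with the contents of register `i` as index -/
  | store (a i x : ℕ) : Cmd
  /-- `c; d` -/
  | seq (c d : Cmd) : Cmd
  /-- `if x ≠ 0 then c else d` -/
  | ite (x : ℕ) (c d : Cmd) : Cmd
  /-- `while x ≠ 0 do c` -/
  | loop (x : ℕ) (c : Cmd) : Cmd

/-- Machine states: the contents of the registers and of the arrays. -/
structure Mem where
  reg : ℕ → ℕ
  arr : ℕ → ℕ → ℕ

/-- Assign to a register. -/
def Mem.setReg (m : Mem) (x k : ℕ) : Mem := ⟨Function.update m.reg x k, m.arr⟩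

/-- Assign to an array entry. -/
def Mem.setArr (m : Mem) (a i k : ℕ) : Mem :=
  ⟨m.reg, Function.update m.arr a (Function.update (m.arr a) i k)⟩

/-- `Exec c m m' t`: started in `m`, the program `c` halts in `m'` after exactly `t` steps. -/
inductive Exec : Cmd → Mem → Mem → ℕ → Prop
  | skip (m : Mem) : Exec .skip m m 1
  | const (x c : ℕ) (m : Mem) : Exec (.const x c) m (m.setReg x c) 1
  | add (x y z : ℕ) (m : Mem) : Exec (.add x y z) m (m.setReg x (m.reg y + m.reg z)) 1
  | sub (x y z : ℕ) (m : Mem) : Exec (.sub x y z) m (m.setReg x (m.reg y - m.reg z)) 1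
  | load (x a i : ℕ) (m : Mem) : Exec (.load x a i) m (m.setReg x (m.arr a (m.reg i))) 1
  | store (a i x : ℕ) (m : Mem) : Exec (.store a i x) m (m.setArr a (m.reg i) (m.reg x)) 1
  | seq {c d : Cmd} {m m₁ m₂ : Mem} {t u : ℕ} (hc : Exec c m m₁ t) (hd : Exec d m₁ m₂ u) :
      Exec (.seq c d) m m₂ (t + u)
  | iteTrue {x : ℕ} {c d : Cmd} {m m₁ : Mem} {t : ℕ} (hx : m.reg x ≠ 0) (hc : Exec c m m₁ t) :
      Exec (.ite x c d) m m₁ (t + 1)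
  | iteFalse {x : ℕ} {c d : Cmd} {m m₁ : Mem} {t : ℕ} (hx : m.reg x = 0) (hd : Exec d m m₁ t) :
      Exec (.ite x c d) m m₁ (t + 1)
  | loopStop {x : ℕ} {c : Cmd} {m : Mem} (hx : m.reg x = 0) : Exec (.loop x c) m m 1
  | loopStep {x : ℕ} {c : Cmd} {m m₁ m₂ : Mem} {t u : ℕ} (hx : m.reg x ≠ 0)
      (hc : Exec c m m₁ t) (hl : Exec (.loop x c) m₁ m₂ u) : Exec (.loop x c) m m₂ (t + u + 1)

/-! ## Input and output format -/

mutual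
/-- The nodes of the syntax tree in preorder, each as a pair (kind, identifier), with kinds
1 variable, 2 lambda, 3 call, 4 let. -/
def Exp.code : Exp → List (ℕ × ℕ)
  | .letin v f a e => (4, v) :: (3, 0) :: (f.code ++ a.code ++ e.code)
  | .call f a => (3, 0) :: (f.code ++ a.code)
  | .ret a => a.code
def Atom.code : Atom → List (ℕ × ℕ)
  | .var v => [(1, v)]
  | .lam v e => (2, v) :: e.code
end

/-- The initial machine state for the program `e`: register 0 holds the size of `e`, arrays 0 and 1
hold the kinds and the identifiers of its nodes in preorder, and everything else is zero. -/
def input (e : Exp) : Mem where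
  reg := fun x => if x = 0 then e.size else 0
  arr := fun a i =>
    if a = 0 then (e.code.getD i (0, 0)).1 else if a = 1 then (e.code.getD i (0, 0)).2 else 0

mutual
/-- The nodes of the syntax tree in preorder, each as the partial control state formed by the
subexpression and the monovariant environment that binds the variables in scope there. -/
def Exp.points : Exp → Env Var → List (PState Var)
  | .letin v f a e, ρ =>
      (.letin v f a e, ρ) :: (.call f a, ρ) :: (f.points ρ ++ a.points ρ ++ e.points (ρ.bind v v))
  | .call f a, ρ => (.call f a, ρ) :: (f.points ρ ++ a.points ρ)
  | .ret a, ρ => a.points ρ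
def Atom.points : Atom → Env Var → List (PState Var)
  | .var v, ρ => [(.ret (.var v), ρ)]
  | .lam v e, ρ => (.ret (.lam v e), ρ) :: e.points (ρ.bind v v)
end

/-- `IsPoint e i ψ`: node number `i` of the program `e` is the partial control state `ψ`. -/
def IsPoint (e : Exp) (i : ℕ) (ψ : PState Var) : Prop := (e.points Env.empty)[i]? = some ψ

/-- Node `i` of `e` is a `let`, whose evaluation pushes the frame `φ`. -/
def IsFrame (e : Exp) (i : ℕ) (φ : Frame Var) : Prop :=
  ∃ f a, IsPoint e i (.letin φ.1 f a φ.2.1, φ.2.2)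

/-- Node `i` of `e` is a lambda term, whose evaluation yields the closure `c`. -/
def IsClo (e : Exp) (i : ℕ) (c : Clo Var) : Prop := IsPoint e i (.ret (.lam c.1.1 c.1.2), c.2)

/-- Node `i` of `e` is a `let` or a lambda term that binds `v`. -/
def IsBinder (e : Exp) (i : ℕ) (v : Var) : Prop :=
  (∃ φ, IsFrame e i φ ∧ φ.1 = v) ∨ (∃ c, IsClo e i c ∧ c.1.1 = v)

open Classical in
/-- The truth value of `p` as a number. -/
noncomputable def bit (p : Prop) : ℕ := if p then 1 else 0

/-- The machine state `m` holds the system `s` for the program `e`: all states, frames, closures and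
addresses that occur in `s` come from nodes of `e`, and with `n` the size of `e`,
array 2 is the characteristic table of the nodes, arrays 3, 4, 5 of the ε-, push and pop edges,
array 6 of the ε-closure edges and array 7 of the store, indexed by node numbers. -/
structure Holds (e : Exp) (s : System Var) (m : Mem) : Prop where
  node_mem : ∀ ψ ∈ s.1.1, ∃ i, IsPoint e i ψ
  edge_mem : ∀ ψ g ψ', (ψ, g, ψ') ∈ s.1.2 → (∃ i, IsPoint e i ψ) ∧ (∃ i, IsPoint e i ψ') ∧
    ∀ φ, (g = .push φ ∨ g = .pop φ) → ∃ l, IsFrame e l φ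
  closure_mem : ∀ ψ ψ', (ψ, ψ') ∈ s.2.1 → (∃ i, IsPoint e i ψ) ∧ ∃ i, IsPoint e i ψ'
  store_mem : ∀ v c, c ∈ s.2.2 v → (∃ i, IsBinder e i v) ∧ ∃ j, IsClo e j c
  node : ∀ i ψ, IsPoint e i ψ → m.arr 2 i = bit (ψ ∈ s.1.1)
  eps : ∀ i j ψ ψ', IsPoint e i ψ → IsPoint e j ψ' →
    m.arr 3 (i * e.size + j) = bit ((ψ, .eps, ψ') ∈ s.1.2)
  push : ∀ i l j ψ φ ψ', IsPoint e i ψ → IsFrame e l φ → IsPoint e j ψ' →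
    m.arr 4 ((i * e.size + l) * e.size + j) = bit ((ψ, .push φ, ψ') ∈ s.1.2)
  pop : ∀ i l j ψ φ ψ', IsPoint e i ψ → IsFrame e l φ → IsPoint e j ψ' →
    m.arr 5 ((i * e.size + l) * e.size + j) = bit ((ψ, .pop φ, ψ') ∈ s.1.2)
  closure : ∀ i j ψ ψ', IsPoint e i ψ → IsPoint e j ψ' →
    m.arr 6 (i * e.size + j) = bit ((ψ, ψ') ∈ s.2.1)
  store : ∀ i j v c, IsBinder e i v → IsClo e j c →
    m.arr 7 (i * e.size + j) = bit (c ∈ s.2.2 v)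

end PDCFA

/-!
The machine keeps relations on the nodes of the program in tables, and computes a table from a
nonrecursive definition by clauses, as in Datalog: a clause with `q` variables is evaluated by `q`
nested loops over the nodes, hence in time of order `n ^ q` (`Def.runs`). A list of such
definitions, evaluated in order, yields the intended tables if these satisfy the definitions
(`defsSem_agree`).

An iteration of the transfer function would take more than three variables if it were transcribed
literally. Three suffice (`iterDefs`, `iterDefs_sem`), because a push edge always pushes the frame
of the `let` it starts from, and because the joins in pop edges, closure edges and store entries can
be split with auxiliary tables. All states, frames and closures of the iterates come from nodes
(`NodeSys`), but distinct nodes may stand for equal states, frames or closures, and distinct binders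
for the same variable. So the clauses join modulo these equalities, which are static tables. They
are computed once, by rounds of simultaneous recursion over the syntax tree, in time of order
`n ^ 5` (`setup_runs`).

The iterates of the transfer function from `⊥` increase, and a system from nodes is determined by
its six tables, which have at most `6 * n ^ 3` entries. So the least fixed point is reached after
that many iterations (`isLeast_iterate`). The machine counts down from `8 * n ^ 3`, a value that is
cheap to compute by doubling, and spends cubic time on each iteration.

For the comparison with the store-widened analysis (`exists_wide_eq`), both functions are monotone,
and their least fixed points bound each other. A configuration can be read off a fixed graph if its
state is a node of the graph and its continuation is a chain of push edges linked by ε-closure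
edges; the configurations that can be read off are closed under the steps of the store-widened
analysis (`wideStep_le_of_transfer_le`). Conversely, the graph of all edges that lead from reachable
configurations to reachable configurations is closed under the transfer function
(`transfer_le_of_wideStep_le`).
-/

namespace PDCFA

/-! ### Bounded executions -/

/-- Started in `m`, the program `c` halts in `m'` after at most `B` steps. -/
def Runs (c : Cmd) (m m' : Mem) (B : ℕ) : Prop := ∃ t ≤ B, Exec c m m' t

theorem Runs.mono {c : Cmd} {m m' : Mem} {B B' : ℕ} (h : Runs c m m' B) (hB : B ≤ B') :
    Runs c m m' B' :=
  let ⟨t, ht, hx⟩ := h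
  ⟨t, ht.trans hB, hx⟩

theorem Runs.seq {c d : Cmd} {m m₁ m₂ : Mem} {B B' : ℕ} (h : Runs c m m₁ B)
    (h' : Runs d m₁ m₂ B') : Runs (.seq c d) m m₂ (B + B') :=
  let ⟨t, ht, hx⟩ := h
  let ⟨u, hu, hy⟩ := h'
  ⟨t + u, by omega, .seq hx hy⟩

theorem Exec.runs {c : Cmd} {m m' : Mem} {t : ℕ} (h : Exec c m m' t) : Runs c m m' t :=
  ⟨t, le_rfl, h⟩

/-- Repeat `c`, with the register `x` counting down to zero. Register 1 has to hold the number 1. -/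
def countdown (x : ℕ) (c : Cmd) : Cmd := .loop x (.seq (.sub x x 1) c)

/-- The rule for count-down loops; `I k` is the invariant with `k` rounds to go. -/
theorem Runs.countdown {x : ℕ} {c : Cmd} {B : ℕ} {I : ℕ → Mem → Prop}
    (hone : ∀ k m, I k m → m.reg 1 = 1) (hreg : ∀ k m, I k m → m.reg x = k)
    (step : ∀ k m, I (k + 1) m → ∃ m', Runs c (m.setReg x k) m' B ∧ I k m') :
    ∀ k m, I k m → ∃ m', Runs (countdown x c) m m' (k * (B + 2) + 1) ∧ I 0 m' := by
  intro k
  induction k with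
  | zero => exact fun m hm => ⟨m, ⟨1, by omega, .loopStop (hreg _ _ hm)⟩, hm⟩
  | succ k ih =>
    intro m hm
    obtain ⟨m₁, ⟨t, ht, hx⟩, h₁⟩ := step k m hm
    obtain ⟨m₂, ⟨u, hu, hy⟩, h₂⟩ := ih m₁ h₁
    have hs : Exec (.sub x x 1) m (m.setReg x k) 1 := by
      have := Exec.sub x x 1 m
      rwa [hreg _ _ hm, hone _ _ hm, Nat.add_sub_cancel] at this
    refine ⟨m₂, ⟨1 + t + u + 1, ?_, .loopStep (by rw [hreg _ _ hm]; omega) (.seq hs hx) hy⟩, h₂⟩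
    rw [Nat.add_mul]; omega

/-! ### Tables and their memory layout -/

/-- The position of a tuple in a table: its value in base `n`, behind the leading digits `acc`. -/
def encFrom (n : ℕ) : ℕ → List ℕ → ℕ
  | acc, [] => acc
  | acc, x :: xs => encFrom n (acc * n + x) xs

/-- The position of a tuple in a table. -/
abbrev enc (n : ℕ) (xs : List ℕ) : ℕ := encFrom n 0 xs

theorem encFrom_inj {n : ℕ} : ∀ {xs ys : List ℕ} {a b : ℕ}, xs.length = ys.length →
    (∀ x ∈ xs, x < n) → (∀ y ∈ ys, y < n) → encFrom n a xs = encFrom n b ys → a = b ∧ xs = ys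
  | [], [], _, _, _, _, _, h => ⟨h, rfl⟩
  | x :: xs, y :: ys, a, b, hl, hx, hy, h => by
    simp only [List.length_cons, Nat.add_right_cancel_iff, List.mem_cons, forall_eq_or_imp] at *
    obtain ⟨h₁, rfl⟩ := encFrom_inj hl hx.2 hy.2 h
    have hn : 0 < n := by omega
    have ha : (a * n + x) / n = (b * n + y) / n := by rw [h₁]
    rw [Nat.mul_comm a, Nat.mul_comm b, Nat.mul_add_div hn, Nat.mul_add_div hn,
      Nat.div_eq_of_lt hx.1, Nat.div_eq_of_lt hy.1] at ha
    obtain rfl : a = b := by omega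
    exact ⟨rfl, by congr 1; omega⟩

/-- The arity of the table in array `p`. Tables of the analysis that is being computed are shifted
by 30 against those of the analysis so far. -/
def ar (p : ℕ) : ℕ :=
  if p = 2 ∨ p = 32 then 1 else if p = 4 ∨ p = 5 ∨ p = 34 ∨ p = 35 then 3 else 2

/-- Arrays 0 and 1 hold the input and array 8 the multiples of `n`; all others are tables. -/
def IsTab (p : ℕ) : Prop := 2 ≤ p ∧ p ≠ 8

instance : DecidablePred IsTab := fun p => inferInstanceAs (Decidable (2 ≤ p ∧ p ≠ 8))

/-- The input as seen by the programs: the number, the kinds and the identifiers of the nodes. -/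
structure Ctx where
  /-- the number of nodes -/
  n : ℕ
  /-- the kinds -/
  kd : ℕ → ℕ
  /-- the identifiers -/
  nm : ℕ → ℕ

/-- A database: a relation on node numbers for each table. -/
abbrev DB := ℕ → List ℕ → Prop

/-- `xs` is an index of the table `p`. -/
def Valid (n p : ℕ) (xs : List ℕ) : Prop := xs.length = ar p ∧ ∀ x ∈ xs, x < n

/-- The memory `m` is prepared for working on tables, and its tables are those of `D`. Register 0
holds `n`, and register 1 the number 1. Of the others, 2 to 5 are for intermediate results, 6 and 7
are counters, and those from 10 on hold the loop variables. -/
structure Rep (c : Ctx) (m : Mem) (D : DB) : Prop where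
  size : m.reg 0 = c.n
  one : m.reg 1 = 1
  kind : ∀ i < c.n, m.arr 0 i = c.kd i
  name : ∀ i < c.n, m.arr 1 i = c.nm i
  -- `n ^ 2` suffices: tables have at most three columns
  mul : ∀ i ≤ c.n ^ 2, m.arr 8 i = i * c.n
  tab : ∀ p, IsTab p → ∀ xs, Valid c.n p xs → m.arr p (enc c.n xs) = bit (D p xs)

theorem ar_le (p : ℕ) : ar p ≤ 3 := by unfold ar; split_ifs <;> omega

/-- The two memories agree except in the scratch registers 2, 3, 4, 5. -/
def Same (m m' : Mem) : Prop := m'.arr = m.arr ∧ ∀ r, r < 2 ∨ 5 < r → m'.reg r = m.reg r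

theorem Same.trans {m m' m'' : Mem} (h : Same m m') (h' : Same m' m'') : Same m m'' :=
  ⟨h'.1.trans h.1, fun r hr => (h'.2 r hr).trans (h.2 r hr)⟩

theorem Same.rep {c : Ctx} {m m' : Mem} {D : DB} (h : Same m m') (hm : Rep c m D) :
    Rep c m' D where
  size := by rw [h.2 0 (by omega), hm.size]
  one := by rw [h.2 1 (by omega), hm.one]
  kind := by rw [h.1]; exact hm.kind
  name := by rw [h.1]; exact hm.name
  mul := by rw [h.1]; exact hm.mul
  tab := by rw [h.1]; exact hm.tab

theorem Same.setReg {m m' : Mem} (h : Same m m') {r : ℕ} (hr : 2 ≤ r ∧ r ≤ 5) (k : ℕ) :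
    Same m (m'.setReg r k) :=
  ⟨h.1, fun s hs => by
    rw [← h.2 s hs]; simp only [Mem.setReg]; rw [Function.update_of_ne (by omega)]⟩

theorem Same.refl (m : Mem) : Same m m := ⟨rfl, fun _ _ => rfl⟩

/-! ### Literals -/

/-- Conditions on the values of the loop variables, which are referred to by number. -/
inductive Atm
  /-- the tuple is in the table `p` -/
  | tab (p : ℕ) (xs : List ℕ)
  /-- the node has kind `k` -/
  | kind (k x : ℕ)
  /-- the nodes have the same identifier -/
  | same (x y : ℕ)
  /-- `y` is `x + 1` -/
  | succ (x y : ℕ)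
  /-- the node is the root -/
  | root (x : ℕ)

/-- The condition holds for the values `v` of the loop variables. -/
def Atm.Holds (c : Ctx) (D : DB) (v : ℕ → ℕ) : Atm → Prop
  | .tab p xs => D p (xs.map v)
  | .kind k x => c.kd (v x) = k
  | .same x y => c.nm (v x) = c.nm (v y)
  | .succ x y => v y = v x + 1
  | .root x => v x = 0

/-- The condition is about tables other than `h`, and about the first `d` loop variables. -/
def Atm.WF (h d : ℕ) : Atm → Bool
  | .tab p xs => decide (IsTab p) && decide (p ≠ h) && decide (xs.length = ar p) &&
      xs.all (fun x => decide (x < d))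
  | .kind _ x => decide (x < d)
  | .same x y => decide (x < d) && decide (y < d)
  | .succ x y => decide (x < d) && decide (y < d)
  | .root x => decide (x < d)

/-- Loop variable `x` lives in register `10 + x`; multiply register 2 by `n` and add the
variable, for each of the variables. -/
def indexFrom : List ℕ → Cmd
  | [] => .skip
  | x :: xs => .seq (.load 2 8 2) (.seq (.add 2 2 (10 + x)) (indexFrom xs))

/-- Compute the position of a tuple of variables in register 2. -/
def index (xs : List ℕ) : Cmd := .seq (.const 2 0) (indexFrom xs)

/-- Set register 3 to 1 if registers `x` and `y` are equal, and to 0 otherwise. -/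
def eqTest (x y : ℕ) : Cmd :=
  .seq (.sub 5 x y) (.seq (.sub 3 y x) (.seq (.add 3 3 5) (.sub 3 1 3)))

/-- Set register 3 to a nonzero value if the condition holds, and to zero otherwise. -/
def Atm.cmd : Atm → Cmd
  | .tab p xs => .seq (index xs) (.load 3 p 2)
  | .kind k x => .seq (.load 3 0 (10 + x)) (.seq (.const 4 k) (eqTest 3 4))
  | .same x y => .seq (.load 3 1 (10 + x)) (.seq (.load 4 1 (10 + y)) (eqTest 3 4))
  | .succ x y => .seq (.add 3 (10 + x) 1) (eqTest 3 (10 + y))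
  | .root x => .sub 3 1 (10 + x)

theorem indexFrom_runs {c : Ctx} {D : DB} : ∀ (xs : List ℕ) (j : ℕ) (m : Mem), Rep c m D →
    j + xs.length ≤ 3 → m.reg 2 < c.n ^ j → (∀ x ∈ xs, m.reg (10 + x) < c.n) →
    ∃ m', Runs (indexFrom xs) m m' (2 * xs.length + 1) ∧ Same m m' ∧
      m'.reg 2 = encFrom c.n (m.reg 2) (xs.map fun x => m.reg (10 + x))
  | [], _, m, _, _, _, _ => ⟨m, (Exec.skip m).runs, .refl m, rfl⟩
  | x :: xs, j, m, hm, hj, ha, hx => by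
    simp only [List.length_cons, List.mem_cons, forall_eq_or_imp] at hj hx
    have hn : 0 < c.n := by omega
    have hmul : m.arr 8 (m.reg 2) = m.reg 2 * c.n :=
      hm.mul _ (ha.le.trans (Nat.pow_le_pow_right hn (by omega)))
    set m₁ := m.setReg 2 (m.reg 2 * c.n) with hm₁
    set m₂ := m₁.setReg 2 (m.reg 2 * c.n + m.reg (10 + x)) with hm₂
    have s₂ : Same m m₂ := ((Same.refl m).setReg (by omega) _).setReg (by omega) _
    have e₁ : Exec (.load 2 8 2) m m₁ 1 := by
      have := Exec.load 2 8 2 m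
      rwa [hmul] at this
    have e₂ : Exec (.add 2 2 (10 + x)) m₁ m₂ 1 := by
      have := Exec.add 2 2 (10 + x) m₁
      have h₂ : m₁.reg 2 = m.reg 2 * c.n := by simp [hm₁, Mem.setReg]
      have h₃ : m₁.reg (10 + x) = m.reg (10 + x) := by
        simp only [hm₁, Mem.setReg]; rw [Function.update_of_ne (by omega)]
      rwa [h₂, h₃] at this
    have hr : ∀ y, m₂.reg (10 + y) = m.reg (10 + y) := fun y => s₂.2 _ (by omega)
    have h2 : m₂.reg 2 = m.reg 2 * c.n + m.reg (10 + x) := by simp [hm₂, Mem.setReg]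
    obtain ⟨m', r', s', h'⟩ := indexFrom_runs xs (j + 1) m₂ (s₂.rep hm) (by omega)
      (by
        rw [h2, Nat.pow_succ]
        have := Nat.mul_le_mul_right c.n (Nat.succ_le_of_lt ha)
        rw [Nat.succ_mul] at this
        omega)
      (fun y hy => by rw [hr]; exact hx.2 y hy)
    refine ⟨m', (e₁.runs.seq (e₂.runs.seq r')).mono (by simp; omega), s₂.trans s', ?_⟩
    rw [h', h2]
    simp only [hr, List.map_cons, encFrom]

theorem index_runs {c : Ctx} {D : DB} {xs : List ℕ} {m : Mem} (hm : Rep c m D)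
    (hl : xs.length ≤ 3) (hx : ∀ x ∈ xs, m.reg (10 + x) < c.n) :
    ∃ m', Runs (index xs) m m' 8 ∧ Same m m' ∧
      m'.reg 2 = enc c.n (xs.map fun x => m.reg (10 + x)) := by
  have s : Same m (m.setReg 2 0) := (Same.refl m).setReg (by omega) _
  have hr : ∀ y, (m.setReg 2 0).reg (10 + y) = m.reg (10 + y) := fun y => s.2 _ (by omega)
  obtain ⟨m', r', s', h'⟩ := indexFrom_runs xs 0 (m.setReg 2 0) (s.rep hm) (by omega)
    (by simp [Mem.setReg]) (fun y hy => by rw [hr]; exact hx y hy)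
  refine ⟨m', ((Exec.const 2 0 m).runs.seq r').mono (by omega), s.trans s', ?_⟩
  rw [h']; simp only [hr]; simp [Mem.setReg]

theorem eqTest_runs {m : Mem} {x y : ℕ} (h1 : m.reg 1 = 1) (hx : x ≠ 5) (hy : y ≠ 5) :
    ∃ m', Runs (eqTest x y) m m' 4 ∧ Same m m' ∧ (m'.reg 3 ≠ 0 ↔ m.reg x = m.reg y) := by
  refine ⟨_, (Exec.seq (.sub _ _ _ _) (.seq (.sub _ _ _ _) (.seq (.add _ _ _ _)
    (.sub _ _ _ _)))).runs, ?_, ?_⟩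
  · exact ((((Same.refl m).setReg (by omega) _).setReg (by omega) _).setReg (by omega) _).setReg
      (by omega) _
  · simp [Mem.setReg, h1, hx, hy]
    omega

theorem bit_ne_zero {p : Prop} : bit p ≠ 0 ↔ p := by
  unfold bit; split_ifs with h <;> simp [h]

theorem Atm.cmd_runs {c : Ctx} {D : DB} {m : Mem} (hm : Rep c m D) {h d : ℕ}
    (hv : ∀ x < d, m.reg (10 + x) < c.n) (a : Atm) (ha : a.WF h d = true) :
    ∃ m', Runs a.cmd m m' 10 ∧ Same m m' ∧
      (m'.reg 3 ≠ 0 ↔ a.Holds c D fun x => m.reg (10 + x)) := by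
  cases a with
  | tab p xs =>
    simp only [WF, Bool.and_eq_true, decide_eq_true_eq, List.all_eq_true] at ha
    obtain ⟨⟨⟨hp, -⟩, hl⟩, hx⟩ := ha
    obtain ⟨m₁, r₁, s₁, h₁⟩ := index_runs (xs := xs) hm (hl ▸ ar_le p)
      (fun x h => hv x (hx x h))
    refine ⟨_, (r₁.seq (Exec.load 3 p 2 m₁).runs).mono (by omega), s₁.setReg (by omega) _, ?_⟩
    have := hm.tab p hp (xs.map fun x => m.reg (10 + x)) ⟨by simpa using hl, by
      simp only [List.mem_map, forall_exists_index, and_imp, forall_apply_eq_imp_iff₂]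
      exact fun x h => hv x (hx x h)⟩
    simp only [Mem.setReg, Function.update_self, h₁, s₁.1, this]
    exact bit_ne_zero
  | kind k x =>
    simp only [WF, decide_eq_true_eq] at ha
    have s : Same m ((m.setReg 3 (m.arr 0 (m.reg (10 + x)))).setReg 4 k) :=
      ((Same.refl m).setReg (by omega) _).setReg (by omega) _
    obtain ⟨m', r', s', h'⟩ := eqTest_runs (m := (m.setReg 3 (m.arr 0 (m.reg (10 + x)))).setReg 4 k)
      (x := 3) (y := 4) (s.rep hm).one (by omega) (by omega)
    refine ⟨m', ((Exec.load 3 0 _ m).runs.seq ((Exec.const 4 k _).runs.seq r')).mono (by omega),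
      s.trans s', h'.trans ?_⟩
    simp [Mem.setReg, Atm.Holds, hm.kind _ (hv x ha)]
  | same x y =>
    simp only [WF, Bool.and_eq_true, decide_eq_true_eq] at ha
    have s : Same m ((m.setReg 3 (m.arr 1 (m.reg (10 + x)))).setReg 4 (m.arr 1 (m.reg (10 + y)))) :=
      ((Same.refl m).setReg (by omega) _).setReg (by omega) _
    obtain ⟨m', r', s', h'⟩ := eqTest_runs
      (m := (m.setReg 3 (m.arr 1 (m.reg (10 + x)))).setReg 4 (m.arr 1 (m.reg (10 + y))))
      (x := 3) (y := 4) (s.rep hm).one (by omega) (by omega)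
    have e₂ := Exec.load 4 1 (10 + y) (m.setReg 3 (m.arr 1 (m.reg (10 + x))))
    rw [((Same.refl m).setReg (show 2 ≤ 3 ∧ 3 ≤ 5 by omega) _).2 (10 + y) (by omega)] at e₂
    refine ⟨m', ((Exec.load 3 1 _ m).runs.seq (e₂.runs.seq r')).mono (by omega),
      s.trans s', h'.trans ?_⟩
    simp [Mem.setReg, Atm.Holds, hm.name _ (hv x ha.1), hm.name _ (hv y ha.2)]
  | succ x y =>
    have s : Same m (m.setReg 3 (m.reg (10 + x) + m.reg 1)) := (Same.refl m).setReg (by omega) _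
    obtain ⟨m', r', s', h'⟩ := eqTest_runs (m := m.setReg 3 (m.reg (10 + x) + m.reg 1))
      (x := 3) (y := 10 + y) (s.rep hm).one (by omega) (by omega)
    refine ⟨m', ((Exec.add 3 _ 1 m).runs.seq r').mono (by omega), s.trans s', h'.trans ?_⟩
    rw [s.2 (10 + y) (by omega), hm.one]
    simp only [Mem.setReg, Function.update_self, Atm.Holds, eq_comm]
  | root x =>
    refine ⟨_, (Exec.sub 3 1 _ m).runs.mono (by omega), (Same.refl m).setReg (by omega) _, ?_⟩
    simp [Mem.setReg, Atm.Holds, hm.one]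
    omega

/-! ### Nested loops -/

/-- A condition, or its negation if the first component is `false`. -/
abbrev Lit := Bool × Atm

/-- The literal holds for the values `v` of the loop variables. -/
def Lit.Holds (c : Ctx) (D : DB) (v : ℕ → ℕ) (l : Lit) : Prop :=
  if l.1 then l.2.Holds c D v else ¬ l.2.Holds c D v

/-- Run `b` if all the literals hold. -/
def guarded (b : Cmd) : List Lit → Cmd
  | [] => b
  | l :: ls =>
    .seq l.2.cmd (if l.1 then .ite 3 (guarded b ls) .skip else .ite 3 .skip (guarded b ls))

/-- Add the tuple of the first loop variables to the table `p`, or remove it. -/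
def put (p : ℕ) (b : Bool) : Cmd :=
  .seq (index (List.range (ar p))) (.seq (.const 3 (bif b then 1 else 0)) (.store p 2 3))

/-- Run `b` for all values below `n` of the first `d` loop variables. -/
def loops (b : Cmd) : ℕ → Cmd
  | 0 => b
  | d + 1 => .seq (.seq (.const 2 0) (.add (10 + d) 0 2)) (countdown (10 + d) (loops b d))

/-! ### Effects on the database -/

/-- Add the tuples in `M` to the table `p`, or remove them. -/
def mark (D : DB) (p : ℕ) (b : Bool) (M : List ℕ → Prop) : DB :=
  Function.update D p fun xs => (M xs ∧ b = true) ∨ (¬ M xs ∧ D p xs)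

theorem mark_of_ne {D : DB} {p q : ℕ} (b : Bool) (M : List ℕ → Prop) (h : q ≠ p) :
    mark D p b M q = D q := Function.update_of_ne h ..

theorem mark_mark (D : DB) (p : ℕ) (b : Bool) (M N : List ℕ → Prop) :
    mark (mark D p b M) p b N = mark D p b fun xs => M xs ∨ N xs := by
  unfold mark
  rw [Function.update_idem]
  congr 1; funext xs
  simp only [Function.update_self, eq_iff_iff]
  tauto

theorem mark_false (D : DB) (p : ℕ) (b : Bool) : mark D p b (fun _ => False) = D := by
  simp [mark]

theorem Atm.holds_congr {c : Ctx} {D D' : DB} {v w : ℕ → ℕ} {h d : ℕ} (hD : ∀ q ≠ h, D' q = D q)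
    (hv : ∀ t < d, w t = v t) {a : Atm} (ha : a.WF h d = true) :
    a.Holds c D' w ↔ a.Holds c D v := by
  cases a with
  | tab p xs =>
    simp only [WF, Bool.and_eq_true, decide_eq_true_eq, List.all_eq_true] at ha
    simp only [Holds, hD p ha.1.1.2]
    rw [List.map_congr_left fun t ht => hv t (ha.2 t ht)]
  | kind k x => simp only [WF, decide_eq_true_eq] at ha; simp [Holds, hv _ ha]
  | same x y =>
    simp only [WF, Bool.and_eq_true, decide_eq_true_eq] at ha; simp [Holds, hv _ ha.1, hv _ ha.2]
  | succ x y =>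
    simp only [WF, Bool.and_eq_true, decide_eq_true_eq] at ha; simp [Holds, hv _ ha.1, hv _ ha.2]
  | root x => simp only [WF, decide_eq_true_eq] at ha; simp [Holds, hv _ ha]

theorem Lit.holds_congr {c : Ctx} {D D' : DB} {v w : ℕ → ℕ} {h d : ℕ} (hD : ∀ q ≠ h, D' q = D q)
    (hv : ∀ t < d, w t = v t) {l : Lit} (hl : l.2.WF h d = true) :
    l.Holds c D' w ↔ l.Holds c D v := by
  unfold Lit.Holds; rw [Atm.holds_congr hD hv hl]

/-- The values of the loop variables. -/
abbrev Mem.vars (m : Mem) : ℕ → ℕ := fun x => m.reg (10 + x)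

theorem put_runs {c : Ctx} {D : DB} {m : Mem} {p d : ℕ} {b : Bool} (hm : Rep c m D)
    (hp : IsTab p) (hd : ar p ≤ d) (hv : ∀ x < d, m.vars x < c.n) :
    ∃ m', Runs (put p b) m m' 10 ∧
      Rep c m' (mark D p b fun xs => xs = (List.range (ar p)).map m.vars) ∧
      ∀ r, r < 2 ∨ 5 < r → m'.reg r = m.reg r := by
  obtain ⟨m₁, r₁, s₁, h₁⟩ := index_runs (xs := List.range (ar p)) hm
    (by simpa using ar_le p) (fun x hx => hv x (by simp at hx; omega))
  set k := bif b then 1 else 0 with hk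
  have s₂ : Same m (m₁.setReg 3 k) := s₁.setReg (by omega) _
  have e := Exec.store p 2 3 (m₁.setReg 3 k)
  refine ⟨_, (r₁.seq ((Exec.const 3 k m₁).runs.seq e.runs)).mono (by omega), ?_, s₂.2⟩
  have h2 : (m₁.setReg 3 k).reg 2 = enc c.n ((List.range (ar p)).map m.vars) := by
    rw [← h₁]; simp [Mem.setReg]
  have h3 : (m₁.setReg 3 k).reg 3 = k := by simp [Mem.setReg]
  have hs := s₂.rep hm
  rw [h2, h3]
  have ha : ∀ q ≠ p, ((m₁.setReg 3 k).setArr p (enc c.n ((List.range (ar p)).map m.vars)) k).arr q =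
      (m₁.setReg 3 k).arr q := fun q hq => by simp only [Mem.setArr]; rw [Function.update_of_ne hq]
  obtain ⟨hp2, hp8⟩ := hp
  refine ⟨hs.size, hs.one, ?_, ?_, ?_, fun q hq xs hxs => ?_⟩
  · rw [ha 0 (by omega)]; exact hs.kind
  · rw [ha 1 (by omega)]; exact hs.name
  · rw [ha 8 (by omega)]; exact hs.mul
  · by_cases hqp : q = p
    · subst hqp
      simp only [Mem.setArr, mark, Function.update_self]
      by_cases hx : xs = (List.range (ar q)).map m.vars
      · rw [hx, Function.update_self]
        cases b <;> simp [bit, hk]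
      · rw [Function.update_of_ne, hs.tab q hq xs hxs]
        · simp [hx]
        · intro h
          refine hx (encFrom_inj (by simpa using hxs.1) hxs.2 ?_ h).2
          simp only [List.mem_map, List.mem_range, forall_exists_index, and_imp]
          rintro _ t ht rfl
          exact hv t (by omega)
    · rw [ha q hqp, mark_of_ne _ _ hqp, hs.tab q hq xs hxs]

/-- The rule for guards: the postcondition `Q` holds after the body if the literals hold, and holds
already if they do not. Evaluating a literal takes at most 12 steps. -/
theorem guarded_runs {c : Ctx} {h d B : ℕ} {b : Cmd} {Q : Mem → Prop} :
    ∀ {ls : List Lit} {m : Mem} {D : DB}, Rep c m D → (∀ x < d, m.vars x < c.n) →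
    (∀ l ∈ ls, l.2.WF h d = true) →
    ((∀ l ∈ ls, l.Holds c D m.vars) → ∀ m₁, Same m m₁ → ∃ m', Runs b m₁ m' B ∧ Q m') →
    ((¬ ∀ l ∈ ls, l.Holds c D m.vars) → ∀ m₁, Same m m₁ → Q m₁) →
    ∃ m', Runs (guarded b ls) m m' (B + 12 * ls.length) ∧ Q m'
  | [], m, _, _, _, _, hy, _ => by simpa [guarded] using hy (by simp) m (.refl m)
  | (s, a) :: ls, m, D, hm, hv, hw, hy, hn => by
    simp only [List.mem_cons, forall_eq_or_imp] at hw hy hn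
    obtain ⟨m₁, r₁, s₁, h₁⟩ := a.cmd_runs hm hv hw.1
    have hvars : m₁.vars = m.vars := funext fun x => s₁.2 _ (by omega)
    have hskip : ¬ Lit.Holds c D m.vars (s, a) →
        ∃ m', Runs .skip m₁ m' (B + 12 * ls.length + 1) ∧ Q m' := fun hl =>
      ⟨m₁, (Exec.skip m₁).runs.mono (by omega), hn (fun h => hl h.1) m₁ s₁⟩
    have hgo : Lit.Holds c D m.vars (s, a) →
        ∃ m', Runs (guarded b ls) m₁ m' (B + 12 * ls.length) ∧ Q m' := fun hl =>
      guarded_runs (s₁.rep hm) (by rwa [hvars]) hw.2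
        (fun h m₂ s₂ => hy ⟨hl, by rwa [hvars] at h⟩ m₂ (s₁.trans s₂))
        (fun h m₂ s₂ => hn (by rw [hvars] at h; exact fun h' => h h'.2) m₂ (s₁.trans s₂))
    suffices ∃ m', Runs (if s then .ite 3 (guarded b ls) .skip else .ite 3 .skip (guarded b ls))
        m₁ m' (B + 12 * ls.length + 2) ∧ Q m' by
      obtain ⟨m', r', q⟩ := this
      exact ⟨m', (r₁.seq r').mono (by simp; omega), q⟩
    cases s <;> by_cases h3 : m₁.reg 3 = 0
    · obtain ⟨m', ⟨t, ht, r'⟩, q⟩ := hgo (by simp [Lit.Holds, ← h₁, h3])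
      exact ⟨m', ⟨_, by omega, .iteFalse h3 r'⟩, q⟩
    · obtain ⟨m', ⟨t, ht, r'⟩, q⟩ := hskip (by simp [Lit.Holds, ← h₁, h3])
      exact ⟨m', ⟨_, by omega, .iteTrue h3 r'⟩, q⟩
    · obtain ⟨m', ⟨t, ht, r'⟩, q⟩ := hskip (by simp [Lit.Holds, ← h₁, h3])
      exact ⟨m', ⟨_, by omega, .iteFalse h3 r'⟩, q⟩
    · obtain ⟨m', ⟨t, ht, r'⟩, q⟩ := hgo (by simp [Lit.Holds, ← h₁, h3])
      exact ⟨m', ⟨_, by omega, .iteTrue h3 r'⟩, q⟩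

/-- Some values below `n` of the first `d` loop variables, with those of `v` for the others,
satisfy `G`. -/
def ExVars (n d : ℕ) (v : ℕ → ℕ) (G : (ℕ → ℕ) → List ℕ → Prop) (xs : List ℕ) : Prop :=
  ∃ w : ℕ → ℕ, (∀ t, d ≤ t → w t = v t) ∧ (∀ t < d, w t < n) ∧ G w xs

theorem exVars_succ {n d : ℕ} {v : ℕ → ℕ} {G : (ℕ → ℕ) → List ℕ → Prop} {xs : List ℕ} :
    ExVars n (d + 1) v G xs ↔ ∃ j < n, ExVars n d (Function.update v d j) G xs := by
  constructor
  · rintro ⟨w, h, h', g⟩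
    refine ⟨w d, h' d (by omega), w, fun t ht => ?_, fun t ht => h' t (by omega), g⟩
    rcases eq_or_ne t d with rfl | hne
    · simp
    · rw [Function.update_of_ne hne]; exact h t (by omega)
  · rintro ⟨j, hj, w, h, h', g⟩
    refine ⟨w, fun t ht => ?_, fun t ht => ?_, g⟩
    · rw [h t (by omega), Function.update_of_ne (by omega)]
    · rcases eq_or_ne t d with rfl | hne
      · rw [h t le_rfl, Function.update_self]; exact hj
      · exact h' t (by omega)

theorem exVars_congr {n d : ℕ} {v v' : ℕ → ℕ} {G : (ℕ → ℕ) → List ℕ → Prop}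
    (h : ∀ t, d ≤ t → v t = v' t) : ExVars n d v G = ExVars n d v' G := by
  funext xs; unfold ExVars
  congr! 6 with w t ht
  exact h t ht

theorem Rep.setReg {c : Ctx} {m : Mem} {D : DB} (hm : Rep c m D) {r : ℕ} (hr : 2 ≤ r) (k : ℕ) :
    Rep c (m.setReg r k) D where
  size := by simp only [Mem.setReg]; rw [Function.update_of_ne (by omega), hm.size]
  one := by simp only [Mem.setReg]; rw [Function.update_of_ne (by omega), hm.one]
  kind := hm.kind
  name := hm.name
  mul := hm.mul
  tab := hm.tab

/-- If the body adds the tuples in `G v` to the table `p` (or removes them) for the values `v` of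
the loop variables, then the loops do so for the tuples in the union of these sets. The body may
rely on all tables but `p`. -/
theorem loops_runs {c : Ctx} (hn : 0 < c.n) {p d B : ℕ} {b : Bool} {body : Cmd} {D : DB}
    {G : (ℕ → ℕ) → List ℕ → Prop}
    (hbody : ∀ (m : Mem) (D' : DB), Rep c m D' → (∀ q ≠ p, D' q = D q) →
      (∀ x < d, m.vars x < c.n) → ∃ m', Runs body m m' B ∧ Rep c m' (mark D' p b (G m.vars)) ∧
        ∀ r, r < 2 ∨ 5 < r → m'.reg r = m.reg r) :
    ∀ (e : ℕ) (m : Mem) (D' : DB), e ≤ d → Rep c m D' → (∀ q ≠ p, D' q = D q) →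
      (∀ x < d, e ≤ x → m.vars x < c.n) →
      ∃ m', Runs (loops body e) m m' ((B + 6 * e) * c.n ^ e) ∧
        Rep c m' (mark D' p b (ExVars c.n e m.vars G)) ∧
        ∀ r, r < 2 ∨ (5 < r ∧ r < 10) ∨ 10 + e ≤ r → m'.reg r = m.reg r := by
  intro e
  induction e with
  | zero =>
    intro m D' _ hm hD hv
    obtain ⟨m', r', h', s'⟩ := hbody m D' hm hD (fun x hx => hv x hx (by omega))
    refine ⟨m', by simpa [loops] using r', ?_, fun r hr => s' r (by omega)⟩
    convert h' using 2
    funext xs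
    simp only [ExVars, zero_le, forall_const, not_lt_zero, false_imp_iff, true_and, eq_iff_iff]
    constructor
    · rintro ⟨w, h, g⟩
      rwa [funext h] at g
    · exact fun g => ⟨_, fun _ => rfl, g⟩
  | succ e ih =>
    intro m D' hed hm hD hv
    let I : ℕ → Mem → Prop := fun k m' => k ≤ c.n ∧ m'.reg (10 + e) = k ∧
      Rep c m' (mark D' p b fun xs =>
        ∃ j, k ≤ j ∧ j < c.n ∧ ExVars c.n e (Function.update m.vars e j) G xs) ∧
      ∀ r, r < 2 ∨ (5 < r ∧ r < 10) ∨ 10 + (e + 1) ≤ r → m'.reg r = m.reg r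
    have hstart : Runs (.seq (.const 2 0) (.add (10 + e) 0 2)) m
        ((m.setReg 2 0).setReg (10 + e) c.n) 2 := by
      have e₂ := Exec.add (10 + e) 0 2 (m.setReg 2 0)
      have h0 : (m.setReg 2 0).reg 0 + (m.setReg 2 0).reg 2 = c.n := by
        simp [Mem.setReg, hm.size]
      rw [h0] at e₂
      exact (Exec.const 2 0 m).runs.seq e₂.runs
    have hI : I c.n ((m.setReg 2 0).setReg (10 + e) c.n) := by
      refine ⟨le_rfl, by simp [Mem.setReg], ?_, fun r hr => ?_⟩
      · convert (hm.setReg (r := 2) (by omega) 0).setReg (r := 10 + e) (by omega) c.n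
        convert mark_false D' p b with xs
        constructor
        · rintro ⟨j, h, h', -⟩; omega
        · simp
      · simp only [Mem.setReg]
        rw [Function.update_of_ne (by omega), Function.update_of_ne (by omega)]
    obtain ⟨m', r', hk⟩ := Runs.countdown (x := 10 + e) (I := I) (c := loops body e)
      (B := (B + 6 * e) * c.n ^ e)
      (fun k m h => h.2.2.1.one) (fun k m h => h.2.1)
      (fun k m₁ ⟨h₁, h₂, h₃, h₄⟩ => by
        have hx : ∀ x, e ≤ x → (m₁.setReg (10 + e) k).vars x = Function.update m.vars e k x := by
          intro x hx
          rcases eq_or_ne x e with rfl | hne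
          · simp [Mem.setReg, Mem.vars]
          · rw [Function.update_of_ne hne]
            simp only [Mem.setReg, Mem.vars]
            rw [Function.update_of_ne (by omega), h₄ _ (by omega)]
        obtain ⟨m', r', h', s'⟩ := ih (m₁.setReg (10 + e) k) _ (by omega)
          (h₃.setReg (by omega) k) (fun q hq => (mark_of_ne _ _ hq).trans (hD q hq))
          (fun x hxd hex => by
            rw [hx x hex]
            rcases eq_or_ne x e with rfl | hne
            · simp; omega
            · rw [Function.update_of_ne hne]; exact hv x hxd (by omega))
        refine ⟨m', r', by omega, ?_, ?_, fun r hr => ?_⟩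
        · rw [s' _ (by omega)]; simp [Mem.setReg]
        · rw [mark_mark] at h'
          convert h' using 2
          funext xs
          rw [exVars_congr hx, eq_iff_iff]
          constructor
          · rintro ⟨j, hj, hj', h⟩
            rcases eq_or_ne j k with rfl | hne
            · exact .inr h
            · exact .inl ⟨j, by omega, hj', h⟩
          · rintro (⟨j, hj, hj', h⟩ | h)
            · exact ⟨j, by omega, hj', h⟩
            · exact ⟨k, le_rfl, by omega, h⟩
        · rw [s' r (by omega), ← h₄ r hr]
          simp only [Mem.setReg]; rw [Function.update_of_ne (by omega)])
      c.n _ hI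
    refine ⟨m', (hstart.seq r').mono ?_, ?_, hk.2.2.2⟩
    · have h1 : c.n ≤ c.n ^ e * c.n := Nat.le_mul_of_pos_left _ (Nat.pow_pos hn)
      calc _ = (B + 6 * e) * (c.n ^ e * c.n) + 2 * c.n + 3 := by ring
        _ ≤ (B + 6 * e) * (c.n ^ e * c.n) + 6 * (c.n ^ e * c.n) := by omega
        _ = _ := by ring
    · convert hk.2.2.1 using 2
      funext xs
      rw [exVars_succ]
      simp

/-! ### Table definitions -/

/-- A definition of the table `head`: a tuple is in the table if for one of the clauses there are
values for its further variables, whose number is given, that satisfy its literals. Variables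
`0, …, ar head - 1` are the entries of the tuple. -/
structure Def where
  head : ℕ
  clauses : List (ℕ × List Lit)

/-- Some `k` numbers below `n` satisfy `P`. -/
def ExN (n : ℕ) : ℕ → (List ℕ → Prop) → Prop
  | 0, P => P []
  | k + 1, P => ∃ y < n, ExN n k fun ys => P (y :: ys)

theorem exN_iff {n : ℕ} : ∀ {k : ℕ} {P : List ℕ → Prop},
    ExN n k P ↔ ∃ ys : List ℕ, ys.length = k ∧ (∀ y ∈ ys, y < n) ∧ P ys
  | 0, P => by simp [ExN, List.length_eq_zero_iff]
  | k + 1, P => by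
    simp only [ExN, exN_iff]
    constructor
    · rintro ⟨y, hy, ys, rfl, h, hP⟩
      exact ⟨y :: ys, rfl, by simpa using ⟨hy, h⟩, hP⟩
    · rintro ⟨_ | ⟨y, ys⟩, hl, h, hP⟩
      · simp at hl
      · simp only [List.mem_cons, forall_eq_or_imp] at h
        exact ⟨y, h.1, ys, by simpa using hl, h.2, hP⟩

/-- The tuple `xs` satisfies the clause. -/
def ClauseHolds (c : Ctx) (D : DB) (xs : List ℕ) (cl : ℕ × List Lit) : Prop :=
  ExN c.n cl.1 fun ys => ∀ l ∈ cl.2, l.Holds c D fun t => (xs ++ ys).getD t 0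

/-- The meaning of a definition. -/
def Def.sem (c : Ctx) (D : DB) (d : Def) (xs : List ℕ) : Prop :=
  ∃ cl ∈ d.clauses, ClauseHolds c D xs cl

/-- The program that adds the tuples satisfying a clause to the table `p`. -/
def clauseCmd (p : ℕ) (cl : ℕ × List Lit) : Cmd :=
  loops (guarded (put p true) cl.2) (ar p + cl.1)

/-- The program that computes the table: clear it, and add the tuples of each clause. -/
def Def.cmd (d : Def) : Cmd :=
  .seq (loops (put d.head false) (ar d.head))
    (d.clauses.foldr (fun cl b => .seq (clauseCmd d.head cl) b) .skip)

/-- The definition is well-formed and not recursive. -/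
def Def.WF (d : Def) : Bool :=
  decide (IsTab d.head) &&
    d.clauses.all fun cl => cl.2.all fun l => l.2.WF d.head (ar d.head + cl.1)

/-- No clause has more than `q` variables. -/
def Def.dimLE (d : Def) (q : ℕ) : Bool :=
  decide (ar d.head ≤ q) && d.clauses.all fun cl => decide (ar d.head + cl.1 ≤ q)

/-- Only the tuples of node numbers of the right length are stored. -/
theorem Rep.congr {c : Ctx} {m : Mem} {D D' : DB} (hm : Rep c m D)
    (h : ∀ p xs, Valid c.n p xs → (D p xs ↔ D' p xs)) : Rep c m D' :=
  { hm with tab := fun p hp xs hx => by rw [hm.tab p hp xs hx, propext (h p xs hx)] }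

/-- The registers between the intermediate results and the loop variables, which serve as counters,
are unchanged. -/
def Keeps (m m' : Mem) : Prop := ∀ r, 5 < r → r < 10 → m'.reg r = m.reg r

theorem clear_runs {c : Ctx} (hn : 0 < c.n) {p : ℕ} (hp : IsTab p) {m : Mem} {D : DB}
    (hm : Rep c m D) :
    ∃ m', Runs (loops (put p false) (ar p)) m m' (28 * c.n ^ ar p) ∧
      Rep c m' (Function.update D p fun _ => False) ∧ Keeps m m' := by
  obtain ⟨m', r', h', s'⟩ := loops_runs hn (p := p) (d := ar p) (D := D) (b := false)
    (G := fun v xs => xs = (List.range (ar p)).map v)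
    (fun m D' hm _ hv => put_runs hm hp le_rfl hv) (ar p) m D le_rfl hm (fun _ _ => rfl)
    (fun x h h' => by omega)
  refine ⟨m', r'.mono ?_, h'.congr fun q xs hx => ?_, fun r h h' => s' r (by omega)⟩
  · exact Nat.mul_le_mul_right _ (by have := ar_le p; omega)
  · rcases eq_or_ne q p with rfl | hne
    · simp only [mark, Function.update_self, iff_false]
      rintro (⟨-, h⟩ | ⟨h, -⟩)
      · simp at h
      · refine h ⟨fun t => if t < ar q then xs.getD t 0 else m.vars t, fun t ht => ?_,
          fun t ht => ?_, ?_⟩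
        · dsimp only; rw [if_neg (by omega)]
        · dsimp only; rw [if_pos ht, List.getD_eq_getElem _ _ (hx.1 ▸ ht)]
          exact hx.2 _ (List.getElem_mem _)
        · refine List.ext_getElem (by simpa using hx.1) fun i h₁ h₂ => ?_
          simp only [List.length_map, List.length_range] at h₂
          simp [h₂, h₁]
    · rw [mark_of_ne _ _ hne, Function.update_of_ne hne]

theorem clause_runs {c : Ctx} (hn : 0 < c.n) {p : ℕ} (hp : IsTab p) {m : Mem} {D : DB}
    (hm : Rep c m D) {cl : ℕ × List Lit} (hcl : ∀ l ∈ cl.2, l.2.WF p (ar p + cl.1) = true) :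
    ∃ m', Runs (clauseCmd p cl) m m'
        ((10 + 12 * cl.2.length + 6 * (ar p + cl.1)) * c.n ^ (ar p + cl.1)) ∧
      Rep c m' (Function.update D p fun xs => D p xs ∨ ClauseHolds c D xs cl) ∧ Keeps m m' := by
  set d := ar p + cl.1 with hd
  obtain ⟨m', r', h', s'⟩ := loops_runs hn (p := p) (d := d) (D := D) (b := true)
    (body := guarded (put p true) cl.2) (B := 10 + 12 * cl.2.length)
    (G := fun v xs => (∀ l ∈ cl.2, l.Holds c D v) ∧ xs = (List.range (ar p)).map v)
    (fun m D' hm hD hv => by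
      have hiff : (∀ l ∈ cl.2, l.Holds c D' m.vars) ↔ ∀ l ∈ cl.2, l.Holds c D m.vars :=
        forall₂_congr fun l hl => Lit.holds_congr hD (fun _ _ => rfl) (hcl l hl)
      refine guarded_runs hm hv hcl (fun h m₁ s₁ => ?_) (fun h m₁ s₁ => ⟨?_, s₁.2⟩)
      · have hvars : m₁.vars = m.vars := funext fun x => s₁.2 _ (by omega)
        obtain ⟨m', r', h', s'⟩ := put_runs (b := true) (s₁.rep hm) hp (Nat.le_add_right _ cl.1)
          (by rwa [hvars])
        refine ⟨m', r', ?_, fun r hr => (s' r hr).trans (s₁.2 r hr)⟩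
        rw [hvars] at h'
        convert h' using 3
        simp only [and_iff_right_iff_imp]
        exact fun _ => hiff.1 h
      · rw [hiff] at h
        convert s₁.rep hm
        convert mark_false D' p true with xs
        simp only [iff_false, not_and]
        exact fun h' => absurd h' h)
    d m D le_rfl hm (fun _ _ => rfl) (fun x h h' => by omega)
  refine ⟨m', r', h'.congr fun q xs hx => ?_, fun r h h' => s' r (by omega)⟩
  rcases eq_or_ne q p with rfl | hne
  swap
  · rw [mark_of_ne _ _ hne, Function.update_of_ne hne]
  simp only [mark, Function.update_self, and_true]
  suffices ExVars c.n d m.vars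
      (fun v xs => (∀ l ∈ cl.2, l.Holds c D v) ∧ xs = (List.range (ar q)).map v) xs ↔
      ClauseHolds c D xs cl by
    rw [this]; tauto
  unfold ClauseHolds
  rw [exN_iff]
  constructor
  · rintro ⟨w, -, hw, hl, rfl⟩
    refine ⟨(List.range cl.1).map fun t => w (ar q + t), by simp, ?_, fun l h => ?_⟩
    · simp only [List.mem_map, List.mem_range, forall_exists_index, and_imp]
      rintro _ t ht rfl
      exact hw _ (by omega)
    · refine (Lit.holds_congr (fun _ _ => rfl) (fun t ht => ?_) (hcl l h)).2 (hl l h)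
      rcases lt_or_ge t (ar q) with h' | h'
      · rw [List.getD_append _ _ _ _ (by simpa using h')]
        simp [h']
      · rw [List.getD_append_right _ _ _ _ (by simpa using h')]
        have : t - ar q < cl.1 := by omega
        simp [this, h']
  · rintro ⟨ys, hy, hyn, hl⟩
    have hlen : (xs ++ ys).length = d := by simp [hy, hx.1, hd]
    refine ⟨fun t => if t < d then (xs ++ ys).getD t 0 else m.vars t, fun t ht => ?_,
      fun t ht => ?_, fun l h => ?_, ?_⟩
    · dsimp only; rw [if_neg (by omega)]
    · dsimp only; rw [if_pos ht, List.getD_eq_getElem _ _ (by omega)]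
      rcases List.mem_append.1 (List.getElem_mem (l := xs ++ ys) (n := t) (by omega)) with h | h
      · exact hx.2 _ h
      · exact hyn _ h
    · exact (Lit.holds_congr (fun _ _ => rfl) (fun t ht => by rw [if_pos ht]) (hcl l h)).2 (hl l h)
    · refine List.ext_getElem (by simpa using hx.1) fun i h₁ h₂ => ?_
      simp only [List.length_map, List.length_range] at h₂
      have : i < d := by omega
      simp [this, h₁, List.getElem?_append_left h₁]

theorem clauses_runs {p q : ℕ} (hp : IsTab p) : ∀ cls : List (ℕ × List Lit),
    (∀ cl ∈ cls, ∀ l ∈ cl.2, l.2.WF p (ar p + cl.1) = true) → (∀ cl ∈ cls, ar p + cl.1 ≤ q) →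
    ∃ C, ∀ (c : Ctx), 0 < c.n → ∀ (m : Mem) (D : DB), Rep c m D →
      ∃ m', Runs (cls.foldr (fun cl b => .seq (clauseCmd p cl) b) .skip) m m' (C * c.n ^ q) ∧
        Rep c m' (Function.update D p fun xs => D p xs ∨ ∃ cl ∈ cls, ClauseHolds c D xs cl) ∧
        Keeps m m'
  | [], _, _ => ⟨1, fun c hn m D hm => ⟨m, (Exec.skip m).runs.mono (by
      have := Nat.pow_pos (n := q) hn; omega), by simpa using hm, fun _ _ _ => rfl⟩⟩
  | cl :: cls, hw, hq => by
    simp only [List.mem_cons, forall_eq_or_imp] at hw hq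
    obtain ⟨C, hC⟩ := clauses_runs hp cls hw.2 hq.2
    refine ⟨10 + 12 * cl.2.length + 6 * (ar p + cl.1) + C, fun c hn m D hm => ?_⟩
    obtain ⟨m₁, r₁, h₁, k₁⟩ := clause_runs hn hp hm hw.1
    obtain ⟨m₂, r₂, h₂, k₂⟩ := hC c hn m₁ _ h₁
    refine ⟨m₂, (r₁.seq r₂).mono ?_, ?_, fun r h h' => (k₂ r h h').trans (k₁ r h h')⟩
    · rw [Nat.add_mul _ C]
      gcongr
      exact hq.1
    · rw [Function.update_idem] at h₂
      have hD : ∀ cl' ∈ cls, ∀ xs, ClauseHolds c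
          (Function.update D p fun xs => D p xs ∨ ClauseHolds c D xs cl) xs cl' ↔
          ClauseHolds c D xs cl' := by
        intro cl' hcl' xs
        simp only [ClauseHolds, exN_iff]
        refine exists_congr fun ys => and_congr_right fun _ => and_congr_right fun _ =>
          forall₂_congr fun l hl => Lit.holds_congr (fun q hq => Function.update_of_ne hq ..)
            (fun _ _ => rfl) (hw.2 cl' hcl' l hl)
      convert h₂ using 3
      simp only [Function.update_self, List.mem_cons, exists_eq_or_imp, or_assoc]
      rw [exists_congr fun cl' => and_congr_right fun h => hD cl' h _]

/-- A definition with `q` variables is computed in time of order `n ^ q`. -/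
theorem Def.runs {d : Def} {q : ℕ} (hw : d.WF = true) (hq : d.dimLE q = true) :
    ∃ C, ∀ (c : Ctx), 0 < c.n → ∀ (m : Mem) (D : DB), Rep c m D →
      ∃ m', Runs d.cmd m m' (C * c.n ^ q) ∧
        Rep c m' (Function.update D d.head (d.sem c D)) ∧ Keeps m m' := by
  simp only [WF, dimLE, Bool.and_eq_true, decide_eq_true_eq, List.all_eq_true] at hw hq
  obtain ⟨C, hC⟩ := clauses_runs hw.1 d.clauses hw.2 hq.2
  refine ⟨28 + C, fun c hn m D hm => ?_⟩
  obtain ⟨m₁, r₁, h₁, k₁⟩ := clear_runs hn hw.1 hm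
  obtain ⟨m₂, r₂, h₂, k₂⟩ := hC c hn m₁ _ h₁
  refine ⟨m₂, (r₁.seq r₂).mono ?_, ?_, fun r h h' => (k₂ r h h').trans (k₁ r h h')⟩
  · rw [Nat.add_mul _ C]
    gcongr
    exact hq.1
  · rw [Function.update_idem] at h₂
    convert h₂ using 3
    simp only [Function.update_self, false_or, Def.sem]
    refine exists_congr fun cl => and_congr_right fun hcl => ?_
    simp only [ClauseHolds, exN_iff]
    exact exists_congr fun ys => and_congr_right fun _ => and_congr_right fun _ =>
      forall₂_congr fun l hl => (Lit.holds_congr (fun q hq => Function.update_of_ne hq ..)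
        (fun _ _ => rfl) (hw.2 cl hcl l hl)).symm

/-! ### Lists of definitions -/

/-- Compute the tables one after the other. -/
def defsCmd (ds : List Def) : Cmd := ds.foldr (fun d b => .seq d.cmd b) .skip

/-- The effect of computing the tables one after the other. -/
def defsSem (c : Ctx) : List Def → DB → DB
  | [], D => D
  | d :: ds, D => defsSem c ds (Function.update D d.head (d.sem c D))

theorem defs_runs {q : ℕ} : ∀ {ds : List Def},
    (ds.all fun d => d.WF && d.dimLE q) = true →
    ∃ C, ∀ (c : Ctx), 0 < c.n → ∀ (m : Mem) (D : DB), Rep c m D →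
      ∃ m', Runs (defsCmd ds) m m' (C * c.n ^ q) ∧ Rep c m' (defsSem c ds D) ∧ Keeps m m'
  | [], _ => ⟨1, fun c hn m D hm => ⟨m, (Exec.skip m).runs.mono (by
      have := Nat.pow_pos (n := q) hn; omega), hm, fun _ _ _ => rfl⟩⟩
  | d :: ds, h => by
    simp only [List.all_cons, Bool.and_eq_true] at h
    obtain ⟨C, hC⟩ := defs_runs (ds := ds) (q := q) h.2
    obtain ⟨C', hC'⟩ := Def.runs h.1.1 h.1.2
    refine ⟨C' + C, fun c hn m D hm => ?_⟩
    obtain ⟨m₁, r₁, h₁, k₁⟩ := hC' c hn m D hm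
    obtain ⟨m₂, r₂, h₂, k₂⟩ := hC c hn m₁ _ h₁
    exact ⟨m₂, (r₁.seq r₂).mono (by rw [Nat.add_mul]), h₂,
      fun r h h' => (k₂ r h h').trans (k₁ r h h')⟩

/-- The tables that the condition mentions are among `ok`. -/
def Atm.uses (ok : List ℕ) : Atm → Bool
  | .tab p _ => ok.contains p
  | _ => true

/-- Each definition uses only tables among `ok` and those defined before it. -/
def defsUse : List ℕ → List Def → Bool
  | _, [] => true
  | ok, d :: ds => (d.clauses.all fun cl => cl.2.all fun l => l.2.uses ok) &&
      defsUse (d.head :: ok) ds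

/-- `D` and `T` have the same table `p`. -/
def Agree (n : ℕ) (D T : DB) (p : ℕ) : Prop := ∀ xs, Valid n p xs → (D p xs ↔ T p xs)

theorem Def.sem_congr {c : Ctx} {D T : DB} {ok : List ℕ} {d : Def} (hw : d.WF = true)
    (hu : (d.clauses.all fun cl => cl.2.all fun l => l.2.uses ok) = true)
    (h : ∀ p ∈ ok, Agree c.n D T p) {xs : List ℕ} (hx : Valid c.n d.head xs) :
    d.sem c D xs ↔ d.sem c T xs := by
  simp only [WF, Bool.and_eq_true, List.all_eq_true] at hw hu
  refine exists_congr fun cl => and_congr_right fun hcl => ?_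
  simp only [ClauseHolds, exN_iff]
  refine exists_congr fun ys => and_congr_right fun hy => and_congr_right fun hyn =>
    forall₂_congr fun l hl => ?_
  suffices l.2.Holds c D (fun t => (xs ++ ys).getD t 0) ↔
      l.2.Holds c T (fun t => (xs ++ ys).getD t 0) by
    unfold Lit.Holds; rw [this]
  have h₁ := hw.2 cl hcl l hl
  have h₂ := hu cl hcl l hl
  rcases l with ⟨s, ⟨p, zs⟩ | _ | _ | _ | _⟩
  rotate_left
  iterate 4 rfl
  · simp only [Atm.WF, Atm.uses, Bool.and_eq_true, decide_eq_true_eq, List.all_eq_true,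
      List.contains_iff_mem] at h₁ h₂
    refine h _ h₂ _ ⟨by simpa using h₁.1.2, ?_⟩
    simp only [List.mem_map, forall_exists_index, and_imp]
    rintro _ t ht rfl
    have : t < (xs ++ ys).length := by simpa [hy, hx.1] using h₁.2 t ht
    rw [List.getD_eq_getElem _ _ this]
    rcases List.mem_append.1 (List.getElem_mem this) with h | h
    · exact hx.2 _ h
    · exact hyn _ h

/-- If the intended tables `T` solve the definitions, then computing the definitions one after the
other yields `T`. -/
theorem defsSem_agree {c : Ctx} {T : DB} : ∀ {ds : List Def} {ok : List ℕ} {D : DB},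
    (ds.all fun d => d.WF) = true → defsUse ok ds = true → (∀ p ∈ ok, Agree c.n D T p) →
    (∀ d ∈ ds, ∀ xs, Valid c.n d.head xs → (d.sem c T xs ↔ T d.head xs)) →
    ∀ p, p ∈ ok ∨ p ∈ ds.map Def.head → Agree c.n (defsSem c ds D) T p
  | [], _, _, _, _, h, _, p, hp => h p (by simpa using hp)
  | d :: ds, ok, D, hw, hu, h, hT, p, hp => by
    simp only [List.all_cons, defsUse, Bool.and_eq_true, List.mem_cons, forall_eq_or_imp]
      at hw hu hT
    refine defsSem_agree (ds := ds) (ok := d.head :: ok) hw.2 hu.2 (fun q hq xs hx => ?_) hT.2 p ?_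
    · rcases eq_or_ne q d.head with rfl | hne
      · rw [Function.update_self, Def.sem_congr hw.1 hu.1 h hx, hT.1 xs hx]
      · rw [Function.update_of_ne hne]
        exact h q (by simpa [hne] using hq) xs hx
    · simp only [List.map_cons, List.mem_cons] at hp ⊢
      tauto

theorem defsSem_of_notMem {c : Ctx} : ∀ {ds : List Def} {D : DB} {p : ℕ},
    p ∉ ds.map Def.head → defsSem c ds D p = D p
  | [], _, _, _ => rfl
  | d :: ds, D, p, h => by
    simp only [List.map_cons, List.mem_cons, not_or] at h
    rw [defsSem, defsSem_of_notMem h.2, Function.update_of_ne h.1]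

/-! ### Repeated computation and initialization -/

/-- Compute the tables `n` times. -/
def rounds (ds : List Def) : Cmd :=
  .seq (.seq (.const 2 0) (.add 7 0 2)) (countdown 7 (defsCmd ds))

theorem rounds_runs {q : ℕ} {ds : List Def} (h : (ds.all fun d => d.WF && d.dimLE q) = true) :
    ∃ C, ∀ (c : Ctx), 0 < c.n → ∀ (m : Mem) (D : DB), Rep c m D →
      ∃ m', Runs (rounds ds) m m' (C * c.n ^ (q + 1)) ∧ Rep c m' ((defsSem c ds)^[c.n] D) ∧
        m'.reg 6 = m.reg 6 := by
  obtain ⟨C, hC⟩ := defs_runs h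
  refine ⟨C + 5, fun c hn m D hm => ?_⟩
  let I : ℕ → Mem → Prop := fun k m' => k ≤ c.n ∧ m'.reg 7 = k ∧
    Rep c m' ((defsSem c ds)^[c.n - k] D) ∧ m'.reg 6 = m.reg 6
  have hstart : Runs (.seq (.const 2 0) (.add 7 0 2)) m ((m.setReg 2 0).setReg 7 c.n) 2 := by
    have e₂ := Exec.add 7 0 2 (m.setReg 2 0)
    have h0 : (m.setReg 2 0).reg 0 + (m.setReg 2 0).reg 2 = c.n := by simp [Mem.setReg, hm.size]
    rw [h0] at e₂
    exact (Exec.const 2 0 m).runs.seq e₂.runs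
  obtain ⟨m', r', h'⟩ := Runs.countdown (x := 7) (I := I) (c := defsCmd ds) (B := C * c.n ^ q)
    (fun k m h => h.2.2.1.one) (fun k m h => h.2.1)
    (fun k m₁ ⟨h₁, h₂, h₃, h₄⟩ => by
      obtain ⟨m', r', h', k'⟩ := hC c hn _ _ (h₃.setReg (r := 7) (by omega) k)
      refine ⟨m', r', by omega, ?_, ?_, ?_⟩
      · rw [k' 7 (by omega) (by omega)]; simp [Mem.setReg]
      · rwa [← Function.iterate_succ_apply' (defsSem c ds),
          show (c.n - (k + 1)).succ = c.n - k by omega] at h'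
      · rw [k' 6 (by omega) (by omega), ← h₄]; simp [Mem.setReg])
    c.n ((m.setReg 2 0).setReg 7 c.n) ⟨le_rfl, by simp [Mem.setReg], by
      simpa using (hm.setReg (r := 2) (by omega) 0).setReg (r := 7) (by omega) c.n,
      by simp [Mem.setReg]⟩
  refine ⟨m', (hstart.seq r').mono ?_, by simpa using h'.2.2.1, h'.2.2.2⟩
  have h1 : c.n ≤ c.n ^ q * c.n := Nat.le_mul_of_pos_left _ (Nat.pow_pos hn)
  calc _ = C * (c.n ^ q * c.n) + 2 * c.n + 3 := by ring
    _ ≤ C * (c.n ^ q * c.n) + 5 * (c.n ^ q * c.n) := by omega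
    _ = _ := by rw [pow_succ]; ring

/-- The program that tabulates the multiples of `n`, and starts the counter in register 6 at `8 * n
^ 3`. The machine has no multiplication: `n ^ 2` is found by repeated addition, and `n ^ 3` is then
looked up in the table. -/
def prelude : Cmd :=
  .seq (.const 1 1) <| .seq (.add 10 0 3) <| .seq (countdown 10 (.add 3 3 0)) <|
  .seq (.add 10 3 1) <| .seq (.const 3 0) <|
  .seq (countdown 10 (.seq (.store 8 2 3) (.seq (.add 2 2 1) (.add 3 3 0)))) <|
  .seq (.load 6 8 0) <| .seq (.load 6 8 6) <|
  .seq (.add 6 6 6) (.seq (.add 6 6 6) (.add 6 6 6))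

theorem prelude_runs {c : Ctx} (hn : 0 < c.n) {m : Mem} (hreg : ∀ r ≠ 0, m.reg r = 0)
    (h0 : m.reg 0 = c.n) (hk : ∀ i < c.n, m.arr 0 i = c.kd i) (hm : ∀ i < c.n, m.arr 1 i = c.nm i)
    (ha : ∀ p ≥ 2, ∀ i, m.arr p i = 0) :
    ∃ m', Runs prelude m m' (30 * c.n ^ 2) ∧ Rep c m' (fun _ _ => False) ∧
      m'.reg 6 = 8 * c.n ^ 3 := by
  have e₁ := Exec.const 1 1 m
  have e₂ := Exec.add 10 0 3 (m.setReg 1 1)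
  have hv : (m.setReg 1 1).reg 0 + (m.setReg 1 1).reg 3 = c.n := by
    simp [Mem.setReg, h0, hreg]
  rw [hv] at e₂
  -- register 3 accumulates the square of `n`
  let I : ℕ → Mem → Prop := fun k m' => k ≤ c.n ∧ m'.reg 10 = k ∧ m'.reg 3 = (c.n - k) * c.n ∧
    m'.reg 0 = c.n ∧ m'.reg 1 = 1 ∧ m'.reg 2 = 0 ∧ m'.arr = m.arr
  obtain ⟨m₃, r₃, -, hx₃, h₃, h₃0, h₃1, h₃2, ha₃⟩ := Runs.countdown (x := 10) (I := I)
    (c := .add 3 3 0) (B := 1)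
    (fun k m h => h.2.2.2.2.1) (fun k m h => h.2.1)
    (fun k m₁ ⟨h₁, h₂, h₃, h₄, h₅, h₆, h₇⟩ => by
      refine ⟨_, (Exec.add 3 3 0 _).runs, by omega, by simp [Mem.setReg], ?_,
        by simpa [Mem.setReg] using h₄, by simpa [Mem.setReg] using h₅,
        by simpa [Mem.setReg] using h₆, h₇⟩
      rw [show c.n - k = c.n - (k + 1) + 1 by omega, Nat.add_mul, Nat.one_mul]
      simp [Mem.setReg, h₃, h₄])
    c.n ((m.setReg 1 1).setReg 10 c.n) ⟨le_rfl, by simp [Mem.setReg], by simp [Mem.setReg, hreg],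
      by simp [Mem.setReg, h0], by simp [Mem.setReg], by simp [Mem.setReg, hreg], rfl⟩
  rw [Nat.sub_zero, ← sq] at h₃
  have e₄ := Exec.add 10 3 1 m₃
  rw [h₃, h₃1] at e₄
  have e₅ := Exec.const 3 0 (m₃.setReg 10 (c.n ^ 2 + 1))
  -- register 2 runs through the indices, and register 3 through the multiples of `n`
  let J : ℕ → Mem → Prop := fun k m' => k ≤ c.n ^ 2 + 1 ∧ m'.reg 10 = k ∧
    m'.reg 2 = c.n ^ 2 + 1 - k ∧ m'.reg 3 = (c.n ^ 2 + 1 - k) * c.n ∧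
    m'.reg 0 = c.n ∧ m'.reg 1 = 1 ∧ (∀ p ≠ 8, m'.arr p = m.arr p) ∧
    ∀ i < c.n ^ 2 + 1 - k, m'.arr 8 i = i * c.n
  obtain ⟨m₆, r₆, -, -, -, -, h₆0, h₆1, ha₆, hmul⟩ := Runs.countdown (x := 10) (I := J)
    (c := .seq (.store 8 2 3) (.seq (.add 2 2 1) (.add 3 3 0))) (B := 3)
    (fun k m h => h.2.2.2.2.2.1) (fun k m h => h.2.1)
    (fun k m₁ ⟨h₁, h₂, h₃, h₄, h₅, h₆, h₇, h₈⟩ => by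
      have hk : c.n ^ 2 + 1 - k = c.n ^ 2 + 1 - (k + 1) + 1 := by omega
      refine ⟨_, (Exec.seq (.store _ _ _ _) (.seq (.add _ _ _ _) (.add _ _ _ _))).runs, by omega,
        by simp [Mem.setReg, Mem.setArr], ?_, ?_, ?_, ?_, ?_, ?_⟩
      · rw [hk]; simp [Mem.setReg, Mem.setArr, h₃, h₆]
      · rw [hk, Nat.add_mul, Nat.one_mul]; simp [Mem.setReg, Mem.setArr, h₄, h₅]
      · simpa [Mem.setReg, Mem.setArr] using h₅
      · simpa [Mem.setReg, Mem.setArr] using h₆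
      · intro p hp
        simp only [Mem.setReg, Mem.setArr, ← h₇ p hp]
        exact Function.update_of_ne hp ..
      · intro i hi
        have h2 : Function.update m₁.reg 10 k 2 = c.n ^ 2 + 1 - (k + 1) := by simp [h₃]
        have h3 : Function.update m₁.reg 10 k 3 = (c.n ^ 2 + 1 - (k + 1)) * c.n := by simp [h₄]
        simp only [Mem.setReg, Mem.setArr, Function.update_self, h2, h3]
        rcases eq_or_ne i (c.n ^ 2 + 1 - (k + 1)) with rfl | hne
        · rw [Function.update_self]
        · rw [Function.update_of_ne hne]
          exact h₈ i (by omega))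
    (c.n ^ 2 + 1) ((m₃.setReg 10 (c.n ^ 2 + 1)).setReg 3 0) ⟨le_rfl, by simp [Mem.setReg],
      by simpa [Mem.setReg] using h₃2, by simp [Mem.setReg], by simpa [Mem.setReg] using h₃0,
      by simpa [Mem.setReg] using h₃1, fun p _ => by rw [← ha₃]; rfl, fun i hi => by omega⟩
  rw [Nat.sub_zero] at hmul
  have hnn : c.n ≤ c.n ^ 2 := by rw [sq]; exact Nat.le_mul_of_pos_left _ hn
  have e₇ := Exec.load 6 8 0 m₆
  rw [h₆0, hmul c.n (by omega), ← sq] at e₇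
  have e₈ := Exec.load 6 8 6 (m₆.setReg 6 (c.n ^ 2))
  rw [show (m₆.setReg 6 (c.n ^ 2)).arr 8 ((m₆.setReg 6 (c.n ^ 2)).reg 6) = c.n ^ 3 by
    simp only [Mem.setReg, Function.update_self]
    rw [hmul _ (by omega), ← pow_succ]] at e₈
  refine ⟨_, (e₁.runs.seq <| e₂.runs.seq <| r₃.seq <| e₄.runs.seq <| e₅.runs.seq <| r₆.seq <|
    e₇.runs.seq <| e₈.runs.seq (Exec.seq (.add _ _ _ _) (.seq (.add _ _ _ _)
      (.add _ _ _ _))).runs).mono ?_, ?_, ?_⟩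
  · nlinarith
  · refine ⟨by simpa [Mem.setReg] using h₆0, by simpa [Mem.setReg] using h₆1, ?_, ?_, ?_, ?_⟩
    · intro i hi; simpa [Mem.setReg, ha₆] using hk i hi
    · intro i hi; simpa [Mem.setReg, ha₆] using hm i hi
    · intro i hi; simpa [Mem.setReg] using hmul i (by omega)
    · intro p hp xs _
      simp [Mem.setReg, ha₆ p hp.2, ha p hp.1, bit]
  · simp [Mem.setReg]; ring

/-! ### Nodes of the syntax tree -/

/-- The kind of the top node of an expression. -/
def Exp.kind : Exp → ℕ
  | .letin _ _ _ _ => 4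
  | .call _ _ => 3
  | .ret (.lam _ _) => 2
  | .ret (.var _) => 1

/-- The identifier at the top node of an expression, zero if there is none. -/
def Exp.name : Exp → ℕ
  | .letin v _ _ _ => v
  | .call _ _ => 0
  | .ret (.lam v _) => v
  | .ret (.var v) => v

mutual
theorem Exp.length_points : ∀ (x : Exp) (ρ : Env Var), (x.points ρ).length = x.size
  | .letin v f a b, ρ => by
    simp [Exp.points, Exp.size, f.length_points, a.length_points, b.length_points]; omega
  | .call f a, ρ => by simp [Exp.points, Exp.size, f.length_points, a.length_points]; omega
  | .ret a, ρ => a.length_points ρ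
theorem Atom.length_points : ∀ (a : Atom) (ρ : Env Var), (a.points ρ).length = a.size
  | .var v, ρ => rfl
  | .lam v b, ρ => by simp [Atom.points, Atom.size, b.length_points]; omega
end

mutual
theorem Exp.code_eq : ∀ (x : Exp) (ρ : Env Var),
    x.code = (x.points ρ).map fun ψ => (ψ.1.kind, ψ.1.name)
  | .letin v f a b, ρ => by
    simp only [Exp.points, Exp.code, f.code_eq ρ, a.code_eq ρ, b.code_eq (ρ.bind v v),
      List.map_cons, List.map_append]
    rfl
  | .call f a, ρ => by
    simp only [Exp.points, Exp.code, f.code_eq ρ, a.code_eq ρ, List.map_cons, List.map_append]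
    rfl
  | .ret a, ρ => a.code_eq ρ
theorem Atom.code_eq : ∀ (a : Atom) (ρ : Env Var),
    a.code = (a.points ρ).map fun ψ => (ψ.1.kind, ψ.1.name)
  | .var v, ρ => rfl
  | .lam v b, ρ => by
    simp only [Atom.points, Atom.code, b.code_eq (ρ.bind v v), List.map_cons]
    rfl
end

theorem Exp.size_pos : ∀ x : Exp, 0 < x.size
  | .letin _ _ _ _ => by simp only [Exp.size]; omega
  | .call _ _ => by simp only [Exp.size]; omega
  | .ret (.var _) => by simp [Exp.size, Atom.size]
  | .ret (.lam _ _) => by simp [Exp.size, Atom.size]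

theorem Exp.points_eq_cons (x : Exp) (ρ : Env Var) : ∃ l, x.points ρ = (x, ρ) :: l := by
  rcases x with _ | _ | ⟨_ | _⟩ <;> simp [Exp.points, Atom.points]

/-- `At e i x ρ`: the subexpression at node `i` of `e` is `x`, with the variables in `ρ` in scope.
-/
inductive At (e : Exp) : ℕ → Exp → Env Var → Prop
  | root : At e 0 e Env.empty
  | letCall {i v f a b ρ} : At e i (.letin v f a b) ρ → At e (i + 1) (.call f a) ρ
  | letBody {i v f a b ρ} : At e i (.letin v f a b) ρ →
      At e (i + 1 + (Exp.call f a).size) b (ρ.bind v v)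
  | callFun {i f a ρ} : At e i (.call f a) ρ → At e (i + 1) (.ret f) ρ
  | callArg {i f a ρ} : At e i (.call f a) ρ → At e (i + 1 + (Exp.ret f).size) (.ret a) ρ
  | lamBody {i v b ρ} : At e i (.ret (.lam v b)) ρ → At e (i + 1) b (ρ.bind v v)

theorem At.segment {e : Exp} {i : ℕ} {x : Exp} {ρ : Env Var} (h : At e i x ρ) :
    ∃ l r, e.points Env.empty = l ++ x.points ρ ++ r ∧ l.length = i := by
  induction h with
  | root => exact ⟨[], [], by simp, rfl⟩
  | @letCall i v f a b ρ _ ih =>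
    obtain ⟨l, r, h, rfl⟩ := ih
    exact ⟨l ++ [(.letin v f a b, ρ)], b.points (ρ.bind v v) ++ r, by simp [h, Exp.points], by simp⟩
  | @letBody i v f a b ρ _ ih =>
    obtain ⟨l, r, h, rfl⟩ := ih
    exact ⟨l ++ (.letin v f a b, ρ) :: (Exp.call f a).points ρ, r, by simp [h, Exp.points],
      by simp [Exp.length_points]; omega⟩
  | @callFun i f a ρ _ ih =>
    obtain ⟨l, r, h, rfl⟩ := ih
    exact ⟨l ++ [(.call f a, ρ)], a.points ρ ++ r, by simp [h, Exp.points], by simp⟩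
  | @callArg i f a ρ _ ih =>
    obtain ⟨l, r, h, rfl⟩ := ih
    exact ⟨l ++ (.call f a, ρ) :: f.points ρ, r, by simp [h, Exp.points],
      by simp [Atom.length_points, Exp.size]; omega⟩
  | @lamBody i v b ρ _ ih =>
    obtain ⟨l, r, h, rfl⟩ := ih
    exact ⟨l ++ [(.ret (.lam v b), ρ)], r, by simp [h, Exp.points, Atom.points], by simp⟩

theorem At.isPoint {e : Exp} {i : ℕ} {x : Exp} {ρ : Env Var} (h : At e i x ρ) :
    IsPoint e i (x, ρ) := by
  obtain ⟨l, r, hs, rfl⟩ := h.segment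
  obtain ⟨l', h'⟩ := x.points_eq_cons ρ
  simp [IsPoint, hs, h']

theorem At.cover {e : Exp} : ∀ {x : Exp} {i : ℕ} {ρ : Env Var}, At e i x ρ → ∀ k < x.size,
    ∃ y ρ', At e (i + k) y ρ'
  | x, i, ρ, h, 0, _ => ⟨x, ρ, h⟩
  | .letin v f a b, i, ρ, h, k + 1, hk => by
    rcases lt_or_ge k (Exp.call f a).size with h' | h'
    · rw [Nat.add_comm k, ← Nat.add_assoc]
      exact h.letCall.cover k h'
    · have := h.letBody.cover (k - (Exp.call f a).size) (by simp [Exp.size] at *; omega)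
      rwa [show i + 1 + (Exp.call f a).size + (k - (Exp.call f a).size) = i + (k + 1) by omega]
        at this
  | .call f a, i, ρ, h, k + 1, hk => by
    rcases lt_or_ge k (Exp.ret f).size with h' | h'
    · rw [Nat.add_comm k, ← Nat.add_assoc]
      exact h.callFun.cover k h'
    · have := h.callArg.cover (k - (Exp.ret f).size) (by simp [Exp.size] at *; omega)
      rwa [show i + 1 + (Exp.ret f).size + (k - (Exp.ret f).size) = i + (k + 1) by omega]
        at this
  | .ret (.lam v b), i, ρ, h, k + 1, hk => by
    rw [Nat.add_comm k, ← Nat.add_assoc]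
    exact h.lamBody.cover k (by simp [Exp.size, Atom.size] at hk; omega)
  | .ret (.var v), i, ρ, h, k + 1, hk => by simp [Exp.size, Atom.size] at hk
termination_by x => x.size
decreasing_by
  all_goals simp [Exp.size, Atom.size]
  all_goals omega

/-- The partial control state at node `i`; the root state, as a junk value, if there is no such
node. -/
def pt (e : Exp) (i : ℕ) : PState Var := (e.points Env.empty).getD i (e, Env.empty)

theorem isPoint_iff {e : Exp} {i : ℕ} {ψ : PState Var} :
    IsPoint e i ψ ↔ i < e.size ∧ pt e i = ψ := by
  unfold IsPoint pt
  rw [List.getElem?_eq_some_iff, ← e.length_points Env.empty]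
  refine ⟨fun ⟨h, h'⟩ => ⟨h, ?_⟩, fun ⟨h, h'⟩ => ⟨h, ?_⟩⟩
  · rw [List.getD_eq_getElem _ _ h, h']
  · rwa [List.getD_eq_getElem _ _ h] at h'

theorem at_iff {e : Exp} {i : ℕ} {x : Exp} {ρ : Env Var} :
    At e i x ρ ↔ i < e.size ∧ pt e i = (x, ρ) := by
  refine ⟨fun h => isPoint_iff.1 h.isPoint, fun ⟨h, h'⟩ => ?_⟩
  obtain ⟨y, ρ', hy⟩ := At.root.cover i h
  rw [Nat.zero_add] at hy
  have := (isPoint_iff.1 hy.isPoint).2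
  rw [h', Prod.mk.injEq] at this
  rwa [this.1, this.2]

/-- The input as the programs see it. -/
def ctx (e : Exp) : Ctx := ⟨e.size, fun i => (pt e i).1.kind, fun i => (pt e i).1.name⟩

theorem code_getD {e : Exp} {i : ℕ} (h : i < e.size) :
    e.code.getD i (0, 0) = ((pt e i).1.kind, (pt e i).1.name) := by
  have h' : i < (e.points Env.empty).length := by rwa [e.length_points]
  rw [e.code_eq Env.empty, List.getD_eq_getElem _ _ (by simpa using h'), pt,
    List.getD_eq_getElem _ _ h', List.getElem_map]

/-- The size of the subtree at node `i`. -/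
def sz (e : Exp) (i : ℕ) : ℕ := (pt e i).1.size

/-- The second child of node `i` if it is a call or a `let`. -/
def snd (e : Exp) (i : ℕ) : ℕ := i + 1 + sz e (i + 1)

section

variable {e : Exp} {i : ℕ}

theorem pt_zero : pt e 0 = (e, Env.empty) := (at_iff.1 At.root).2

theorem pt_letin {v : Var} {f a : Atom} {b : Exp} {ρ : Env Var} (hi : i < e.size)
    (h : pt e i = (.letin v f a b, ρ)) :
    (i + 1 < e.size ∧ pt e (i + 1) = (.call f a, ρ)) ∧
      snd e i < e.size ∧ pt e (snd e i) = (b, ρ.bind v v) := by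
  have h₀ := at_iff.2 ⟨hi, h⟩
  have h₁ := at_iff.1 h₀.letCall
  have h₂ := at_iff.1 h₀.letBody
  refine ⟨h₁, ?_⟩
  rwa [snd, sz, h₁.2]

theorem pt_call {f a : Atom} {ρ : Env Var} (hi : i < e.size) (h : pt e i = (.call f a, ρ)) :
    (i + 1 < e.size ∧ pt e (i + 1) = (.ret f, ρ)) ∧
      snd e i < e.size ∧ pt e (snd e i) = (.ret a, ρ) := by
  have h₀ := at_iff.2 ⟨hi, h⟩
  have h₁ := at_iff.1 h₀.callFun
  have h₂ := at_iff.1 h₀.callArg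
  refine ⟨h₁, ?_⟩
  rwa [snd, sz, h₁.2]

theorem pt_lam {v : Var} {b : Exp} {ρ : Env Var} (hi : i < e.size)
    (h : pt e i = (.ret (.lam v b), ρ)) :
    i + 1 < e.size ∧ pt e (i + 1) = (b, ρ.bind v v) :=
  at_iff.1 (at_iff.2 ⟨hi, h⟩).lamBody

/-- The parent of a node, and how the scopes of the two nodes differ. -/
theorem parent (h0 : i ≠ 0) (hi : i < e.size) : ∃ p < i, p < e.size ∧
    (((ctx e).kd p ≠ 1 ∧ (ctx e).kd p ≠ 2 ∧ i = p + 1 ∧ (pt e i).2 = (pt e p).2) ∨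
    ((ctx e).kd p = 3 ∧ i = snd e p ∧ (pt e i).2 = (pt e p).2) ∨
    ((ctx e).kd p = 2 ∧ i = p + 1 ∧
      (pt e i).2 = (pt e p).2.bind ((ctx e).nm p) ((ctx e).nm p)) ∨
    ((ctx e).kd p = 4 ∧ i = snd e p ∧
      (pt e i).2 = (pt e p).2.bind ((ctx e).nm p) ((ctx e).nm p))) := by
  obtain ⟨x, ρ, hx⟩ : ∃ x ρ, At e i x ρ := ⟨_, _, at_iff.2 ⟨hi, rfl⟩⟩
  have hsnd : ∀ p, p < snd e p := fun p => by unfold snd; omega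
  cases hx with
  | root => exact absurd rfl h0
  | @letCall p v f a b ρ h =>
    obtain ⟨hp, h⟩ := at_iff.1 h
    refine ⟨p, by omega, hp, .inl ?_⟩
    simp [ctx, h, Exp.kind, (pt_letin hp h).1.2]
  | @letBody p v f a b ρ h =>
    obtain ⟨hp, h⟩ := at_iff.1 h
    have h' := pt_letin hp h
    have hs : p + 1 + (Exp.call f a).size = snd e p := by rw [snd, sz, h'.1.2]
    refine ⟨p, by omega, hp, .inr (.inr (.inr ?_))⟩
    simp [ctx, h, Exp.kind, Exp.name, hs, h'.2.2]
  | @callFun p f a ρ h =>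
    obtain ⟨hp, h⟩ := at_iff.1 h
    refine ⟨p, by omega, hp, .inl ?_⟩
    simp [ctx, h, Exp.kind, (pt_call hp h).1.2]
  | @callArg p f a ρ h =>
    obtain ⟨hp, h⟩ := at_iff.1 h
    have h' := pt_call hp h
    have hs : p + 1 + (Exp.ret f).size = snd e p := by rw [snd, sz, h'.1.2]
    refine ⟨p, by omega, hp, .inr (.inl ?_)⟩
    simp [ctx, h, Exp.kind, hs, h'.2.2]
  | @lamBody p v b ρ h =>
    obtain ⟨hp, h⟩ := at_iff.1 h
    refine ⟨p, by omega, hp, .inr (.inr (.inl ?_))⟩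
    simp [ctx, h, Exp.kind, Exp.name, (pt_lam hp h).2]

/-- Environments bind variables to themselves, and only variables that occur in the program. -/
theorem env_pt (hi : i < e.size) {v w : Var} (h : (pt e i).2 v = some w) :
    w = v ∧ ∃ x < e.size, (ctx e).nm x = v := by
  induction i using Nat.strong_induction_on with
  | _ i ih =>
    rcases eq_or_ne i 0 with rfl | h0
    · simp [pt_zero, Env.empty] at h
    obtain ⟨p, hpi, hp, ⟨-, -, -, h'⟩ | ⟨-, -, h'⟩ | ⟨-, -, h'⟩ | ⟨-, -, h'⟩⟩ := parent h0 hi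
    · exact ih p hpi hp (h' ▸ h)
    · exact ih p hpi hp (h' ▸ h)
    all_goals
      rw [h', Env.bind] at h
      rcases eq_or_ne v ((ctx e).nm p) with rfl | hne
      · rw [Function.update_self, Option.some_inj] at h
        exact ⟨h.symm, p, hp, rfl⟩
      · rw [Function.update_of_ne hne] at h
        exact ih p hpi hp h

/-- Environments agree if they bind the same of the identifiers in the program. -/
theorem env_eq_iff {j : ℕ} (hi : i < e.size) (hj : j < e.size) :
    (pt e i).2 = (pt e j).2 ↔ ∀ x < e.size,
      ((pt e i).2 ((ctx e).nm x) ≠ none ↔ (pt e j).2 ((ctx e).nm x) ≠ none) := by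
  refine ⟨fun h x _ => by rw [h], fun h => funext fun v => ?_⟩
  cases h₁ : (pt e i).2 v with
  | some w =>
    obtain ⟨rfl, x, hx, rfl⟩ := env_pt hi h₁
    have := (h x hx).1 (by simp [h₁])
    obtain ⟨w, hw⟩ := Option.ne_none_iff_exists'.1 this
    rw [hw, (env_pt hj hw).1]
  | none =>
    cases h₂ : (pt e j).2 v with
    | none => rfl
    | some w =>
      obtain ⟨rfl, x, hx, rfl⟩ := env_pt hj h₂
      exact absurd h₁ ((h x hx).2 (by simp [h₂]))

end

/-! ### Transitions and monotonicity -/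

theorem aeval_mono {A : Type} {a : Atom} {ρ : Env A} {σ τ : Store A} (h : σ ≤ τ) :
    aeval a ρ σ ≤ aeval a ρ τ := by
  cases a with
  | lam v e => exact le_rfl
  | var v => exact fun c ⟨a, h₁, h₂⟩ => ⟨a, h₁, h a h₂⟩

theorem Store.single_mono {A : Type} {a : A} {D D' : Set (Clo A)} (h : D ≤ D') :
    Store.single a D ≤ Store.single a D' := fun _ _ ⟨h₁, h₂⟩ => ⟨h₁, h h₂⟩

/-- `ψ` is a `let` that pushes the frame `φ` on the way to `ψ'`. -/
def IsPush (ψ : PState Var) (φ : Frame Var) (ψ' : PState Var) : Prop :=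
  ∃ v f a b ρ, ψ = (.letin v f a b, ρ) ∧ φ = (v, b, ρ) ∧ ψ' = (.call f a, ρ)

/-- The state in which a value is returned to the frame. -/
def Frame.target (φ : Frame Var) : PState Var := (φ.2.1, φ.2.2.bind φ.1 φ.1)

/-- The state in which the body of the closure is run. -/
def Clo.target (c : Clo Var) : PState Var := (c.1.2, c.2.bind c.1.1 c.1.1)

theorem pstep_push {σ σ' : Store Var} {ψ ψ' : PState Var} {φ : Frame Var} :
    PStep mono σ ψ (.push φ) (ψ', σ') ↔ IsPush ψ φ ψ' ∧ σ' = σ := by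
  constructor
  · intro h
    obtain ⟨x, ρ⟩ := ψ
    obtain ⟨y, ρ'⟩ := ψ'
    have := h []
    cases this with
    | push v f a b => exact ⟨⟨v, f, a, b, ρ, rfl, rfl, rfl⟩, rfl⟩
  · rintro ⟨⟨v, f, a, b, ρ, rfl, rfl, rfl⟩, rfl⟩ κ
    exact .push ..

theorem pstep_eps {σ σ' : Store Var} {ψ ψ' : PState Var} :
    PStep mono σ ψ .eps (ψ', σ') ↔ ∃ f a ρ c, ψ = (.call f a, ρ) ∧ c ∈ aeval f ρ σ ∧
      ψ' = Clo.target c ∧ σ' = σ ⊔ Store.single c.1.1 (aeval a ρ σ) := by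
  constructor
  · intro h
    obtain ⟨x, ρ⟩ := ψ
    obtain ⟨y, ρ'⟩ := ψ'
    have := h []
    cases this with
    | call f a _ _ _ v b ρ' h => exact ⟨f, a, ρ, _, rfl, h, rfl, rfl⟩
  · rintro ⟨f, a, ρ, c, rfl, h, rfl, rfl⟩ κ
    exact .call (alloc := mono) f a ρ σ κ c.1.1 c.1.2 c.2 h

theorem pstep_pop {σ σ' : Store Var} {ψ ψ' : PState Var} {φ : Frame Var} :
    PStep mono σ ψ (.pop φ) (ψ', σ') ↔ ∃ a ρ, ψ = (.ret a, ρ) ∧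
      ψ' = Frame.target φ ∧ σ' = σ ⊔ Store.single φ.1 (aeval a ρ σ) := by
  constructor
  · intro h
    obtain ⟨x, ρ⟩ := ψ
    obtain ⟨y, ρ'⟩ := ψ'
    have : AStep PDCFA.mono ⟨x, ρ, σ, [φ]⟩ ⟨y, ρ', σ', []⟩ := h []
    generalize hc : Conf.mk y ρ' σ' [] = c at this
    cases this with
    | call => simp at hc
    | push => simp at hc
    | pop a _ _ v b ρ₁ =>
      obtain ⟨rfl, rfl, rfl, -⟩ := Conf.mk.inj hc
      exact ⟨a, ρ, rfl, rfl, rfl⟩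
  · rintro ⟨a, ρ, rfl, rfl, rfl⟩ κ
    exact .pop (alloc := mono) a ρ σ φ.1 φ.2.1 φ.2.2 κ

/-- Every transition of the machine is one of the three kinds. -/
theorem fstep_iff {σ σ' : Store Var} {ψ ψ' : PState Var} {κ κ' : Kont Var} :
    FStep mono σ (ψ.1, ψ.2, κ) ((ψ'.1, ψ'.2, κ'), σ') ↔
      (∃ φ, PStep mono σ ψ (.push φ) (ψ', σ') ∧ κ' = φ :: κ) ∨
      (PStep mono σ ψ .eps (ψ', σ') ∧ κ' = κ) ∨
      ∃ φ, PStep mono σ ψ (.pop φ) (ψ', σ') ∧ κ = φ :: κ' := by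
  constructor
  · intro h
    obtain ⟨x, ρ⟩ := ψ
    obtain ⟨y, ρ'⟩ := ψ'
    have : AStep PDCFA.mono ⟨x, ρ, σ, κ⟩ ⟨y, ρ', σ', κ'⟩ := h
    generalize hc : Conf.mk y ρ' σ' κ' = c at this
    cases this with
    | push v f a b =>
      obtain ⟨rfl, rfl, rfl, rfl⟩ := Conf.mk.inj hc
      exact .inl ⟨_, pstep_push.2 ⟨⟨v, f, a, _, _, rfl, rfl, rfl⟩, rfl⟩, rfl⟩
    | call f a _ _ _ v b ρ₁ hc' =>
      obtain ⟨rfl, rfl, rfl, rfl⟩ := Conf.mk.inj hc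
      exact .inr (.inl ⟨pstep_eps.2 ⟨f, a, _, ((v, _), ρ₁), rfl, hc', rfl, rfl⟩, rfl⟩)
    | pop a _ _ v b ρ₁ =>
      obtain ⟨rfl, rfl, rfl, rfl⟩ := Conf.mk.inj hc
      exact .inr (.inr ⟨_, pstep_pop.2 ⟨a, _, rfl, rfl, rfl⟩, rfl⟩)
  · rintro (⟨φ, h, rfl⟩ | ⟨h, rfl⟩ | ⟨φ, h, rfl⟩)
    · exact h κ
    · exact h _
    · exact h κ'

theorem PStep.mono {σ τ σ' : Store Var} {ψ ψ' : PState Var} {g : Act Var} (hσ : σ ≤ τ)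
    (h : PStep mono σ ψ g (ψ', σ')) : ∃ τ', σ' ≤ τ' ∧ PStep PDCFA.mono τ ψ g (ψ', τ') := by
  cases g with
  | push φ =>
    obtain ⟨h', rfl⟩ := pstep_push.1 h
    exact ⟨τ, hσ, pstep_push.2 ⟨h', rfl⟩⟩
  | eps =>
    obtain ⟨f, a, ρ, c, h₁, h₂, h₃, rfl⟩ := pstep_eps.1 h
    exact ⟨_, sup_le_sup hσ (Store.single_mono (aeval_mono hσ)),
      pstep_eps.2 ⟨f, a, ρ, c, h₁, aeval_mono hσ h₂, h₃, rfl⟩⟩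
  | pop φ =>
    obtain ⟨a, ρ, h₁, h₂, rfl⟩ := pstep_pop.1 h
    exact ⟨_, sup_le_sup hσ (Store.single_mono (aeval_mono hσ)),
      pstep_pop.2 ⟨a, ρ, h₁, h₂, rfl⟩⟩

theorem allT_mono {s t : System Var} (h : s ≤ t) {g : Edge Var} {σ' : Store Var}
    (hg : (g, σ') ∈ allT mono s.1.1 s.1.2 s.2.1 s.2.2) :
    ∃ τ', σ' ≤ τ' ∧ (g, τ') ∈ allT mono t.1.1 t.1.2 t.2.1 t.2.2 := by
  obtain ⟨⟨hP, hE⟩, hH, hσ⟩ := h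
  rcases hg with (⟨ψ, φ, ψ', σ₁, heq, hψ, hs⟩ | ⟨ψ, ψ', σ₁, heq, hψ, hs⟩) |
      ⟨ψ, φ, ψ', ψ₂, ψ₃, σ₁, heq, hs, hψ, hψ'⟩ <;>
    obtain ⟨rfl, rfl⟩ := Prod.mk.inj heq <;> obtain ⟨τ', hle, hs'⟩ := hs.mono hσ <;>
    refine ⟨τ', hle, ?_⟩
  · exact .inl (.inl ⟨ψ, φ, ψ', τ', rfl, hP hψ, hs'⟩)
  · exact .inl (.inr ⟨ψ, ψ', τ', rfl, hP hψ, hs'⟩)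
  · exact .inr ⟨ψ, φ, ψ', ψ₂, ψ₃, τ', rfl, hs', hE hψ, hH hψ'⟩

theorem mem_sSup {S : Set (Store Var)} {v : Var} {c : Clo Var} :
    c ∈ (sSup S : Store Var) v ↔ ∃ σ ∈ S, c ∈ σ v := by
  simp [sSup_apply]

theorem transfer_mono (e : Exp) : Monotone (transfer mono e) := by
  intro s t h
  have hE : edges' mono s.1.1 s.1.2 s.2.1 s.2.2 ≤ edges' mono t.1.1 t.1.2 t.2.1 t.2.2 := by
    rintro g ⟨σ', hg⟩
    obtain ⟨τ', -, h'⟩ := allT_mono h hg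
    exact ⟨τ', h'⟩
  have hP : nodes' mono e s.1.1 s.1.2 s.2.1 s.2.2 ≤ nodes' mono e t.1.1 t.1.2 t.2.1 t.2.2 := by
    rintro ψ ((hψ | hψ) | ⟨ψ₀, g, hg⟩)
    · exact .inl (.inl (h.1.1 hψ))
    · exact .inl (.inr hψ)
    · exact .inr ⟨ψ₀, g, hE hg⟩
  refine ⟨⟨hP, hE⟩, ?_, ?_⟩
  · rintro p (((⟨ψ', h₁, h₂⟩ | ⟨φ, ψ', ψ₂, h₁, h₂, h₃⟩) | h₁) | ⟨h₁, h₂⟩)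
    · exact .inl (.inl (.inl ⟨ψ', h.2.1 h₁, h.2.1 h₂⟩))
    · exact .inl (.inl (.inr ⟨φ, ψ', ψ₂, h.1.2 h₁, h.2.1 h₂, h.1.2 h₃⟩))
    · exact .inl (.inr (hE h₁))
    · exact .inr ⟨hP h₁, h₂⟩
  · refine sSup_le fun σ' ⟨g, hg⟩ => ?_
    obtain ⟨τ', hle, h'⟩ := allT_mono h hg
    exact hle.trans (le_sSup ⟨g, h'⟩)

theorem wideStep_mono (e : Exp) : Monotone (wideStep mono e) := by
  have key : ∀ {σ τ σ' : Store Var} {p p' : PConf Var}, σ ≤ τ → FStep mono σ p (p', σ') →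
      ∃ τ', σ' ≤ τ' ∧ FStep mono τ p (p', τ') := by
    rintro σ τ σ' ⟨x, ρ, κ⟩ ⟨y, ρ', κ'⟩ hσ h
    rcases (fstep_iff (ψ := (x, ρ)) (ψ' := (y, ρ'))).1 h with ⟨φ, h, hκ⟩ | ⟨h, hκ⟩ | ⟨φ, h, hκ⟩ <;>
      obtain ⟨τ', hle, h'⟩ := h.mono hσ <;>
      refine ⟨τ', hle, (fstep_iff (ψ := (x, ρ)) (ψ' := (y, ρ'))).2 ?_⟩
    · exact .inl ⟨φ, h', hκ⟩
    · exact .inr (.inl ⟨h', hκ⟩)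
    · exact .inr (.inr ⟨φ, h', hκ⟩)
  intro s t h
  refine ⟨?_, sSup_le ?_⟩
  · rintro p (⟨q, hq, σ', hs⟩ | hp)
    · obtain ⟨τ', -, hs'⟩ := key h.2 hs
      exact .inl ⟨q, h.1 hq, τ', hs'⟩
    · exact .inr hp
  · rintro σ' ⟨q, hq, p, hs⟩
    obtain ⟨τ', hle, hs'⟩ := key h.2 hs
    exact hle.trans (le_sSup ⟨q, h.1 hq, p, hs'⟩)

/-! ### The two analyses agree -/

/-- The continuations of the state `ψ` according to the graph: below a frame that a push edge
`ψ₁ → ψ₂` has pushed lies a continuation of `ψ₁`, if an ε-closure edge leads from `ψ₂` to `ψ`. -/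
def KontOf (e : Exp) (s : System Var) : Kont Var → PState Var → Prop
  | [], ψ => ((e, Env.empty), ψ) ∈ s.2.1
  | φ :: κ, ψ => ∃ ψ₁ ψ₂, (ψ₁, .push φ, ψ₂) ∈ s.1.2 ∧ (ψ₂, ψ) ∈ s.2.1 ∧ KontOf e s κ ψ₁

/-- Reading the reachable configurations off the graph gives a pre-fixed point of the store-widened
analysis. -/
theorem wideStep_le_of_transfer_le {e : Exp} {s : System Var} (hs : transfer mono e s ≤ s) :
    wideStep mono e ({p | (p.1, p.2.1) ∈ s.1.1 ∧ KontOf e s p.2.2 (p.1, p.2.1)}, s.2.2) ≤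
      ({p | (p.1, p.2.1) ∈ s.1.1 ∧ KontOf e s p.2.2 (p.1, p.2.1)}, s.2.2) := by
  obtain ⟨⟨hP, hE⟩, hH, hσ⟩ := hs
  have hcomp : ∀ {ψ ψ' ψ''}, (ψ, ψ') ∈ s.2.1 → (ψ', ψ'') ∈ s.2.1 → (ψ, ψ'') ∈ s.2.1 :=
    fun h h' => hH (.inl (.inl (.inl ⟨_, h, h'⟩)))
  have hkont : ∀ {κ ψ ψ'}, KontOf e s κ ψ → (ψ, ψ') ∈ s.2.1 → KontOf e s κ ψ' := by
    rintro (_ | ⟨φ, κ⟩) ψ ψ' h h'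
    · exact hcomp h h'
    · obtain ⟨ψ₁, ψ₂, h₁, h₂, h₃⟩ := h
      exact ⟨ψ₁, ψ₂, h₁, hcomp h₂ h', h₃⟩
  have hrefl : ∀ {ψ}, ψ ∈ s.1.1 → (ψ, ψ) ∈ s.2.1 := fun h => hH (.inr ⟨.inl (.inl h), rfl⟩)
  -- every transition from a configuration read off the graph is one of the graph
  have key : ∀ (ψ ψ' : PState Var) κ κ' σ', ψ ∈ s.1.1 → KontOf e s κ ψ →
      FStep mono s.2.2 (ψ.1, ψ.2, κ) ((ψ'.1, ψ'.2, κ'), σ') →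
      (∃ g, ((ψ, g, ψ'), σ') ∈ allT mono s.1.1 s.1.2 s.2.1 s.2.2) ∧ KontOf e s κ' ψ' := by
    intro ψ ψ' κ κ' σ' hψ hκ hs
    rcases fstep_iff.1 hs with ⟨φ, h, rfl⟩ | ⟨h, rfl⟩ | ⟨φ, h, rfl⟩
    · have hT : ((ψ, .push φ, ψ'), σ') ∈ allT mono s.1.1 s.1.2 s.2.1 s.2.2 :=
        .inl (.inl ⟨ψ, φ, ψ', σ', rfl, hψ, h⟩)
      exact ⟨⟨_, hT⟩, ψ, ψ', hE ⟨_, hT⟩, hrefl (hP (.inr ⟨ψ, _, _, hT⟩)), hκ⟩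
    · have hT : ((ψ, .eps, ψ'), σ') ∈ allT mono s.1.1 s.1.2 s.2.1 s.2.2 :=
        .inl (.inr ⟨ψ, ψ', σ', rfl, hψ, h⟩)
      exact ⟨⟨_, hT⟩, hkont hκ (hH (.inl (.inr ⟨_, hT⟩)))⟩
    · obtain ⟨ψ₁, ψ₂, h₁, h₂, h₃⟩ := hκ
      have hT : ((ψ, .pop φ, ψ'), σ') ∈ allT mono s.1.1 s.1.2 s.2.1 s.2.2 :=
        .inr ⟨ψ₁, φ, ψ₂, ψ, ψ', σ', rfl, h, h₁, h₂⟩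
      exact ⟨⟨_, hT⟩, hkont h₃ (hH (.inl (.inl (.inr ⟨φ, ψ₂, ψ, h₁, h₂, hE ⟨_, hT⟩⟩))))⟩
  refine ⟨?_, sSup_le ?_⟩
  · rintro ⟨y, ρ', κ'⟩ (⟨⟨x, ρ, κ⟩, ⟨h₁, h₂⟩, σ', hs⟩ | h)
    · obtain ⟨⟨g, hT⟩, hk⟩ := key (x, ρ) (y, ρ') κ κ' σ' h₁ h₂ hs
      exact ⟨hP (.inr ⟨_, g, _, hT⟩), hk⟩
    · obtain ⟨rfl, rfl, rfl⟩ : y = e ∧ ρ' = Env.empty ∧ κ' = [] := by simpa using h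
      have h₀ : (y, Env.empty) ∈ s.1.1 := hP (.inl (.inr rfl))
      exact ⟨h₀, hrefl h₀⟩
  · rintro σ' ⟨⟨x, ρ, κ⟩, ⟨h₁, h₂⟩, ⟨y, ρ', κ'⟩, hs⟩
    obtain ⟨⟨g, hT⟩, -⟩ := key (x, ρ) (y, ρ') κ κ' σ' h₁ h₂ hs
    exact le_trans (le_sSup (show σ' ∈ {σ' | ∃ g, (g, σ') ∈ _} from ⟨_, hT⟩)) hσ

/-- The largest graph that is sound for the set `Q` of reachable configurations: an edge is one
that, on every continuation on which its source is reachable, leads to a reachable configuration,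
and there has to be such a continuation. A pair of states is an ε-closure edge if every continuation
on which the first is reachable is one on which the second is. -/
def graphOf (Q : Set (PConf Var)) (τ : Store Var) : System Var :=
  (({ψ | ∃ κ, (ψ.1, ψ.2, κ) ∈ Q},
    {t | match t.2.1 with
      | .push φ => (∃ κ, (t.1.1, t.1.2, κ) ∈ Q) ∧
          ∀ κ, (t.1.1, t.1.2, κ) ∈ Q → (t.2.2.1, t.2.2.2, φ :: κ) ∈ Q
      | .eps => (∃ κ, (t.1.1, t.1.2, κ) ∈ Q) ∧
          ∀ κ, (t.1.1, t.1.2, κ) ∈ Q → (t.2.2.1, t.2.2.2, κ) ∈ Q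
      | .pop φ => (∃ κ, (t.1.1, t.1.2, φ :: κ) ∈ Q) ∧
          ∀ κ, (t.1.1, t.1.2, φ :: κ) ∈ Q → (t.2.2.1, t.2.2.2, κ) ∈ Q}),
    {h | ∀ κ, (h.1.1, h.1.2, κ) ∈ Q → (h.2.1, h.2.2, κ) ∈ Q}, τ)

/-- The store-widened analysis gives a pre-fixed point of the iteration function. -/
theorem transfer_le_of_wideStep_le {e : Exp} {Q : Set (PConf Var)} {τ : Store Var}
    (h : wideStep mono e (Q, τ) ≤ (Q, τ)) :
    transfer mono e (graphOf Q τ) ≤ graphOf Q τ := by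
  obtain ⟨hQ, hτ⟩ := h
  have step : ∀ {ψ ψ' : PState Var} {κ κ' σ'}, (ψ.1, ψ.2, κ) ∈ Q →
      FStep mono τ (ψ.1, ψ.2, κ) ((ψ'.1, ψ'.2, κ'), σ') → (ψ'.1, ψ'.2, κ') ∈ Q ∧ σ' ≤ τ :=
    fun {_ _ _ _ σ'} h₁ h₂ => ⟨hQ (.inl ⟨_, h₁, _, h₂⟩), le_trans (le_sSup
      (show σ' ∈ {σ' | ∃ p ∈ Q, ∃ p', FStep mono τ p (p', σ')} from ⟨_, h₁, _, h₂⟩)) hτ⟩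
  have key : ∀ {ψ g ψ' σ'}, ((ψ, g, ψ'), σ') ∈ allT mono (graphOf Q τ).1.1 (graphOf Q τ).1.2
      (graphOf Q τ).2.1 (graphOf Q τ).2.2 →
      (ψ, g, ψ') ∈ (graphOf Q τ).1.2 ∧ ψ' ∈ (graphOf Q τ).1.1 ∧ σ' ≤ τ := by
    intro ψ g ψ' σ' hg
    rcases hg with (⟨ψ, φ, ψ', σ₁, heq, ⟨κ, hκ⟩, hs⟩ | ⟨ψ, ψ', σ₁, heq, ⟨κ, hκ⟩, hs⟩) |
      ⟨ψ₀, φ, ψ₁, ψ₂, ψ₃, σ₁, heq, hs, ⟨⟨κ, hκ⟩, h₁⟩, h₂⟩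
    · simp only [Prod.mk.injEq] at heq
      obtain ⟨⟨rfl, rfl, rfl⟩, rfl⟩ := heq
      have h' : ∀ κ, (ψ.1, ψ.2, κ) ∈ Q → _ := fun κ hκ =>
        step hκ (fstep_iff.2 (.inl ⟨φ, hs, rfl⟩))
      exact ⟨⟨⟨κ, hκ⟩, fun κ hκ => (h' κ hκ).1⟩, ⟨_, (h' κ hκ).1⟩, (h' κ hκ).2⟩
    · simp only [Prod.mk.injEq] at heq
      obtain ⟨⟨rfl, rfl, rfl⟩, rfl⟩ := heq
      have h' : ∀ κ, (ψ.1, ψ.2, κ) ∈ Q → _ := fun κ hκ =>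
        step hκ (fstep_iff.2 (.inr (.inl ⟨hs, rfl⟩)))
      exact ⟨⟨⟨κ, hκ⟩, fun κ hκ => (h' κ hκ).1⟩, ⟨_, (h' κ hκ).1⟩, (h' κ hκ).2⟩
    · simp only [Prod.mk.injEq] at heq
      obtain ⟨⟨rfl, rfl, rfl⟩, rfl⟩ := heq
      have h' : ∀ κ, (ψ.1, ψ.2, φ :: κ) ∈ Q → _ := fun κ hκ =>
        step hκ (fstep_iff.2 (.inr (.inr ⟨φ, hs, rfl⟩)))
      have hκ' := h₂ _ (h₁ κ hκ)
      exact ⟨⟨⟨κ, hκ'⟩, fun κ hκ => (h' κ hκ).1⟩, ⟨_, (h' κ hκ').1⟩, (h' κ hκ').2⟩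
  refine ⟨⟨?_, ?_⟩, ?_, ?_⟩
  · rintro ψ ((hψ | rfl) | ⟨ψ₀, g, σ', hT⟩)
    · exact hψ
    · exact ⟨[], hQ (.inr rfl)⟩
    · exact (key hT).2.1
  · rintro ⟨ψ, g, ψ'⟩ ⟨σ', hT⟩
    exact (key hT).1
  · rintro ⟨ψ, ψ'⟩ (((⟨ψ', h₁, h₂⟩ | ⟨φ, ψ', ψ₂, h₁, h₂, h₃⟩) | ⟨σ', hT⟩) | ⟨h₁, h₂⟩)
    · exact fun κ hκ => h₂ κ (h₁ κ hκ)
    · exact fun κ hκ => h₃.2 κ (h₂ _ (h₁.2 κ hκ))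
    · exact (key hT).1.2
    · dsimp only at h₂
      subst h₂
      exact fun κ hκ => hκ
  · exact sSup_le fun σ' ⟨g, hT⟩ => (key hT).2.2

/-- The least fixed points of the two analyses have the same states and the same store. -/
theorem exists_wide_eq {e : Exp} {s : System Var}
    (hs : IsLeast (Function.fixedPoints (transfer mono e)) s) :
    ∃ (Q : Set (PConf Var)) (τ : Store Var),
      IsLeast (Function.fixedPoints (wideStep mono e)) (Q, τ) ∧
      s.1.1 = {ψ | ∃ κ, (ψ.1, ψ.2, κ) ∈ Q} ∧ s.2.2 = τ := by
  let f : System Var →o System Var := ⟨transfer mono e, transfer_mono e⟩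
  let g : Set (PConf Var) × Store Var →o Set (PConf Var) × Store Var :=
    ⟨wideStep mono e, wideStep_mono e⟩
  obtain rfl : s = f.lfp := hs.unique f.isLeast_lfp
  have h₁ : g.lfp ≤ _ := g.lfp_le (wideStep_le_of_transfer_le (le_of_eq f.map_lfp))
  have h₂ : f.lfp ≤ graphOf g.lfp.1 g.lfp.2 :=
    f.lfp_le (transfer_le_of_wideStep_le (le_of_eq g.map_lfp))
  refine ⟨g.lfp.1, g.lfp.2, g.isLeast_lfp, ?_, le_antisymm h₂.2.2 h₁.2⟩
  exact le_antisymm h₂.1.1 fun ψ ⟨κ, hκ⟩ => (h₁.1 hκ).1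

/-! ### Static tables -/

/-- The literal that the tuple is in the table. -/
abbrev tb (p : ℕ) (xs : List ℕ) : Lit := (true, .tab p xs)
/-- The literal that the node has kind `k`. -/
abbrev kd (k x : ℕ) : Lit := (true, .kind k x)
/-- The literal that the nodes have the same identifier. -/
abbrev sm (x y : ℕ) : Lit := (true, .same x y)
/-- The literal that the second node is next in preorder. -/
abbrev sc (x y : ℕ) : Lit := (true, .succ x y)
/-- Negation. -/
abbrev no (l : Lit) : Lit := (!l.1, l.2)

/-- The frame pushed by the node if it is a `let`, and a junk value otherwise. -/
def fr (e : Exp) (i : ℕ) : Frame Var :=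
  match pt e i with
  | (.letin v _ _ b, ρ) => (v, b, ρ)
  | (x, ρ) => (0, x, ρ)

/-- The closure of the node if it is a lambda term, and a junk value otherwise. -/
def clo (e : Exp) (i : ℕ) : Clo Var :=
  match pt e i with
  | (.ret (.lam v b), ρ) => ((v, b), ρ)
  | (x, ρ) => ((0, x), ρ)

/-- The identifier of node `x` is in scope at node `i`. -/
def InEnv (e : Exp) (i x : ℕ) : Prop := (pt e i).2 ((ctx e).nm x) ≠ none

/-- The tables that depend on the syntax tree only. Tables 13, 38, 40 and 41, which hold
intermediate results of the recursive computations, are left out. -/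
def stat (e : Exp) : DB
  -- the subtree at `i` ends in front of `j`
  | 9, [i, j] => j = i + sz e i
  -- the second child of `i` is `j`
  | 10, [i, j] => ((ctx e).kd i = 3 ∨ (ctx e).kd i = 4) ∧ j = snd e i
  | 11, [i, x] => InEnv e i x
  -- equality of expressions; for environments, states and frames see 15 (negated), 16 and 17
  | 12, [i, j] => (pt e i).1 = (pt e j).1
  -- the second children have the same expression
  | 14, [i, j] => ((ctx e).kd i = 3 ∨ (ctx e).kd i = 4) ∧
      ((ctx e).kd j = 3 ∨ (ctx e).kd j = 4) ∧ (pt e (snd e i)).1 = (pt e (snd e j)).1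
  | 15, [i, j] => (pt e i).2 ≠ (pt e j).2
  | 16, [i, j] => pt e i = pt e j
  | 17, [i, j] => (ctx e).kd i = 4 ∧ (ctx e).kd j = 4 ∧ fr e i = fr e j
  -- the call of the `let` at `i`
  | 18, [i, j] => (ctx e).kd i = 4 ∧ pt e j = pt e (i + 1)
  -- the body of the `let` at `i`
  | 19, [i, j] => (ctx e).kd i = 4 ∧ pt e j = Frame.target (fr e i)
  -- the body of the lambda term at `i`
  | 20, [i, j] => (ctx e).kd i = 2 ∧ pt e j = Clo.target (clo e i)
  -- `i` is an occurrence, in its scope, of the variable that `j` binds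
  | 21, [i, j] => (ctx e).kd i = 1 ∧ InEnv e i i ∧ (ctx e).nm i = (ctx e).nm j ∧
      ((ctx e).kd j = 2 ∨ (ctx e).kd j = 4)
  | _, _ => False

/-- One round of the recursive computation of the ends of the subtrees. -/
def endDefs : List Def :=
  [⟨38, [(0, [kd 1 0, sc 0 1]), (1, [kd 2 0, sc 0 2, tb 9 [2, 1]]),
      (2, [no (kd 1 0), no (kd 2 0), sc 0 2, tb 9 [2, 3], tb 9 [3, 1]])]⟩,
   ⟨9, [(0, [tb 38 [0, 1]])]⟩]

/-- The second children. -/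
def sndDef : Def := ⟨10, [(1, [no (kd 1 0), no (kd 2 0), sc 0 2, tb 9 [2, 1]])]⟩

/-- One round of the recursive computation of the scopes. -/
def scopeDefs : List Def :=
  [⟨40, [(1, [no (kd 1 2), sc 2 0, tb 11 [2, 1]]), (1, [tb 10 [2, 0], tb 11 [2, 1]]),
      (1, [kd 2 2, sc 2 0, sm 2 1]), (1, [kd 4 2, tb 10 [2, 0], sm 2 1])]⟩,
   ⟨11, [(0, [tb 40 [0, 1]])]⟩]

/-- Equality of the expressions of the second children. -/
def sndEqDef : Def := ⟨14, [(2, [tb 10 [0, 2], tb 10 [1, 3], tb 12 [2, 3]])]⟩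

/-- One round of the recursive computation of the equality of expressions. -/
def expEqDefs : List Def :=
  [⟨13, [(2, [sc 0 2, sc 1 3, tb 12 [2, 3]])]⟩, sndEqDef,
   ⟨41, [(0, [kd 1 0, kd 1 1, sm 0 1]), (0, [kd 2 0, kd 2 1, sm 0 1, tb 13 [0, 1]]),
      (0, [kd 3 0, kd 3 1, tb 13 [0, 1], tb 14 [0, 1]]),
      (0, [kd 4 0, kd 4 1, sm 0 1, tb 13 [0, 1], tb 14 [0, 1]])]⟩,
   ⟨12, [(0, [tb 41 [0, 1]])]⟩]

/-- The remaining static tables, which are not recursive. -/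
def eqDefs : List Def :=
  [sndEqDef,
   ⟨15, [(1, [tb 11 [0, 2], no (tb 11 [1, 2])]), (1, [tb 11 [1, 2], no (tb 11 [0, 2])])]⟩,
   ⟨16, [(0, [tb 12 [0, 1], no (tb 15 [0, 1])])]⟩,
   ⟨17, [(0, [kd 4 0, kd 4 1, sm 0 1, tb 14 [0, 1], no (tb 15 [0, 1])])]⟩,
   ⟨18, [(1, [kd 4 0, sc 0 2, tb 16 [2, 1]])]⟩,
   ⟨19, [(1, [kd 4 0, tb 10 [0, 2], tb 16 [2, 1]])]⟩,
   ⟨20, [(1, [kd 2 0, sc 0 2, tb 16 [2, 1]])]⟩,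
   ⟨21, [(0, [kd 1 0, tb 11 [0, 0], sm 0 1, kd 2 1]), (0, [kd 1 0, tb 11 [0, 0], sm 0 1, kd 4 1])]⟩]

theorem valid_one {n p : ℕ} {xs : List ℕ} (hp : ar p = 1) :
    Valid n p xs ↔ ∃ i, xs = [i] ∧ i < n := by
  rw [Valid, hp, List.length_eq_one_iff]
  constructor
  · rintro ⟨⟨i, rfl⟩, h⟩; exact ⟨i, rfl, by simpa using h⟩
  · rintro ⟨i, rfl, h⟩; exact ⟨⟨i, rfl⟩, by simpa using h⟩

theorem valid_two {n p : ℕ} {xs : List ℕ} (hp : ar p = 2) :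
    Valid n p xs ↔ ∃ i j, xs = [i, j] ∧ i < n ∧ j < n := by
  rw [Valid, hp, List.length_eq_two]
  constructor
  · rintro ⟨⟨i, j, rfl⟩, h⟩; exact ⟨i, j, rfl, by simpa using h⟩
  · rintro ⟨i, j, rfl, h⟩; exact ⟨⟨i, j, rfl⟩, by simpa using h⟩

theorem valid_three {n p : ℕ} {xs : List ℕ} (hp : ar p = 3) :
    Valid n p xs ↔ ∃ i j k, xs = [i, j, k] ∧ i < n ∧ j < n ∧ k < n := by
  rw [Valid, hp, List.length_eq_three]
  constructor
  · rintro ⟨⟨i, j, k, rfl⟩, h⟩; exact ⟨i, j, k, rfl, by simpa using h⟩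
  · rintro ⟨i, j, k, rfl, h⟩; exact ⟨⟨i, j, k, rfl⟩, by simpa using h⟩

theorem agree_two {n p : ℕ} {D T : DB} (hp : ar p = 2) :
    Agree n D T p ↔ ∀ i < n, ∀ j < n, (D p [i, j] ↔ T p [i, j]) := by
  constructor
  · exact fun h i hi j hj => h _ ((valid_two hp).2 ⟨i, j, rfl, hi, hj⟩)
  · rintro h xs hx
    obtain ⟨i, j, rfl, hi, hj⟩ := (valid_two hp).1 hx
    exact h i hi j hj

/-- Recursion on a rank below `n`: if each further round is right about the next rank, then `n`
rounds compute the table. The rounds preserve `I`. -/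
theorem iterate_agree {n p : ℕ} (hp : ar p = 2) {F : DB → DB} {T : DB} {I : DB → Prop}
    {rank : ℕ → ℕ → ℕ} (hrank : ∀ i < n, ∀ j < n, rank i j < n)
    (hI : ∀ D, I D → I (F D))
    (step : ∀ D r, I D → (∀ i < n, ∀ j < n, (D p [i, j] → T p [i, j]) ∧
        (rank i j < r → T p [i, j] → D p [i, j])) →
      ∀ i < n, ∀ j < n, (F D p [i, j] → T p [i, j]) ∧
        (rank i j ≤ r → T p [i, j] → F D p [i, j]))
    {D : DB} (hD : I D) (h0 : ∀ i < n, ∀ j < n, ¬ D p [i, j]) :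
    I (F^[n] D) ∧ Agree n (F^[n] D) T p := by
  have key : ∀ r, I (F^[r] D) ∧ ∀ i < n, ∀ j < n, (F^[r] D p [i, j] → T p [i, j]) ∧
      (rank i j < r → T p [i, j] → F^[r] D p [i, j]) := by
    intro r
    induction r with
    | zero => exact ⟨hD, fun i hi j hj => ⟨fun h => absurd h (h0 i hi j hj), by simp⟩⟩
    | succ r ih =>
      rw [Function.iterate_succ_apply']
      exact ⟨hI _ ih.1, fun i hi j hj => by
        simpa only [Nat.lt_succ_iff] using step _ r ih.1 ih.2 i hi j hj⟩
  exact ⟨(key n).1, (agree_two hp).2 fun i hi j hj =>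
    ⟨((key n).2 i hi j hj).1, ((key n).2 i hi j hj).2 (hrank i hi j hj)⟩⟩

variable {e : Exp}

theorem kd_le (i : ℕ) : 1 ≤ (ctx e).kd i ∧ (ctx e).kd i ≤ 4 := by
  rcases h : pt e i with ⟨_ | _ | ⟨_ | _⟩, ρ⟩ <;> simp [ctx, h, Exp.kind]

theorem kd_one {i : ℕ} : (ctx e).kd i = 1 ↔ ∃ v ρ, pt e i = (.ret (.var v), ρ) := by
  rcases h : pt e i with ⟨_ | _ | ⟨_ | _⟩, ρ⟩ <;> simp [ctx, h, Exp.kind]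

theorem kd_two {i : ℕ} : (ctx e).kd i = 2 ↔ ∃ v b ρ, pt e i = (.ret (.lam v b), ρ) := by
  rcases h : pt e i with ⟨_ | _ | ⟨_ | _⟩, ρ⟩ <;> simp [ctx, h, Exp.kind]

theorem kd_three {i : ℕ} : (ctx e).kd i = 3 ↔ ∃ f a ρ, pt e i = (.call f a, ρ) := by
  rcases h : pt e i with ⟨_ | _ | ⟨_ | _⟩, ρ⟩ <;> simp [ctx, h, Exp.kind]

theorem kd_four {i : ℕ} : (ctx e).kd i = 4 ↔ ∃ v f a b ρ, pt e i = (.letin v f a b, ρ) := by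
  rcases h : pt e i with ⟨_ | _ | ⟨_ | _⟩, ρ⟩ <;> simp [ctx, h, Exp.kind]

theorem kd_snd {i : ℕ} : ((ctx e).kd i = 3 ∨ (ctx e).kd i = 4) ↔
    ((ctx e).kd i ≠ 1 ∧ (ctx e).kd i ≠ 2) := by
  have := kd_le (e := e) i; omega

theorem succ_lt {i : ℕ} (hi : i < e.size) (h : (ctx e).kd i ≠ 1) : i + 1 < e.size := by
  rcases hx : pt e i with ⟨_ | _ | ⟨_ | _⟩, ρ⟩
  · exact (pt_letin hi hx).1.1
  · exact (pt_call hi hx).1.1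
  · exact absurd (kd_one.2 ⟨_, _, hx⟩) h
  · exact (pt_lam hi hx).1

theorem snd_lt {i : ℕ} (hi : i < e.size) (h : (ctx e).kd i = 3 ∨ (ctx e).kd i = 4) :
    snd e i < e.size := by
  rcases hx : pt e i with ⟨_ | _ | ⟨_ | _⟩, ρ⟩
  · exact (pt_letin hi hx).2.1
  · exact (pt_call hi hx).2.1
  all_goals simp [ctx, hx, Exp.kind] at h

theorem sz_one {i : ℕ} (h : (ctx e).kd i = 1) : sz e i = 1 := by
  obtain ⟨v, ρ, h⟩ := kd_one.1 h
  simp [sz, h, Exp.size, Atom.size]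

theorem sz_two {i : ℕ} (hi : i < e.size) (h : (ctx e).kd i = 2) :
    sz e i = 1 + sz e (i + 1) := by
  obtain ⟨v, b, ρ, h⟩ := kd_two.1 h
  simp [sz, h, (pt_lam hi h).2, Exp.size, Atom.size]

theorem sz_snd {i : ℕ} (hi : i < e.size) (h : (ctx e).kd i = 3 ∨ (ctx e).kd i = 4) :
    sz e i = 1 + sz e (i + 1) + sz e (snd e i) := by
  rcases hx : pt e i with ⟨_ | _ | ⟨_ | _⟩, ρ⟩
  · have := pt_letin hi hx
    simp only [sz, hx, this.1.2, this.2.2, Exp.size]; omega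
  · have := pt_call hi hx
    simp only [sz, hx, this.1.2, this.2.2, Exp.size]
  all_goals simp [ctx, hx, Exp.kind] at h

theorem endDefs_iff {c : Ctx} {D : DB} {i j : ℕ} : defsSem c endDefs D 9 [i, j] ↔
    (c.kd i = 1 ∧ j = i + 1) ∨ (i + 1 < c.n ∧ c.kd i = 2 ∧ D 9 [i + 1, j]) ∨
    (i + 1 < c.n ∧ ∃ k < c.n, (c.kd i ≠ 1 ∧ c.kd i ≠ 2) ∧ D 9 [i + 1, k] ∧ D 9 [k, j]) := by
  simp [endDefs, defsSem, Def.sem, ClauseHolds, ExN, Lit.Holds, Atm.Holds]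

/-- The rank counts the nodes from the end, as the end of a subtree is determined by those of the
children, which come later in preorder. -/
theorem end_agree {D : DB} (h0 : D 9 = fun _ => False) :
    Agree e.size ((defsSem (ctx e) endDefs)^[e.size] D) (stat e) 9 := by
  refine (iterate_agree (p := 9) rfl (I := fun _ => True) (rank := fun i _ => e.size - 1 - i)
    (fun i hi j hj => by omega) (fun _ _ => trivial) (fun D r _ h i hi j hj => ?_) trivial
    (by simp [h0])).2
  simp only [endDefs_iff, stat] at h ⊢
  constructor
  · rintro (⟨h₁, rfl⟩ | ⟨hn, h₁, h₂⟩ | ⟨hn, k, hk, h₁, h₂, h₃⟩)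
    · rw [sz_one h₁]
    · rw [sz_two hi h₁, (h _ hn j hj).1 h₂]; omega
    · obtain rfl := (h _ hn k hk).1 h₂
      rw [sz_snd hi (kd_snd.2 h₁), (h _ hk j hj).1 h₃, snd]; omega
  · rintro hr rfl
    by_cases h1 : (ctx e).kd i = 1
    · exact .inl ⟨h1, by rw [sz_one h1]⟩
    have hs := succ_lt hi h1
    by_cases h2 : (ctx e).kd i = 2
    · rw [sz_two hi h2] at hj ⊢
      exact .inr (.inl ⟨hs, h2, (h _ hs _ hj).2 (by omega) (by omega)⟩)
    · have h3 := kd_snd.2 ⟨h1, h2⟩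
      have hl := snd_lt hi h3
      rw [sz_snd hi h3] at hj ⊢
      refine .inr (.inr ⟨hs, snd e i, hl, ⟨h1, h2⟩, (h _ hs _ hl).2 (by omega) rfl,
        (h _ hl _ hj).2 ?_ (by unfold snd; omega)⟩)
      unfold snd; omega

theorem ctx_n : (ctx e).n = e.size := rfl

theorem snd_agree {D : DB} (h : Agree e.size D (stat e) 9) :
    Agree e.size (defsSem (ctx e) [sndDef] D) (stat e) 10 := by
  refine (agree_two rfl).2 fun i hi j hj => ?_
  have h9 : i + 1 < e.size → (D 9 [i + 1, j] ↔ stat e 9 [i + 1, j]) :=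
    fun h' => (agree_two rfl).1 h _ h' j hj
  simp only [stat] at h9
  simp [defsSem, sndDef, Def.sem, ClauseHolds, ExN, Lit.Holds, Atm.Holds, ctx_n, stat]
  rw [kd_snd]
  constructor
  · rintro ⟨h₁, h₂, h₃⟩
    exact ⟨h₂, (h9 h₁).1 h₃⟩
  · rintro ⟨h₁, h₂⟩
    have := succ_lt hi h₁.1
    exact ⟨this, h₁, (h9 this).2 h₂⟩

theorem scopeDefs_iff {c : Ctx} {D : DB} {j x : ℕ} : defsSem c scopeDefs D 11 [j, x] ↔
    (∃ i < c.n, c.kd i ≠ 1 ∧ j = i + 1 ∧ D 11 [i, x]) ∨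
    (∃ i < c.n, D 10 [i, j] ∧ D 11 [i, x]) ∨
    (∃ i < c.n, c.kd i = 2 ∧ j = i + 1 ∧ c.nm i = c.nm x) ∨
    (∃ i < c.n, c.kd i = 4 ∧ D 10 [i, j] ∧ c.nm i = c.nm x) := by
  simp [scopeDefs, defsSem, Def.sem, ClauseHolds, ExN, Lit.Holds, Atm.Holds]

theorem bind_ne_none {ρ : Env Var} {v x : Var} :
    ρ.bind v v x ≠ none ↔ v = x ∨ ρ x ≠ none := by
  unfold Env.bind
  rcases eq_or_ne x v with rfl | h
  · simp
  · simp [Function.update_of_ne h, h.symm]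

/-- The rank is the node number, as the scope of a node is determined by that of its parent. -/
theorem scope_agree {D : DB} (h0 : D 11 = fun _ => False) (h10 : Agree e.size D (stat e) 10) :
    Agree e.size ((defsSem (ctx e) scopeDefs)^[e.size] D) (stat e) 11 := by
  refine (iterate_agree (p := 11) rfl (I := fun D => Agree e.size D (stat e) 10)
    (rank := fun j _ => j) (fun i hi j hj => hi) (fun D h xs hx => ?_)
    (fun D r h10 h j hj x hx => ?_) h10 (by simp [h0])).2
  · rw [defsSem_of_notMem (by decide)]; exact h xs hx
  have h10' : ∀ i < e.size, (D 10 [i, j] ↔ stat e 10 [i, j]) :=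
    fun i hi => (agree_two rfl).1 h10 i hi j hj
  simp only [scopeDefs_iff, stat, ctx_n, InEnv] at h h10' ⊢
  constructor
  · rintro (⟨i, hi, h₁, rfl, h₂⟩ | ⟨i, hi, h₁, h₂⟩ | ⟨i, hi, h₁, rfl, h₂⟩ | ⟨i, hi, h₁, h₂, h₃⟩)
    · have h₃ := (h i hi x hx).1 h₂
      rcases hi' : pt e i with ⟨_ | _ | ⟨_ | _⟩, ρ⟩ <;> rw [hi'] at h₃
      · rwa [(pt_letin hi hi').1.2]
      · rwa [(pt_call hi hi').1.2]
      · exact absurd (kd_one.2 ⟨_, _, hi'⟩) h₁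
      · rw [(pt_lam hi hi').2]; exact bind_ne_none.2 (.inr h₃)
    · have h₃ := (h i hi x hx).1 h₂
      obtain ⟨hk, rfl⟩ := (h10' i hi).1 h₁
      rcases hi' : pt e i with ⟨_ | _ | ⟨_ | _⟩, ρ⟩ <;> rw [hi'] at h₃
      · rw [(pt_letin hi hi').2.2]; exact bind_ne_none.2 (.inr h₃)
      · rwa [(pt_call hi hi').2.2]
      all_goals simp [ctx, hi', Exp.kind] at hk
    · obtain ⟨v, b, ρ, hi'⟩ := kd_two.1 h₁
      rw [(pt_lam hi hi').2, ← h₂]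
      exact bind_ne_none.2 (.inl (by simp [ctx, hi', Exp.name]))
    · obtain ⟨v, f, a, b, ρ, hi'⟩ := kd_four.1 h₁
      obtain ⟨-, rfl⟩ := (h10' i hi).1 h₂
      rw [(pt_letin hi hi').2.2, ← h₃]
      exact bind_ne_none.2 (.inl (by simp [ctx, hi', Exp.name]))
  · intro hr hT
    have hj0 : j ≠ 0 := by rintro rfl; simp [pt_zero, Env.empty] at hT
    obtain ⟨i, hij, hi, h'⟩ := parent hj0 hj
    rcases h' with ⟨h₁, -, rfl, h₂⟩ | ⟨h₁, rfl, h₂⟩ | ⟨h₁, rfl, h₂⟩ | ⟨h₁, rfl, h₂⟩ <;>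
      rw [h₂] at hT
    · exact .inl ⟨i, hi, h₁, rfl, (h i hi x hx).2 (by omega) hT⟩
    · exact .inr (.inl ⟨i, hi, (h10' i hi).2 ⟨.inl h₁, rfl⟩, (h i hi x hx).2 (by omega) hT⟩)
    · rcases bind_ne_none.1 hT with hv | hT
      · exact .inr (.inr (.inl ⟨i, hi, h₁, rfl, hv⟩))
      · exact .inl ⟨i, hi, by omega, rfl, (h i hi x hx).2 (by omega) hT⟩
    · have h10i := (h10' i hi).2 ⟨.inr h₁, rfl⟩
      rcases bind_ne_none.1 hT with hv | hT
      · exact .inr (.inr (.inr ⟨i, hi, h₁, h10i, hv⟩))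
      · exact .inr (.inl ⟨i, hi, h10i, (h i hi x hx).2 (by omega) hT⟩)

theorem expEqDefs_iff {c : Ctx} {D : DB} {i j : ℕ} : defsSem c expEqDefs D 12 [i, j] ↔
    (c.kd i = 1 ∧ c.kd j = 1 ∧ c.nm i = c.nm j) ∨
    (c.kd i = 2 ∧ c.kd j = 2 ∧ c.nm i = c.nm j ∧
      i + 1 < c.n ∧ j + 1 < c.n ∧ D 12 [i + 1, j + 1]) ∨
    (c.kd i = 3 ∧ c.kd j = 3 ∧ (i + 1 < c.n ∧ j + 1 < c.n ∧ D 12 [i + 1, j + 1]) ∧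
      ∃ k < c.n, ∃ l < c.n, D 10 [i, k] ∧ D 10 [j, l] ∧ D 12 [k, l]) ∨
    (c.kd i = 4 ∧ c.kd j = 4 ∧ c.nm i = c.nm j ∧
      (i + 1 < c.n ∧ j + 1 < c.n ∧ D 12 [i + 1, j + 1]) ∧
      ∃ k < c.n, ∃ l < c.n, D 10 [i, k] ∧ D 10 [j, l] ∧ D 12 [k, l]) := by
  simp [expEqDefs, sndEqDef, defsSem, Def.sem, ClauseHolds, ExN, Lit.Holds, Atm.Holds]

/-- Expressions are equal if their top nodes and children agree. -/
theorem exp_eq_iff {i j : ℕ} (hi : i < e.size) (hj : j < e.size) :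
    (pt e i).1 = (pt e j).1 ↔
    ((ctx e).kd i = 1 ∧ (ctx e).kd j = 1 ∧ (ctx e).nm i = (ctx e).nm j) ∨
    ((ctx e).kd i = 2 ∧ (ctx e).kd j = 2 ∧ (ctx e).nm i = (ctx e).nm j ∧
      (pt e (i + 1)).1 = (pt e (j + 1)).1) ∨
    ((ctx e).kd i = 3 ∧ (ctx e).kd j = 3 ∧ (pt e (i + 1)).1 = (pt e (j + 1)).1 ∧
      (pt e (snd e i)).1 = (pt e (snd e j)).1) ∨
    ((ctx e).kd i = 4 ∧ (ctx e).kd j = 4 ∧ (ctx e).nm i = (ctx e).nm j ∧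
      (pt e (i + 1)).1 = (pt e (j + 1)).1 ∧ (pt e (snd e i)).1 = (pt e (snd e j)).1) := by
  rcases hx : pt e i with ⟨_ | _ | ⟨_ | _⟩, ρ⟩ <;> rcases hy : pt e j with ⟨_ | _ | ⟨_ | _⟩, ρ'⟩ <;>
    simp [ctx, hx, hy, Exp.kind, Exp.name]
  · simp [(pt_letin hi hx).1.2, (pt_letin hi hx).2.2, (pt_letin hj hy).1.2, (pt_letin hj hy).2.2,
      and_assoc]
  · simp [(pt_call hi hx).1.2, (pt_call hi hx).2.2, (pt_call hj hy).1.2, (pt_call hj hy).2.2]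
  · simp [(pt_lam hi hx).2, (pt_lam hj hy).2]

/-- The rank counts the nodes from the end, as for the ends of subtrees. -/
theorem expEq_agree {D : DB} (h0 : D 12 = fun _ => False) (h10 : Agree e.size D (stat e) 10) :
    Agree e.size ((defsSem (ctx e) expEqDefs)^[e.size] D) (stat e) 12 := by
  refine (iterate_agree (p := 12) rfl (I := fun D => Agree e.size D (stat e) 10)
    (rank := fun i _ => e.size - 1 - i) (fun i hi j hj => by omega) (fun D h xs hx => ?_)
    (fun D r h10 h i hi j hj => ?_) h10 (by simp [h0])).2
  · rw [defsSem_of_notMem (by decide)]; exact h xs hx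
  have h10' : ∀ i < e.size, ∀ j < e.size, (D 10 [i, j] ↔ stat e 10 [i, j]) :=
    (agree_two rfl).1 h10
  simp only [expEqDefs_iff, stat, ctx_n] at h h10' ⊢
  rw [exp_eq_iff hi hj]
  have hs := succ_lt hi
  have hs' := succ_lt hj
  constructor
  · rintro (h' | ⟨h₁, h₂, h₃, h₄, h₅, h₆⟩ | ⟨h₁, h₂, ⟨h₄, h₅, h₆⟩, k, hk, l, hl, h₇, h₈, h₉⟩ |
      ⟨h₁, h₂, h₃, ⟨h₄, h₅, h₆⟩, k, hk, l, hl, h₇, h₈, h₉⟩)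
    · exact .inl h'
    · exact .inr (.inl ⟨h₁, h₂, h₃, (h _ h₄ _ h₅).1 h₆⟩)
    all_goals
      obtain ⟨-, rfl⟩ := (h10' _ hi _ hk).1 h₇
      obtain ⟨-, rfl⟩ := (h10' _ hj _ hl).1 h₈
    · exact .inr (.inr (.inl ⟨h₁, h₂, (h _ h₄ _ h₅).1 h₆, (h _ hk _ hl).1 h₉⟩))
    · exact .inr (.inr (.inr ⟨h₁, h₂, h₃, (h _ h₄ _ h₅).1 h₆, (h _ hk _ hl).1 h₉⟩))
  · have hi' : i < snd e i := by unfold snd; omega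
    rintro hr (h' | ⟨h₁, h₂, h₃, h₄⟩ | ⟨h₁, h₂, h₄, h₅⟩ | ⟨h₁, h₂, h₃, h₄, h₅⟩)
    · exact .inl h'
    · have h₅ := hs (by omega)
      have h₆ := hs' (by omega)
      exact .inr (.inl ⟨h₁, h₂, h₃, h₅, h₆, (h _ h₅ _ h₆).2 (by omega) h₄⟩)
    · have h₆ := hs (by omega)
      have h₇ := hs' (by omega)
      have h₈ := snd_lt hi (.inl h₁)
      have h₉ := snd_lt hj (.inl h₂)
      exact .inr (.inr (.inl ⟨h₁, h₂, ⟨h₆, h₇, (h _ h₆ _ h₇).2 (by omega) h₄⟩, _, h₈, _, h₉,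
        (h10' _ hi _ h₈).2 ⟨.inl h₁, rfl⟩, (h10' _ hj _ h₉).2 ⟨.inl h₂, rfl⟩,
        (h _ h₈ _ h₉).2 (by omega) h₅⟩))
    · have h₆ := hs (by omega)
      have h₇ := hs' (by omega)
      have h₈ := snd_lt hi (.inr h₁)
      have h₉ := snd_lt hj (.inr h₂)
      exact .inr (.inr (.inr ⟨h₁, h₂, h₃, ⟨h₆, h₇, (h _ h₆ _ h₇).2 (by omega) h₄⟩, _, h₈, _, h₉,
        (h10' _ hi _ h₈).2 ⟨.inr h₁, rfl⟩, (h10' _ hj _ h₉).2 ⟨.inr h₂, rfl⟩,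
        (h _ h₈ _ h₉).2 (by omega) h₅⟩))

theorem fr_target {i : ℕ} (hi : i < e.size) (h : (ctx e).kd i = 4) :
    Frame.target (fr e i) = pt e (snd e i) := by
  obtain ⟨v, f, a, b, ρ, h⟩ := kd_four.1 h
  simp [fr, h, Frame.target, (pt_letin hi h).2.2]

theorem clo_target {i : ℕ} (hi : i < e.size) (h : (ctx e).kd i = 2) :
    Clo.target (clo e i) = pt e (i + 1) := by
  obtain ⟨v, b, ρ, h⟩ := kd_two.1 h
  simp [clo, h, Clo.target, (pt_lam hi h).2]

/-- The static tables solve the definitions that are not recursive. -/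
theorem eqDefs_sem : ∀ d ∈ eqDefs, ∀ xs, Valid e.size d.head xs →
    (d.sem (ctx e) (stat e) xs ↔ stat e d.head xs) := by
  simp only [eqDefs, List.mem_cons, List.not_mem_nil, or_false, forall_eq_or_imp, forall_eq,
    sndEqDef]
  refine ⟨?_, ?_, ?_, ?_, ?_, ?_, ?_, ?_⟩ <;> intro xs hx <;>
    obtain ⟨i, j, rfl, hi, hj⟩ := (valid_two rfl).1 hx <;>
    simp [Def.sem, ClauseHolds, ExN, Lit.Holds, Atm.Holds, stat, ctx_n]
  · exact ⟨fun h => h.2.2, fun h => ⟨snd_lt hi h.1, snd_lt hj h.2.1, h⟩⟩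
  · rw [env_eq_iff hi hj]
    simp only [InEnv]
    push Not
    constructor
    · rintro (⟨y, hy, h₁, h₂⟩ | ⟨y, hy, h₁, h₂⟩)
      · exact ⟨y, hy, .inl ⟨h₂, h₁⟩⟩
      · exact ⟨y, hy, .inr ⟨h₁, h₂⟩⟩
    · rintro ⟨y, hy, ⟨h₁, h₂⟩ | ⟨h₁, h₂⟩⟩
      · exact .inl ⟨y, hy, h₂, h₁⟩
      · exact .inr ⟨y, hy, h₁, h₂⟩
  · rw [Prod.ext_iff, and_comm]
  · by_cases h₁ : (ctx e).kd i = 4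
    swap
    · simp [h₁]
    by_cases h₂ : (ctx e).kd j = 4
    swap
    · simp [h₂]
    simp only [h₁, h₂, or_true, true_and]
    obtain ⟨v, f, a, b, ρ, h₁⟩ := kd_four.1 h₁
    obtain ⟨v', f', a', b', ρ', h₂⟩ := kd_four.1 h₂
    simp [fr, ctx, h₁, h₂, Exp.name, (pt_letin hi h₁).2.2, (pt_letin hj h₂).2.2]
    tauto
  · constructor
    · rintro ⟨-, h₁, h₂⟩; exact ⟨h₁, h₂.symm⟩
    · rintro ⟨h₁, h₂⟩; exact ⟨succ_lt hi (by omega), h₁, h₂.symm⟩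
  · constructor
    · rintro ⟨-, h₁, -, h₂⟩; exact ⟨h₁, by rw [fr_target hi h₁, h₂]⟩
    · rintro ⟨h₁, h₂⟩
      exact ⟨snd_lt hi (.inr h₁), h₁, .inr h₁, by rw [h₂, fr_target hi h₁]⟩
  · constructor
    · rintro ⟨-, h₁, h₂⟩; exact ⟨h₁, by rw [clo_target hi h₁, h₂]⟩
    · rintro ⟨h₁, h₂⟩
      exact ⟨succ_lt hi (by omega), h₁, by rw [h₂, clo_target hi h₁]⟩
  · tauto

/-- The program that prepares the memory and computes the static tables. -/
def setupCmd : Cmd :=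
  .seq prelude <| .seq (rounds endDefs) <| .seq (defsCmd [sndDef]) <| .seq (rounds scopeDefs) <|
  .seq (rounds expEqDefs) (defsCmd eqDefs)

theorem iterate_defsSem_of_notMem {c : Ctx} {ds : List Def} {p : ℕ} (h : p ∉ ds.map Def.head)
    (D : DB) (k : ℕ) : (defsSem c ds)^[k] D p = D p := by
  induction k with
  | zero => rfl
  | succ k ih => rw [Function.iterate_succ_apply', defsSem_of_notMem h, ih]

/-- The set-up takes time of order `n ^ 5`: each of `n` rounds evaluates clauses with at most four
variables. The tables of the analysis are still empty. -/
theorem setup_runs : ∃ C, ∀ e : Exp, ∃ m D, Runs setupCmd (input e) m (C * e.size ^ 6) ∧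
    Rep (ctx e) m D ∧ m.reg 6 = 8 * e.size ^ 3 ∧
    (∀ p ∈ [10, 16, 17, 18, 19, 20, 21], Agree e.size D (stat e) p) ∧
    ∀ p ∈ [2, 3, 4, 5, 6, 7], D p = fun _ => False := by
  obtain ⟨C₁, h₁⟩ := rounds_runs (ds := endDefs) (q := 4) (by decide)
  obtain ⟨C₂, h₂⟩ := defs_runs (ds := [sndDef]) (q := 4) (by decide)
  obtain ⟨C₃, h₃⟩ := rounds_runs (ds := scopeDefs) (q := 4) (by decide)
  obtain ⟨C₄, h₄⟩ := rounds_runs (ds := expEqDefs) (q := 4) (by decide)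
  obtain ⟨C₅, h₅⟩ := defs_runs (ds := eqDefs) (q := 4) (by decide)
  refine ⟨30 + (C₁ + (C₂ + (C₃ + (C₄ + C₅)))), fun e => ?_⟩
  have hn : 0 < (ctx e).n := e.size_pos
  obtain ⟨m₀, r₀, hm₀, k₀⟩ := prelude_runs (c := ctx e) hn (m := input e)
    (fun r hr => by simp [input, hr]) (by simp [input, ctx])
    (fun i hi => by simp only [input, if_true, code_getD hi]; rfl)
    (fun i hi => by simp only [input, one_ne_zero, if_true, if_false, code_getD hi]; rfl)
    (fun p hp i => by simp only [input]; rw [if_neg (by omega), if_neg (by omega)])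
  obtain ⟨m₁, r₁, hm₁, k₁⟩ := h₁ _ hn _ _ hm₀
  obtain ⟨m₂, r₂, hm₂, k₂⟩ := h₂ _ hn _ _ hm₁
  obtain ⟨m₃, r₃, hm₃, k₃⟩ := h₃ _ hn _ _ hm₂
  obtain ⟨m₄, r₄, hm₄, k₄⟩ := h₄ _ hn _ _ hm₃
  obtain ⟨m₅, r₅, hm₅, k₅⟩ := h₅ _ hn _ _ hm₄
  rw [ctx_n] at *
  set D₁ := (defsSem (ctx e) endDefs)^[e.size] fun _ _ => False with hD₁
  set D₂ := defsSem (ctx e) [sndDef] D₁ with hD₂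
  set D₃ := (defsSem (ctx e) scopeDefs)^[e.size] D₂ with hD₃
  set D₄ := (defsSem (ctx e) expEqDefs)^[e.size] D₃ with hD₄
  set D₅ := defsSem (ctx e) eqDefs D₄ with hD₅
  have a₁ : Agree e.size D₁ (stat e) 9 := end_agree rfl
  have a₂ : Agree e.size D₂ (stat e) 10 := snd_agree a₁
  have n₁ : ∀ p, p ∉ [38, 9] → D₁ p = fun _ => False := fun p hp => by
    rw [hD₁, iterate_defsSem_of_notMem hp]
  have n₂ : ∀ p, p ∉ [38, 9, 10] → D₂ p = fun _ => False := fun p hp => by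
    simp only [List.mem_cons, List.not_mem_nil, or_false, not_or] at hp
    rw [hD₂, defsSem_of_notMem (by simp [sndDef, hp]), n₁ p (by simp [hp])]
  have a₃ : Agree e.size D₃ (stat e) 11 := scope_agree (n₂ 11 (by decide)) a₂
  have n₃ : ∀ p, p ∉ [40, 11] → D₃ p = D₂ p := fun p hp => by
    rw [hD₃, iterate_defsSem_of_notMem hp]
  have a₃' : Agree e.size D₃ (stat e) 10 := by
    unfold Agree; rw [n₃ 10 (by decide)]; exact a₂
  have a₄ : Agree e.size D₄ (stat e) 12 :=
    expEq_agree (by rw [n₃ 12 (by decide), n₂ 12 (by decide)]) a₃'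
  have n₄ : ∀ p, p ∉ [13, 14, 41, 12] → D₄ p = D₃ p := fun p hp => by
    rw [hD₄, iterate_defsSem_of_notMem hp]
  have a₅ : ∀ p, p ∈ [10, 11, 12] ∨ p ∈ eqDefs.map Def.head → Agree e.size D₅ (stat e) p := by
    refine defsSem_agree (c := ctx e) (T := stat e) (ds := eqDefs) (ok := [10, 11, 12])
      (by decide) (by decide) (fun p hp => ?_) eqDefs_sem
    simp only [List.mem_cons, List.not_mem_nil, or_false] at hp
    rcases hp with rfl | rfl | rfl
    · show Agree e.size D₄ _ _
      unfold Agree; rw [n₄ 10 (by decide)]; exact a₃'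
    · show Agree e.size D₄ _ _
      unfold Agree; rw [n₄ 11 (by decide)]; exact a₃
    · exact a₄
  refine ⟨m₅, D₅, ?_, hm₅, ?_, fun p hp => a₅ p ?_, fun p hp => ?_⟩
  · refine (r₀.seq <| r₁.seq <| r₂.seq <| r₃.seq <| r₄.seq r₅).mono ?_
    simp only [Nat.add_mul]
    have hle : ∀ k ≤ 6, e.size ^ k ≤ e.size ^ 6 := fun k hk => Nat.pow_le_pow_right hn hk
    gcongr <;> first | exact hn | omega
  · rw [k₅ 6 (by omega) (by omega), k₄, k₃, k₂ 6 (by omega) (by omega), k₁, k₀]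
  · revert p; decide
  · have h : ∀ p ∈ [2, 3, 4, 5, 6, 7], p ∉ eqDefs.map Def.head ∧ p ∉ [13, 14, 41, 12] ∧
        p ∉ [40, 11] ∧ p ∉ [38, 9, 10] := by decide
    obtain ⟨g₁, g₂, g₃, g₄⟩ := h p hp
    rw [hD₅, defsSem_of_notMem g₁, n₄ p g₂, n₃ p g₃, n₂ p g₄]

/-! ### One step of the iteration function -/

variable {s : System Var}

theorem mem_push {ψ ψ' : PState Var} {φ : Frame Var} :
    (ψ, .push φ, ψ') ∈ (transfer mono e s).1.2 ↔ ψ ∈ s.1.1 ∧ IsPush ψ φ ψ' := by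
  constructor
  · rintro ⟨σ', (⟨_, _, _, _, heq, h, h'⟩ | ⟨_, _, _, heq, -⟩) | ⟨_, _, _, _, _, _, heq, -⟩⟩ <;>
      simp only [Prod.mk.injEq, Act.push.injEq, reduceCtorEq, false_and, and_false] at heq
    obtain ⟨⟨rfl, rfl, rfl⟩, rfl⟩ := heq
    exact ⟨h, (pstep_push.1 h').1⟩
  · rintro ⟨h, h'⟩
    exact ⟨s.2.2, .inl (.inl ⟨ψ, φ, ψ', _, rfl, h, pstep_push.2 ⟨h', rfl⟩⟩)⟩

theorem mem_eps {ψ ψ' : PState Var} :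
    (ψ, .eps, ψ') ∈ (transfer mono e s).1.2 ↔ ψ ∈ s.1.1 ∧ ∃ f a ρ c, ψ = (.call f a, ρ) ∧
      c ∈ aeval f ρ s.2.2 ∧ ψ' = Clo.target c := by
  constructor
  · rintro ⟨σ', (⟨_, _, _, _, heq, -⟩ | ⟨_, _, _, heq, h, h'⟩) | ⟨_, _, _, _, _, _, heq, -⟩⟩ <;>
      simp only [Prod.mk.injEq, reduceCtorEq, false_and, and_false, true_and] at heq
    obtain ⟨⟨rfl, rfl⟩, rfl⟩ := heq
    obtain ⟨f, a, ρ, c, h₁, h₂, h₃, -⟩ := pstep_eps.1 h'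
    exact ⟨h, f, a, ρ, c, h₁, h₂, h₃⟩
  · rintro ⟨h, f, a, ρ, c, h₁, h₂, h₃⟩
    exact ⟨_, .inl (.inr ⟨ψ, ψ', _, rfl, h, pstep_eps.2 ⟨f, a, ρ, c, h₁, h₂, h₃, rfl⟩⟩)⟩

theorem mem_pop {ψ ψ' : PState Var} {φ : Frame Var} :
    (ψ, .pop φ, ψ') ∈ (transfer mono e s).1.2 ↔ (∃ a ρ, ψ = (.ret a, ρ)) ∧ ψ' = Frame.target φ ∧
      ∃ ψ₀ ψ₁, (ψ₀, .push φ, ψ₁) ∈ s.1.2 ∧ (ψ₁, ψ) ∈ s.2.1 := by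
  constructor
  · rintro ⟨σ', (⟨_, _, _, _, heq, -⟩ | ⟨_, _, _, heq, -⟩) | ⟨ψ₀, _, ψ₁, _, _, _, heq, h, h'⟩⟩ <;>
      simp only [Prod.mk.injEq, Act.pop.injEq, reduceCtorEq, false_and, and_false] at heq
    obtain ⟨⟨rfl, rfl, rfl⟩, rfl⟩ := heq
    obtain ⟨a, ρ, h₁, h₂, -⟩ := pstep_pop.1 h
    exact ⟨⟨a, ρ, h₁⟩, h₂, ψ₀, ψ₁, h'⟩
  · rintro ⟨⟨a, ρ, h₁⟩, h₂, ψ₀, ψ₁, h'⟩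
    exact ⟨_, .inr ⟨ψ₀, φ, ψ₁, ψ, ψ', _, rfl, pstep_pop.2 ⟨a, ρ, h₁, h₂, rfl⟩, h'⟩⟩

theorem mem_nodes {ψ : PState Var} : ψ ∈ (transfer mono e s).1.1 ↔
    ψ ∈ s.1.1 ∨ ψ = (e, Env.empty) ∨ ∃ ψ₀ g, (ψ₀, g, ψ) ∈ (transfer mono e s).1.2 := by
  change (_ ∨ _) ∨ _ ↔ _
  rw [or_assoc]; rfl

theorem mem_closure {ψ ψ' : PState Var} : (ψ, ψ') ∈ (transfer mono e s).2.1 ↔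
    (∃ ψ₁, (ψ, ψ₁) ∈ s.2.1 ∧ (ψ₁, ψ') ∈ s.2.1) ∨
    (∃ φ ψ₁ ψ₂, (ψ, .push φ, ψ₁) ∈ s.1.2 ∧ (ψ₁, ψ₂) ∈ s.2.1 ∧ (ψ₂, .pop φ, ψ') ∈ s.1.2) ∨
    (ψ, .eps, ψ') ∈ (transfer mono e s).1.2 ∨ (ψ ∈ (transfer mono e s).1.1 ∧ ψ' = ψ) := by
  change ((_ ∨ _) ∨ _) ∨ _ ↔ _
  rw [or_assoc, or_assoc]; rfl

/-- The values that one step adds to the store. -/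
def NewVal (s : System Var) (v : Var) (c : Clo Var) : Prop :=
  (∃ f a ρ d, (.call f a, ρ) ∈ s.1.1 ∧ d ∈ aeval f ρ s.2.2 ∧ d.1.1 = v ∧ c ∈ aeval a ρ s.2.2) ∨
  ∃ a ρ φ ψ₀ ψ₁, (ψ₀, .push φ, ψ₁) ∈ s.1.2 ∧ (ψ₁, (.ret a, ρ)) ∈ s.2.1 ∧ φ.1 = v ∧
    c ∈ aeval a ρ s.2.2

theorem mem_store_imp {v : Var} {c : Clo Var} (h : c ∈ (transfer mono e s).2.2 v) :
    c ∈ s.2.2 v ∨ NewVal s v c := by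
  obtain ⟨σ', ⟨g, (⟨ψ, _, _, _, heq, -, h⟩ | ⟨ψ, _, _, heq, hψ, h⟩) |
    ⟨ψ₀, φ, ψ₁, ψ, _, _, heq, h, h₁, h₂⟩⟩, hc⟩ := mem_sSup.1 h <;>
    obtain ⟨rfl, rfl⟩ := Prod.mk.inj heq
  · obtain ⟨-, rfl⟩ := pstep_push.1 h
    exact .inl hc
  · obtain ⟨f, a, ρ, d, rfl, h₁, -, rfl⟩ := pstep_eps.1 h
    rcases hc with hc | ⟨rfl, hc⟩
    · exact .inl hc
    · exact .inr (.inl ⟨f, a, ρ, d, hψ, h₁, rfl, hc⟩)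
  · obtain ⟨a, ρ, rfl, -, rfl⟩ := pstep_pop.1 h
    rcases hc with hc | ⟨rfl, hc⟩
    · exact .inl hc
    · exact .inr (.inr ⟨a, ρ, φ, ψ₀, ψ₁, h₁, h₂, rfl, hc⟩)

/-- The new store is the join of the stores of the transitions, without the old store, but nothing
is lost if the system grows. -/
theorem mem_store (hs : s ≤ transfer mono e s) {v : Var} {c : Clo Var} :
    c ∈ (transfer mono e s).2.2 v ↔ c ∈ s.2.2 v ∨ NewVal s v c := by
  refine ⟨mem_store_imp, ?_⟩
  rintro (h | ⟨f, a, ρ, d, h₁, h₂, rfl, h₃⟩ | ⟨a, ρ, φ, ψ₀, ψ₁, h₁, h₂, rfl, h₃⟩)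
  · exact hs.2.2 v h
  · exact mem_sSup.2 ⟨_, ⟨_, .inl (.inr ⟨_, _, _, rfl, h₁,
      pstep_eps.2 ⟨f, a, ρ, d, rfl, h₂, rfl, rfl⟩⟩)⟩, .inr ⟨rfl, h₃⟩⟩
  · exact mem_sSup.2 ⟨_, ⟨_, .inr ⟨ψ₀, φ, ψ₁, _, _, _, rfl,
      pstep_pop.2 ⟨a, ρ, rfl, rfl, rfl⟩, h₁, h₂⟩⟩, .inr ⟨rfl, h₃⟩⟩

/-! ### Systems whose parts come from nodes -/

/-- The state comes from a node. -/
def IsNode (e : Exp) (ψ : PState Var) : Prop := ∃ i < e.size, pt e i = ψ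

/-- All parts of the system come from nodes, and a push edge leads from a `let` to its call, pushing
the frame of this `let`. -/
structure NodeSys (e : Exp) (s : System Var) : Prop where
  node : ∀ ψ ∈ s.1.1, IsNode e ψ
  push : ∀ ψ φ ψ', (ψ, .push φ, ψ') ∈ s.1.2 → IsPush ψ φ ψ'
  edge : ∀ ψ g ψ', (ψ, g, ψ') ∈ s.1.2 → IsNode e ψ ∧ IsNode e ψ' ∧
    ∀ φ, (g = .push φ ∨ g = .pop φ) → ∃ l < e.size, (ctx e).kd l = 4 ∧ fr e l = φ
  closure : ∀ ψ ψ', (ψ, ψ') ∈ s.2.1 → IsNode e ψ ∧ IsNode e ψ'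
  store : ∀ v c, c ∈ s.2.2 v →
    (∃ b < e.size, ((ctx e).kd b = 2 ∨ (ctx e).kd b = 4) ∧ (ctx e).nm b = v) ∧
    ∃ j < e.size, (ctx e).kd j = 2 ∧ clo e j = c

theorem IsPush.node {ψ ψ' : PState Var} {φ : Frame Var} (h : IsPush ψ φ ψ') {i : ℕ}
    (hi : i < e.size) (hψ : pt e i = ψ) :
    (ctx e).kd i = 4 ∧ fr e i = φ ∧ i + 1 < e.size ∧ pt e (i + 1) = ψ' := by
  obtain ⟨v, f, a, b, ρ, rfl, rfl, rfl⟩ := h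
  exact ⟨kd_four.2 ⟨_, _, _, _, _, hψ⟩, by simp [fr, hψ], (pt_letin hi hψ).1⟩

theorem isPush_fr {i : ℕ} (hi : i < e.size) (h : (ctx e).kd i = 4) :
    IsPush (pt e i) (fr e i) (pt e (i + 1)) := by
  obtain ⟨v, f, a, b, ρ, h⟩ := kd_four.1 h
  exact ⟨v, f, a, b, ρ, h, by simp [fr, h], (pt_letin hi h).1.2⟩

theorem fr_fst {i : ℕ} (h : (ctx e).kd i = 4) : (fr e i).1 = (ctx e).nm i := by
  obtain ⟨v, f, a, b, ρ, h⟩ := kd_four.1 h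
  simp [fr, ctx, h, Exp.name]

theorem clo_fst {i : ℕ} (h : (ctx e).kd i = 2) : (clo e i).1.1 = (ctx e).nm i := by
  obtain ⟨v, b, ρ, h⟩ := kd_two.1 h
  simp [clo, ctx, h, Exp.name]

theorem pt_eq_of_clo {i : ℕ} {c : Clo Var} (h : (ctx e).kd i = 2) (hc : clo e i = c) :
    pt e i = (.ret (.lam c.1.1 c.1.2), c.2) := by
  obtain ⟨v, b, ρ, h⟩ := kd_two.1 h
  subst hc
  simp [clo, h]

theorem clo_eq_of_pt {i : ℕ} {c : Clo Var} (h : pt e i = (.ret (.lam c.1.1 c.1.2), c.2)) :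
    (ctx e).kd i = 2 ∧ clo e i = c :=
  ⟨kd_two.2 ⟨_, _, _, h⟩, by simp [clo, h]⟩

/-- The values of atoms at nodes are closures of nodes. -/
theorem NodeSys.aeval (hs : NodeSys e s) {i : ℕ} (hi : i < e.size) {a : Atom} {ρ : Env Var}
    (h : pt e i = (.ret a, ρ)) {c : Clo Var} (hc : c ∈ aeval a ρ s.2.2) :
    ∃ j < e.size, (ctx e).kd j = 2 ∧ clo e j = c := by
  cases a with
  | lam v b =>
    obtain rfl : c = ((v, b), ρ) := hc
    exact ⟨i, hi, clo_eq_of_pt h⟩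
  | var v =>
    obtain ⟨w, -, hc⟩ := hc
    exact (hs.store w c hc).2

theorem nodeSys_bot : NodeSys e ⊥ where
  node := fun _ h => h.elim
  push := fun _ _ _ h => h.elim
  edge := fun _ _ _ h => h.elim
  closure := fun _ _ h => h.elim
  store := fun _ _ h => h.elim

theorem NodeSys.transfer (hs : NodeSys e s) : NodeSys e (transfer mono e s) := by
  have htarget : ∀ {c : Clo Var} {j}, j < e.size → (ctx e).kd j = 2 → clo e j = c →
      IsNode e (Clo.target c) := fun hj hk hc =>
    ⟨_, succ_lt hj (by omega), by rw [← hc, clo_target hj hk]⟩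
  have hedge : ∀ ψ g ψ', (ψ, g, ψ') ∈ (PDCFA.transfer mono e s).1.2 → IsNode e ψ ∧ IsNode e ψ' ∧
      ∀ φ, (g = .push φ ∨ g = .pop φ) → ∃ l < e.size, (ctx e).kd l = 4 ∧ fr e l = φ := by
    intro ψ g ψ' h
    cases g with
    | push φ =>
      obtain ⟨h, h'⟩ := mem_push.1 h
      obtain ⟨i, hi, hψ⟩ := hs.node ψ h
      obtain ⟨h₁, h₂, h₃⟩ := h'.node hi hψ
      refine ⟨⟨i, hi, hψ⟩, ⟨_, h₃⟩, ?_⟩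
      rintro φ' (h | h)
      · cases h; exact ⟨i, hi, h₁, h₂⟩
      · cases h
    | eps =>
      obtain ⟨h₁, f, a, ρ, c, rfl, h₂, rfl⟩ := mem_eps.1 h
      obtain ⟨i, hi, hψ⟩ := hs.node _ h₁
      obtain ⟨⟨h₃, h₄⟩, -⟩ := pt_call hi hψ
      obtain ⟨j, hj, hk, hc⟩ := hs.aeval h₃ h₄ h₂
      exact ⟨⟨i, hi, hψ⟩, htarget hj hk hc, fun φ h => by rcases h with h | h <;> cases h⟩
    | pop φ =>
      obtain ⟨-, rfl, ψ₀, ψ₁, h₁, h₂⟩ := mem_pop.1 h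
      obtain ⟨l, hl, hk, hf⟩ := (hs.edge _ _ _ h₁).2.2 φ (.inl rfl)
      refine ⟨(hs.closure _ _ h₂).2, ⟨snd e l, snd_lt hl (.inr hk), ?_⟩, ?_⟩
      · rw [← fr_target hl hk, hf]
      · rintro φ' (h | h)
        · cases h
        · cases h; exact ⟨l, hl, hk, hf⟩
  have hnode : ∀ ψ ∈ (PDCFA.transfer mono e s).1.1, IsNode e ψ := by
    intro ψ h
    rcases mem_nodes.1 h with h | rfl | ⟨ψ₀, g, h⟩
    · exact hs.node _ h
    · exact ⟨0, e.size_pos, pt_zero⟩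
    · exact (hedge _ _ _ h).2.1
  refine ⟨hnode, fun ψ φ ψ' h => (mem_push.1 h).2, hedge, fun ψ ψ' h => ?_, fun v c h => ?_⟩
  · rcases mem_closure.1 h with ⟨ψ₁, h₁, h₂⟩ | ⟨φ, ψ₁, ψ₂, h₁, h₂, h₃⟩ | h | ⟨h, rfl⟩
    · exact ⟨(hs.closure _ _ h₁).1, (hs.closure _ _ h₂).2⟩
    · exact ⟨(hs.edge _ _ _ h₁).1, (hs.edge _ _ _ h₃).2.1⟩
    · exact ⟨(hedge _ _ _ h).1, (hedge _ _ _ h).2.1⟩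
    · exact ⟨hnode _ h, hnode _ h⟩
  · rcases mem_store_imp h with h | ⟨f, a, ρ, d, h₁, h₂, rfl, h₃⟩ |
      ⟨a, ρ, φ, ψ₀, ψ₁, h₁, h₂, rfl, h₃⟩
    · exact hs.store v c h
    · obtain ⟨i, hi, hψ⟩ := hs.node _ h₁
      obtain ⟨⟨h₄, h₅⟩, h₆, h₇⟩ := pt_call hi hψ
      obtain ⟨b, hb, hk, hc⟩ := hs.aeval h₄ h₅ h₂
      exact ⟨⟨b, hb, .inl hk, by rw [← hc, clo_fst hk]⟩, hs.aeval h₆ h₇ h₃⟩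
    · obtain ⟨l, hl, hk, hf⟩ := (hs.edge _ _ _ h₁).2.2 φ (.inl rfl)
      obtain ⟨j, hj, hψ⟩ := (hs.closure _ _ h₂).2
      exact ⟨⟨l, hl, .inr hk, by rw [← hf, fr_fst hk]⟩, hs.aeval hj hψ h₃⟩

/-! ### The tables of a system -/

/-- The tables of a system, as the memory format prescribes them. -/
def sysTab (e : Exp) (s : System Var) : DB
  | 2, [i] => pt e i ∈ s.1.1
  | 3, [i, j] => (pt e i, .eps, pt e j) ∈ s.1.2
  | 4, [i, l, j] => (ctx e).kd l = 4 ∧ (pt e i, .push (fr e l), pt e j) ∈ s.1.2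
  | 5, [i, l, j] => (ctx e).kd l = 4 ∧ (pt e i, .pop (fr e l), pt e j) ∈ s.1.2
  | 6, [i, j] => (pt e i, pt e j) ∈ s.2.1
  | 7, [i, j] => ((ctx e).kd i = 2 ∨ (ctx e).kd i = 4) ∧ (ctx e).kd j = 2 ∧
      clo e j ∈ s.2.2 ((ctx e).nm i)
  | _, _ => False

theorem sysTab_mono {s t : System Var} (h : s ≤ t) {p : ℕ} {xs : List ℕ} (hx : sysTab e s p xs) :
    sysTab e t p xs := by
  obtain ⟨⟨hP, hE⟩, hH, hσ⟩ := h
  unfold sysTab at hx ⊢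
  split at hx
  · exact hP hx
  · exact hE hx
  · exact ⟨hx.1, hE hx.2⟩
  · exact ⟨hx.1, hE hx.2⟩
  · exact hH hx
  · exact ⟨hx.1, hx.2.1, hσ _ hx.2.2⟩
  · exact hx

/-- A system from nodes is determined by its tables. -/
theorem NodeSys.le_of_sysTab {s t : System Var} (hs : NodeSys e s)
    (h : ∀ p ∈ [2, 3, 4, 5, 6, 7], ∀ xs, Valid e.size p xs → sysTab e s p xs → sysTab e t p xs) :
    s ≤ t := by
  refine ⟨⟨fun ψ hψ => ?_, ?_⟩, ?_, fun v c hc => ?_⟩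
  · obtain ⟨i, hi, rfl⟩ := hs.node ψ hψ
    exact h 2 (by decide) [i] ((valid_one rfl).2 ⟨_, rfl, hi⟩) hψ
  · rintro ⟨ψ, g, ψ'⟩ hg
    obtain ⟨⟨i, hi, rfl⟩, ⟨j, hj, rfl⟩, hf⟩ := hs.edge ψ g ψ' hg
    cases g with
    | eps => exact h 3 (by decide) [i, j] ((valid_two rfl).2 ⟨_, _, rfl, hi, hj⟩) hg
    | push φ =>
      obtain ⟨l, hl, hk, rfl⟩ := hf φ (.inl rfl)
      exact (h 4 (by decide) [i, l, j] ((valid_three rfl).2 ⟨_, _, _, rfl, hi, hl, hj⟩) ⟨hk, hg⟩).2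
    | pop φ =>
      obtain ⟨l, hl, hk, rfl⟩ := hf φ (.inr rfl)
      exact (h 5 (by decide) [i, l, j] ((valid_three rfl).2 ⟨_, _, _, rfl, hi, hl, hj⟩) ⟨hk, hg⟩).2
  · rintro ⟨ψ, ψ'⟩ hg
    obtain ⟨⟨i, hi, rfl⟩, j, hj, rfl⟩ := hs.closure ψ ψ' hg
    exact h 6 (by decide) [i, j] ((valid_two rfl).2 ⟨_, _, rfl, hi, hj⟩) hg
  · obtain ⟨⟨b, hb, hk, rfl⟩, j, hj, hk', rfl⟩ := hs.store v c hc
    exact (h 7 (by decide) [b, j] ((valid_two rfl).2 ⟨_, _, rfl, hb, hj⟩) ⟨hk, hk', hc⟩).2.2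

theorem isFrame_iff {l : ℕ} {φ : Frame Var} :
    IsFrame e l φ ↔ l < e.size ∧ (ctx e).kd l = 4 ∧ fr e l = φ := by
  unfold IsFrame
  simp only [isPoint_iff]
  constructor
  · rintro ⟨f, a, hl, h⟩
    exact ⟨hl, kd_four.2 ⟨_, _, _, _, _, h⟩, by simp [fr, h]⟩
  · rintro ⟨hl, hk, rfl⟩
    obtain ⟨v, f, a, b, ρ, h⟩ := kd_four.1 hk
    exact ⟨f, a, hl, by simp [fr, h]⟩

theorem isClo_iff {j : ℕ} {c : Clo Var} :
    IsClo e j c ↔ j < e.size ∧ (ctx e).kd j = 2 ∧ clo e j = c := by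
  unfold IsClo
  rw [isPoint_iff]
  exact and_congr_right fun _ => ⟨clo_eq_of_pt, fun h => pt_eq_of_clo h.1 h.2⟩

theorem isBinder_iff {b : ℕ} {v : Var} : IsBinder e b v ↔
    b < e.size ∧ ((ctx e).kd b = 2 ∨ (ctx e).kd b = 4) ∧ (ctx e).nm b = v := by
  unfold IsBinder
  simp only [isFrame_iff, isClo_iff]
  constructor
  · rintro (⟨φ, ⟨hb, hk, rfl⟩, rfl⟩ | ⟨φ, ⟨hb, hk, rfl⟩, rfl⟩)
    · exact ⟨hb, .inr hk, (fr_fst hk).symm⟩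
    · exact ⟨hb, .inl hk, (clo_fst hk).symm⟩
  · rintro ⟨hb, hk | hk, rfl⟩
    · exact .inr ⟨_, ⟨hb, hk, rfl⟩, clo_fst hk⟩
    · exact .inl ⟨_, ⟨hb, hk, rfl⟩, fr_fst hk⟩

theorem holds_of_rep {m : Mem} {D : DB} (hs : NodeSys e s) (hm : Rep (ctx e) m D)
    (hD : ∀ p ∈ [2, 3, 4, 5, 6, 7], Agree e.size D (sysTab e s) p) : Holds e s m := by
  have key : ∀ p ∈ [2, 3, 4, 5, 6, 7], ∀ xs, Valid e.size p xs →
      m.arr p (enc e.size xs) = bit (sysTab e s p xs) := fun p hp xs hx => by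
    have hp' : ∀ p ∈ [2, 3, 4, 5, 6, 7], IsTab p := by decide
    rw [← propext (hD p hp xs hx)]
    exact hm.tab p (hp' p hp) xs hx
  have one : ∀ p ∈ [2, 3, 4, 5, 6, 7], ar p = 1 → ∀ i < e.size,
      m.arr p i = bit (sysTab e s p [i]) := fun p hp ha i hi => by
    simpa [encFrom] using key p hp [i] ((valid_one ha).2 ⟨i, rfl, hi⟩)
  have two : ∀ p ∈ [2, 3, 4, 5, 6, 7], ar p = 2 → ∀ i < e.size, ∀ j < e.size,
      m.arr p (i * e.size + j) = bit (sysTab e s p [i, j]) := fun p hp ha i hi j hj => by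
    simpa [encFrom] using key p hp [i, j] ((valid_two ha).2 ⟨i, j, rfl, hi, hj⟩)
  have three : ∀ p ∈ [2, 3, 4, 5, 6, 7], ar p = 3 → ∀ i < e.size, ∀ j < e.size, ∀ k < e.size,
      m.arr p ((i * e.size + j) * e.size + k) = bit (sysTab e s p [i, j, k]) :=
    fun p hp ha i hi j hj k hk => by
      simpa [encFrom] using key p hp [i, j, k] ((valid_three ha).2 ⟨i, j, k, rfl, hi, hj, hk⟩)
  refine ⟨?_, ?_, ?_, ?_, ?_, ?_, ?_, ?_, ?_, ?_⟩
  · exact fun ψ h => by simpa only [isPoint_iff, IsNode] using hs.node ψ h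
  · exact fun ψ g ψ' h => by simpa only [isPoint_iff, isFrame_iff, IsNode] using hs.edge ψ g ψ' h
  · exact fun ψ ψ' h => by simpa only [isPoint_iff, IsNode] using hs.closure ψ ψ' h
  · exact fun v c h => by simpa only [isBinder_iff, isClo_iff] using hs.store v c h
  all_goals simp only [isPoint_iff, isFrame_iff, isBinder_iff, isClo_iff]
  · rintro i _ ⟨hi, rfl⟩
    exact one 2 (by decide) rfl i hi
  · rintro i j _ _ ⟨hi, rfl⟩ ⟨hj, rfl⟩
    exact two 3 (by decide) rfl i hi j hj
  · rintro i l j _ _ _ ⟨hi, rfl⟩ ⟨hl, hk, rfl⟩ ⟨hj, rfl⟩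
    rw [three 4 (by decide) rfl i hi l hl j hj]
    simp only [sysTab, hk, true_and]
  · rintro i l j _ _ _ ⟨hi, rfl⟩ ⟨hl, hk, rfl⟩ ⟨hj, rfl⟩
    rw [three 5 (by decide) rfl i hi l hl j hj]
    simp only [sysTab, hk, true_and]
  · rintro i j _ _ ⟨hi, rfl⟩ ⟨hj, rfl⟩
    exact two 6 (by decide) rfl i hi j hj
  · rintro i j _ _ ⟨hi, hk, rfl⟩ ⟨hj, hk', rfl⟩
    rw [two 7 (by decide) rfl i hi j hj]
    simp only [sysTab, hk, hk', true_and]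

/-! ### The tables of an iteration -/

/-- The function of the call at node `i`, or its argument, evaluates to the closure of node `c`. -/
def CallVal (e : Exp) (s : System Var) (arg : Bool) (i c : ℕ) : Prop :=
  (ctx e).kd c = 2 ∧ ∃ f a ρ, pt e i = (.call f a, ρ) ∧
    clo e c ∈ aeval (bif arg then a else f) ρ s.2.2

/-- The states that node `j` stands for may return to the frame of node `l`. -/
def Returns (e : Exp) (s : System Var) (j l : ℕ) : Prop :=
  (ctx e).kd l = 4 ∧ ((ctx e).kd j ≠ 3 ∧ (ctx e).kd j ≠ 4) ∧
    ∃ ψ₀ ψ₁, (ψ₀, .push (fr e l), ψ₁) ∈ s.1.2 ∧ (ψ₁, pt e j) ∈ s.2.1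

/-- The intended tables in an iteration that starts from the system `s`. -/
def tabs (e : Exp) (s : System Var) : DB
  -- node `i` returns an atom that evaluates to the closure of node `c`
  | 22, [i, c] => (ctx e).kd c = 2 ∧ ∃ a ρ, pt e i = (.ret a, ρ) ∧ clo e c ∈ aeval a ρ s.2.2
  | 23, [i, c] => CallVal e s false i c
  | 24, [i, c] => CallVal e s true i c
  -- the closure of node `d` is a new value of the variable that node `b` binds
  | 25, [b, d] => (ctx e).kd d = 2 ∧
      (((ctx e).kd b = 2 ∧ ∃ i < e.size, pt e i ∈ s.1.1 ∧ CallVal e s false i b ∧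
        CallVal e s true i d) ∨
      ∃ j < e.size, Returns e s j b ∧ ∃ a ρ, pt e j = (.ret a, ρ) ∧ clo e d ∈ aeval a ρ s.2.2)
  | 26, [j, l] => Returns e s j l
  -- the `let` at node `i` has been entered, and `j` is reached with its frame on top
  | 27, [i, j] => (ctx e).kd i = 4 ∧
      ∃ ψ, (pt e i, .push (fr e i), ψ) ∈ s.1.2 ∧ (ψ, pt e j) ∈ s.2.1
  | 28, [i, j] => ∃ φ ψ₁ ψ₂, (pt e i, .push φ, ψ₁) ∈ s.1.2 ∧ (ψ₁, ψ₂) ∈ s.2.1 ∧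
      (ψ₂, .pop φ, pt e j) ∈ s.1.2
  | 2, xs => sysTab e s 2 xs
  | 3, xs => sysTab e s 3 xs
  | 4, xs => sysTab e s 4 xs
  | 5, xs => sysTab e s 5 xs
  | 6, xs => sysTab e s 6 xs
  | 7, xs => sysTab e s 7 xs
  | 32, xs => sysTab e (transfer mono e s) 2 xs
  | 33, xs => sysTab e (transfer mono e s) 3 xs
  | 34, xs => sysTab e (transfer mono e s) 4 xs
  | 35, xs => sysTab e (transfer mono e s) 5 xs
  | 36, xs => sysTab e (transfer mono e s) 6 xs
  | 37, xs => sysTab e (transfer mono e s) 7 xs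
  | p, xs => stat e p xs

/-- The values of the atoms. -/
def valDef : Def := ⟨22, [(0, [kd 2 0, tb 16 [0, 1]]), (1, [tb 21 [0, 2], tb 7 [2, 1]])]⟩
/-- The values of the functions of calls. -/
def funDef : Def := ⟨23, [(1, [kd 3 0, sc 0 2, tb 22 [2, 1]])]⟩
/-- The values of the arguments of calls. -/
def argDef : Def := ⟨24, [(1, [kd 3 0, tb 10 [0, 2], tb 22 [2, 1]])]⟩
/-- The new ε-edges. -/
def epsDef : Def := ⟨33, [(1, [tb 2 [0], tb 23 [0, 2], tb 20 [2, 1]])]⟩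
/-- A push edge followed by an ε-closure edge. A `let` pushes its own frame, so the frame needs no
variable besides that of the node. -/
def bodyDef : Def := ⟨27, [(1, [tb 4 [0, 0, 2], tb 6 [2, 1]])]⟩
/-- The returning states and the frames on top of their stacks. Table 17 is needed because distinct
nodes may stand for the same frame. -/
def returnDef : Def := ⟨26, [(1, [no (kd 3 0), no (kd 4 0), tb 27 [2, 0], tb 17 [2, 1]])]⟩
/-- The new pop edges. -/
def popDef : Def := ⟨35, [(0, [tb 26 [0, 1], tb 19 [1, 2]])]⟩
/-- The new values, for each binding node by itself: collecting them for the variable in the same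
clause would take a fourth variable. -/
def bindDef : Def :=
  ⟨25, [(1, [tb 2 [2], tb 23 [2, 0], tb 24 [2, 1]]), (1, [tb 26 [2, 0], tb 22 [2, 1]])]⟩
/-- The new store: the old one, and the new values at all nodes that bind the same variable. -/
def storeDef : Def :=
  ⟨37, [(0, [tb 7 [0, 1]]), (1, [tb 25 [2, 1], sm 2 0, kd 2 0]),
    (1, [tb 25 [2, 1], sm 2 0, kd 4 0])]⟩
/-- The new push edges. -/
def pushDef : Def := ⟨34, [(0, [tb 2 [0], tb 17 [0, 1], tb 18 [0, 2]])]⟩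
/-- The new nodes. -/
def nodeDef : Def :=
  ⟨32, [(0, [tb 2 [0]]), (1, [(true, .root 1), tb 16 [1, 0]]), (1, [tb 33 [1, 0]]),
    (2, [tb 34 [1, 2, 0]]), (2, [tb 35 [1, 2, 0]])]⟩
/-- A push edge, an ε-closure edge, and the matching pop edge. The frame is that of the first node,
and the first two edges have been joined, so three variables suffice. -/
def matchDef : Def := ⟨28, [(1, [tb 27 [0, 2], tb 5 [2, 0, 1]])]⟩
/-- The new ε-closure edges. -/
def closureDef : Def :=
  ⟨36, [(1, [tb 6 [0, 2], tb 6 [2, 1]]), (0, [tb 28 [0, 1]]), (0, [tb 33 [0, 1]]),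
    (0, [tb 32 [0], tb 16 [0, 1]])]⟩

/-- The tables of an iteration, in the order in which they are computed. No clause has more than
three variables. -/
def iterDefs : List Def :=
  [valDef, funDef, argDef, epsDef, bodyDef, returnDef, popDef, bindDef, storeDef, pushDef, nodeDef,
    matchDef, closureDef]

theorem valDef_sem (hs : NodeSys e s) {i c : ℕ} (hi : i < e.size) :
    valDef.sem (ctx e) (tabs e s) [i, c] ↔ tabs e s 22 [i, c] := by
  simp [valDef, Def.sem, ClauseHolds, ExN, Lit.Holds, Atm.Holds, tabs, sysTab, stat, ctx_n]
  constructor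
  · rintro (⟨h₁, h₂⟩ | ⟨b, -, ⟨h₁, h₂, h₃, -⟩, -, h₄, h₅⟩)
    · obtain ⟨v, b, ρ, h⟩ := kd_two.1 h₁
      have hc : pt e c = (.ret (.lam v b), ρ) := h₂ ▸ h
      exact ⟨kd_two.2 ⟨_, _, _, hc⟩, .lam v b, ρ, h, by simp [clo, hc, aeval]⟩
    · obtain ⟨v, ρ, h⟩ := kd_one.1 h₁
      have hv : (ctx e).nm i = v := by simp [ctx, h, Exp.name]
      rw [InEnv, hv] at h₂
      obtain ⟨w, hw⟩ := Option.ne_none_iff_exists'.1 h₂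
      obtain ⟨rfl, -⟩ := env_pt hi hw
      rw [h] at hw
      exact ⟨h₄, .var w, ρ, h, w, hw, by rwa [← hv, h₃]⟩
  · rintro ⟨h₁, _ | _, ρ, h, hc⟩
    · obtain ⟨w, hw, hc⟩ := hc
      rename_i v
      obtain ⟨rfl, -⟩ := env_pt hi (v := v) (by rw [h]; exact hw)
      obtain ⟨⟨b, hb, hk, hn⟩, -⟩ := hs.store _ _ hc
      have hv : (ctx e).nm i = w := by simp [ctx, h, Exp.name]
      refine .inr ⟨b, hb, ⟨kd_one.2 ⟨_, _, h⟩, ?_, hv.trans hn.symm, hk⟩, hk, h₁, by rwa [hn]⟩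
      rw [InEnv, hv, h]
      simp [hw]
    · exact .inl ⟨kd_two.2 ⟨_, _, _, h⟩, by rw [h, pt_eq_of_clo h₁ hc]⟩

theorem funDef_sem {i c : ℕ} (hi : i < e.size) :
    funDef.sem (ctx e) (tabs e s) [i, c] ↔ tabs e s 23 [i, c] := by
  simp [funDef, Def.sem, ClauseHolds, ExN, Lit.Holds, Atm.Holds, tabs, ctx_n, CallVal]
  constructor
  · rintro ⟨h₁, h₂, h₃, a, ρ, h₄, h₅⟩
    obtain ⟨f', a', ρ', h⟩ := kd_three.1 h₂
    rw [(pt_call hi h).1.2] at h₄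
    cases h₄
    exact ⟨h₃, _, _, _, h, h₅⟩
  · rintro ⟨h₁, f, a, ρ, h, h₂⟩
    exact ⟨(pt_call hi h).1.1, kd_three.2 ⟨_, _, _, h⟩, h₁, f, ρ, (pt_call hi h).1.2, h₂⟩

theorem argDef_sem {i c : ℕ} (hi : i < e.size) :
    argDef.sem (ctx e) (tabs e s) [i, c] ↔ tabs e s 24 [i, c] := by
  simp [argDef, Def.sem, ClauseHolds, ExN, Lit.Holds, Atm.Holds, tabs, stat, ctx_n, CallVal]
  constructor
  · rintro ⟨h₁, h₂, -, h₃, a, ρ, h₄, h₅⟩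
    obtain ⟨f', a', ρ', h⟩ := kd_three.1 h₂
    rw [(pt_call hi h).2.2] at h₄
    cases h₄
    exact ⟨h₃, _, _, _, h, h₅⟩
  · rintro ⟨h₁, f, a, ρ, h, h₂⟩
    have hk := kd_three.2 ⟨_, _, _, h⟩
    exact ⟨(pt_call hi h).2.1, hk, .inl hk, h₁, a, ρ, (pt_call hi h).2.2, h₂⟩

theorem epsDef_sem (hs : NodeSys e s) {i j : ℕ} (hi : i < e.size) :
    epsDef.sem (ctx e) (tabs e s) [i, j] ↔ tabs e s 33 [i, j] := by
  simp [epsDef, Def.sem, ClauseHolds, ExN, Lit.Holds, Atm.Holds, tabs, sysTab, stat, ctx_n, CallVal]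
  rw [mem_eps]
  constructor
  · rintro ⟨c, -, h₁, ⟨-, f, a, ρ, h₂, h₃⟩, -, h₄⟩
    exact ⟨h₁, f, a, ρ, clo e c, h₂, h₃, h₄⟩
  · rintro ⟨h₁, f, a, ρ, c, h₂, h₃, h₄⟩
    obtain ⟨⟨h₅, h₆⟩, -⟩ := pt_call hi h₂
    obtain ⟨k, hk, hk', rfl⟩ := hs.aeval h₅ h₆ h₃
    exact ⟨k, hk, h₁, ⟨hk', f, a, ρ, h₂, h₃⟩, hk', h₄⟩

theorem bodyDef_sem (hs : NodeSys e s) {i j : ℕ} :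
    bodyDef.sem (ctx e) (tabs e s) [i, j] ↔ tabs e s 27 [i, j] := by
  simp [bodyDef, Def.sem, ClauseHolds, ExN, Lit.Holds, Atm.Holds, tabs, sysTab, ctx_n,
    -Prod.exists]
  constructor
  · rintro ⟨k, -, ⟨h₁, h₂⟩, h₃⟩
    exact ⟨h₁, _, h₂, h₃⟩
  · rintro ⟨h₁, ψ, h₂, h₃⟩
    obtain ⟨k, hk, rfl⟩ := (hs.closure _ _ h₃).1
    exact ⟨k, hk, ⟨h₁, h₂⟩, h₃⟩

theorem returnDef_sem (hs : NodeSys e s) {j l : ℕ} :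
    returnDef.sem (ctx e) (tabs e s) [j, l] ↔ tabs e s 26 [j, l] := by
  simp [returnDef, Def.sem, ClauseHolds, ExN, Lit.Holds, Atm.Holds, tabs, stat, ctx_n,
    Returns, -Prod.exists]
  constructor
  · rintro ⟨i, -, h₁, ⟨-, ψ, h₂, h₃⟩, -, h₄, h₅⟩
    exact ⟨h₄, h₁, _, ψ, h₅ ▸ h₂, h₃⟩
  · rintro ⟨h₁, h₂, ψ₀, ψ₁, h₃, h₄⟩
    obtain ⟨i, hi, rfl⟩ := (hs.edge _ _ _ h₃).1
    obtain ⟨hk, hf, -⟩ := (hs.push _ _ _ h₃).node hi rfl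
    exact ⟨i, hi, h₂, ⟨hk, ψ₁, hf ▸ h₃, h₄⟩, hk, h₁, hf⟩

theorem kd_ret {j : ℕ} : (∃ a ρ, pt e j = (.ret a, ρ)) ↔ (ctx e).kd j ≠ 3 ∧ (ctx e).kd j ≠ 4 := by
  rcases h : pt e j with ⟨_ | _ | ⟨_ | _⟩, ρ⟩ <;> simp [ctx, h, Exp.kind]

theorem popDef_sem {j l k : ℕ} :
    popDef.sem (ctx e) (tabs e s) [j, l, k] ↔ tabs e s 35 [j, l, k] := by
  simp [popDef, Def.sem, ClauseHolds, ExN, Lit.Holds, Atm.Holds, tabs, sysTab, stat, Returns,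
    mem_pop, kd_ret, -Prod.exists]
  tauto

theorem bindDef_sem {b d : ℕ} :
    bindDef.sem (ctx e) (tabs e s) [b, d] ↔ tabs e s 25 [b, d] := by
  simp [bindDef, Def.sem, ClauseHolds, ExN, Lit.Holds, Atm.Holds, tabs, sysTab, ctx_n]
  constructor
  · rintro (⟨i, hi, h₁, h₂, h₃⟩ | ⟨j, hj, h₁, h₂, h₃⟩)
    · exact ⟨h₃.1, .inl ⟨h₂.1, i, hi, h₁, h₂, h₃⟩⟩
    · exact ⟨h₂, .inr ⟨j, hj, h₁, h₃⟩⟩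
  · rintro ⟨h, ⟨-, i, hi, h₁, h₂, h₃⟩ | ⟨j, hj, h₁, h₃⟩⟩
    · exact .inl ⟨i, hi, h₁, h₂, h₃⟩
    · exact .inr ⟨j, hj, h₁, h, h₃⟩

/-- The new values of a variable, collected from the nodes that bind it. -/
theorem newVal_iff (hs : NodeSys e s) {v : Var} {d : ℕ} (hd : (ctx e).kd d = 2) :
    NewVal s v (clo e d) ↔ ∃ b < e.size, (ctx e).nm b = v ∧ tabs e s 25 [b, d] := by
  simp only [tabs]
  constructor
  · rintro (⟨f, a, ρ, c, h₁, h₂, rfl, h₃⟩ | ⟨a, ρ, φ, ψ₀, ψ₁, h₁, h₂, rfl, h₃⟩)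
    · obtain ⟨i, hi, hψ⟩ := hs.node _ h₁
      obtain ⟨⟨h₄, h₅⟩, -⟩ := pt_call hi hψ
      obtain ⟨b, hb, hk, rfl⟩ := hs.aeval h₄ h₅ h₂
      exact ⟨b, hb, (clo_fst hk).symm, hd, .inl ⟨hk, i, hi, hψ ▸ h₁, ⟨hk, f, a, ρ, hψ, h₂⟩,
        hd, f, a, ρ, hψ, h₃⟩⟩
    · obtain ⟨l, hl, hk, rfl⟩ := (hs.edge _ _ _ h₁).2.2 φ (.inl rfl)
      obtain ⟨j, hj, hψ⟩ := (hs.closure _ _ h₂).2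
      exact ⟨l, hl, (fr_fst hk).symm, hd, .inr ⟨j, hj, ⟨hk, kd_ret.1 ⟨a, ρ, hψ⟩, ψ₀, ψ₁, h₁,
        hψ ▸ h₂⟩, a, ρ, hψ, h₃⟩⟩
  · rintro ⟨b, hb, rfl, -, ⟨hk, i, hi, h₁, ⟨-, f, a, ρ, h₂, h₃⟩, -, f', a', ρ', h₄, h₅⟩ |
      ⟨j, hj, ⟨hk, -, ψ₀, ψ₁, h₁, h₂⟩, a, ρ, h₃, h₄⟩⟩
    · rw [h₂] at h₄
      cases h₄
      exact .inl ⟨f, a, ρ, clo e b, h₂ ▸ h₁, h₃, clo_fst hk, h₅⟩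
    · exact .inr ⟨a, ρ, fr e b, ψ₀, ψ₁, h₁, h₃ ▸ h₂, fr_fst hk, h₄⟩

theorem storeDef_sem (hs : NodeSys e s) (hle : s ≤ transfer mono e s) {b d : ℕ} :
    storeDef.sem (ctx e) (tabs e s) [b, d] ↔ tabs e s 37 [b, d] := by
  have h25 : ∀ {b}, tabs e s 25 [b, d] → (ctx e).kd d = 2 := fun h => by
    simp only [tabs] at h; exact h.1
  have h7 : tabs e s 7 [b, d] ↔ ((ctx e).kd b = 2 ∨ (ctx e).kd b = 4) ∧ (ctx e).kd d = 2 ∧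
    clo e d ∈ s.2.2 ((ctx e).nm b) := by simp only [tabs, sysTab]
  have h37 : tabs e s 37 [b, d] ↔ ((ctx e).kd b = 2 ∨ (ctx e).kd b = 4) ∧ (ctx e).kd d = 2 ∧
      clo e d ∈ (transfer mono e s).2.2 ((ctx e).nm b) := by simp only [tabs, sysTab]
  rw [h37, mem_store hle]
  simp [storeDef, Def.sem, ClauseHolds, ExN, Lit.Holds, Atm.Holds, ctx_n, h7]
  constructor
  · rintro (⟨h₁, h₂, h₃⟩ | ⟨c, hc, h₁, h₂, h₃⟩ | ⟨c, hc, h₁, h₂, h₃⟩)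
    · exact ⟨h₁, h₂, .inl h₃⟩
    · exact ⟨.inl h₃, h25 h₁, .inr ((newVal_iff hs (h25 h₁)).2 ⟨c, hc, h₂, h₁⟩)⟩
    · exact ⟨.inr h₃, h25 h₁, .inr ((newVal_iff hs (h25 h₁)).2 ⟨c, hc, h₂, h₁⟩)⟩
  · rintro ⟨h₁, h₂, h₃ | h₃⟩
    · exact .inl ⟨h₁, h₂, h₃⟩
    · obtain ⟨c, hc, h₄, h₅⟩ := (newVal_iff hs h₂).1 h₃
      rcases h₁ with h₁ | h₁
      · exact .inr (.inl ⟨c, hc, h₅, h₄, h₁⟩)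
      · exact .inr (.inr ⟨c, hc, h₅, h₄, h₁⟩)

theorem pushDef_sem {i l j : ℕ} (hi : i < e.size) :
    pushDef.sem (ctx e) (tabs e s) [i, l, j] ↔ tabs e s 34 [i, l, j] := by
  simp [pushDef, Def.sem, ClauseHolds, ExN, Lit.Holds, Atm.Holds, tabs, sysTab, stat, mem_push]
  constructor
  · rintro ⟨h₁, ⟨h₂, h₃, h₄⟩, -, h₅⟩
    refine ⟨h₃, h₁, ?_⟩
    rw [← h₄, h₅]
    exact isPush_fr hi h₂
  · rintro ⟨h₁, h₂, h₃⟩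
    obtain ⟨h₄, h₅, -, h₆⟩ := h₃.node hi rfl
    exact ⟨h₂, ⟨h₄, h₁, h₅⟩, h₄, h₆.symm⟩

theorem nodeDef_sem (hs : NodeSys e s) {j : ℕ} :
    nodeDef.sem (ctx e) (tabs e s) [j] ↔ tabs e s 32 [j] := by
  simp [nodeDef, Def.sem, ClauseHolds, ExN, Lit.Holds, Atm.Holds, tabs, sysTab, stat, ctx_n,
    mem_nodes, -Prod.exists]
  refine or_congr_right (or_congr ?_ ?_)
  · rw [pt_zero]
    exact ⟨fun h => h.2.symm, fun h => ⟨e.size_pos, h.symm⟩⟩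
  constructor
  · rintro (⟨i, -, h⟩ | ⟨i, -, l, -, -, h⟩ | ⟨i, -, l, -, -, h⟩) <;> exact ⟨_, _, h⟩
  · rintro ⟨ψ, g, h⟩
    obtain ⟨⟨i, hi, rfl⟩, -, hf⟩ := hs.transfer.edge _ _ _ h
    cases g with
    | eps => exact .inl ⟨i, hi, h⟩
    | push φ =>
      obtain ⟨l, hl, hk, rfl⟩ := hf φ (.inl rfl)
      exact .inr (.inl ⟨i, hi, l, hl, hk, h⟩)
    | pop φ =>
      obtain ⟨l, hl, hk, rfl⟩ := hf φ (.inr rfl)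
      exact .inr (.inr ⟨i, hi, l, hl, hk, h⟩)

theorem matchDef_sem (hs : NodeSys e s) {i j : ℕ} (hi : i < e.size) :
    matchDef.sem (ctx e) (tabs e s) [i, j] ↔ tabs e s 28 [i, j] := by
  simp [matchDef, Def.sem, ClauseHolds, ExN, Lit.Holds, Atm.Holds, tabs, sysTab, ctx_n,
    -Prod.exists]
  constructor
  · rintro ⟨k, -, ⟨-, ψ, h₁, h₂⟩, -, h₃⟩
    exact ⟨_, ψ, h₁, _, h₂, h₃⟩
  · rintro ⟨φ, ψ, h₁, ψ', h₂, h₃⟩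
    obtain ⟨hk, rfl, -⟩ := (hs.push _ _ _ h₁).node hi rfl
    obtain ⟨k, hk', rfl⟩ := (hs.closure _ _ h₂).2
    exact ⟨k, hk', ⟨hk, ψ, h₁, h₂⟩, hk, h₃⟩

theorem closureDef_sem (hs : NodeSys e s) {i j : ℕ} :
    closureDef.sem (ctx e) (tabs e s) [i, j] ↔ tabs e s 36 [i, j] := by
  simp [closureDef, Def.sem, ClauseHolds, ExN, Lit.Holds, Atm.Holds, tabs, sysTab, stat, ctx_n,
    mem_closure, -Prod.exists]
  refine or_congr ⟨?_, ?_⟩ (or_congr_right (or_congr_right (and_congr_right fun _ => eq_comm)))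
  · rintro ⟨k, -, h₁, h₂⟩
    exact ⟨_, h₁, h₂⟩
  · rintro ⟨ψ, h₁, h₂⟩
    obtain ⟨k, hk, rfl⟩ := (hs.closure _ _ h₁).2
    exact ⟨k, hk, h₁, h₂⟩

/-- The intended tables solve the definitions of an iteration. -/
theorem iterDefs_sem (hs : NodeSys e s) (hle : s ≤ transfer mono e s) :
    ∀ d ∈ iterDefs, ∀ xs, Valid e.size d.head xs →
      (d.sem (ctx e) (tabs e s) xs ↔ tabs e s d.head xs) := by
  simp only [iterDefs, List.mem_cons, List.not_mem_nil, or_false, forall_eq_or_imp, forall_eq]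
  refine ⟨?_, ?_, ?_, ?_, ?_, ?_, ?_, ?_, ?_, ?_, ?_, ?_, ?_⟩ <;> intro xs hx
  · obtain ⟨i, j, rfl, hi, hj⟩ := (valid_two rfl).1 hx; exact valDef_sem hs hi
  · obtain ⟨i, j, rfl, hi, hj⟩ := (valid_two rfl).1 hx; exact funDef_sem hi
  · obtain ⟨i, j, rfl, hi, hj⟩ := (valid_two rfl).1 hx; exact argDef_sem hi
  · obtain ⟨i, j, rfl, hi, hj⟩ := (valid_two rfl).1 hx; exact epsDef_sem hs hi
  · obtain ⟨i, j, rfl, hi, hj⟩ := (valid_two rfl).1 hx; exact bodyDef_sem hs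
  · obtain ⟨i, j, rfl, hi, hj⟩ := (valid_two rfl).1 hx; exact returnDef_sem hs
  · obtain ⟨i, j, k, rfl, hi, hj, hk⟩ := (valid_three rfl).1 hx; exact popDef_sem
  · obtain ⟨i, j, rfl, hi, hj⟩ := (valid_two rfl).1 hx; exact bindDef_sem
  · obtain ⟨i, j, rfl, hi, hj⟩ := (valid_two rfl).1 hx; exact storeDef_sem hs hle
  · obtain ⟨i, j, k, rfl, hi, hj, hk⟩ := (valid_three rfl).1 hx; exact pushDef_sem hi
  · obtain ⟨i, rfl, hi⟩ := (valid_one rfl).1 hx; exact nodeDef_sem hs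
  · obtain ⟨i, j, rfl, hi, hj⟩ := (valid_two rfl).1 hx; exact matchDef_sem hs hi
  · obtain ⟨i, j, rfl, hi, hj⟩ := (valid_two rfl).1 hx; exact closureDef_sem hs

/-! ### Reaching the least fixed point -/

/-- If the `C i` grow strictly as long as the iterates of `f` change, then there are at most as
many changes as there are elements. -/
theorem iterate_stable {α β : Type*} [Fintype β] {f : α → α} {x : α} {C : ℕ → Finset β}
    (hmono : ∀ i, C i ⊆ C (i + 1)) (hinj : ∀ i, C i = C (i + 1) → f^[i + 1] x = f^[i] x) {K : ℕ}
    (hK : Fintype.card β ≤ K) : f^[K + 1] x = f^[K] x := by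
  by_contra hne
  have hne' : ∀ i ≤ K, f^[i + 1] x ≠ f^[i] x := fun i hi h => by
    have hfix : f (f^[i] x) = f^[i] x :=
      (Function.iterate_succ_apply' f i x).symm.trans h
    have hall : ∀ j, f^[j + i] x = f^[i] x := fun j => by
      rw [Function.iterate_add_apply, Function.iterate_fixed hfix]
    refine hne ?_
    rw [show K + 1 = K + 1 - i + i by omega, hall, show K = K - i + i by omega, hall]
  have hcard : ∀ i ≤ K + 1, i ≤ (C i).card := by
    intro i
    induction i with
    | zero => simp
    | succ i ih =>
      intro hi
      have := Finset.card_lt_card ((hmono i).ssubset_of_ne fun h => hne' i (by omega) (hinj i h))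
      have := ih (by omega)
      omega
  have := hcard (K + 1) le_rfl
  have := Finset.card_le_univ (C (K + 1))
  omega

theorem iterate_le_succ (e : Exp) (i : ℕ) :
    (transfer mono e)^[i] ⊥ ≤ (transfer mono e)^[i + 1] ⊥ := by
  rw [Function.iterate_succ_apply]
  exact (transfer_mono e).iterate i bot_le

theorem nodeSys_iterate (e : Exp) (i : ℕ) : NodeSys e ((transfer mono e)^[i] ⊥) := by
  induction i with
  | zero => exact nodeSys_bot
  | succ i ih => rw [Function.iterate_succ_apply']; exact ih.transfer

/-- The entries of the tables of a system. Tuples are padded to triples, so that there are at most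
`6 * n ^ 3` entries. -/
noncomputable def entries (e : Exp) (s : System Var) :
    Finset (Fin 6 × Fin e.size × Fin e.size × Fin e.size) :=
  open Classical in Finset.univ.filter fun q =>
    sysTab e s (q.1 + 2) ([q.2.1.1, q.2.2.1.1, q.2.2.2.1].take (ar (q.1 + 2)))

theorem entries_mono {s t : System Var} (h : s ≤ t) : entries e s ⊆ entries e t := by
  intro q hq
  simp only [entries, Finset.mem_filter, Finset.mem_univ, true_and] at hq ⊢
  exact sysTab_mono h hq

theorem le_of_entries {s t : System Var} (hs : NodeSys e s) (h : entries e s ⊆ entries e t) :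
    s ≤ t := by
  have key : ∀ (q : Fin 6) (i j k : ℕ) (hi : i < e.size) (hj : j < e.size) (hk : k < e.size),
      sysTab e s (q + 2) ([i, j, k].take (ar (q + 2))) →
      sysTab e t (q + 2) ([i, j, k].take (ar (q + 2))) := fun q i j k hi hj hk hq => by
    have := @h (q, ⟨i, hi⟩, ⟨j, hj⟩, ⟨k, hk⟩)
    simp only [entries, Finset.mem_filter, Finset.mem_univ, true_and] at this
    exact this hq
  refine hs.le_of_sysTab fun p hp xs hx hs => ?_
  have hq : ∀ p ∈ [2, 3, 4, 5, 6, 7], ∃ q : Fin 6, q.1 + 2 = p := by decide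
  obtain ⟨q, rfl⟩ := hq p hp
  have ha := ar_le (q + 2)
  have h1 : 1 ≤ ar (q + 2) := by unfold ar; split_ifs <;> omega
  interval_cases h : ar (q + 2)
  · obtain ⟨i, rfl, hi⟩ := (valid_one h).1 hx
    have := key q i i i hi hi hi
    rw [h] at this
    exact this hs
  · obtain ⟨i, j, rfl, hi, hj⟩ := (valid_two h).1 hx
    have := key q i j j hi hj hj
    rw [h] at this
    exact this hs
  · obtain ⟨i, j, k, rfl, hi, hj, hk⟩ := (valid_three h).1 hx
    have := key q i j k hi hj hk
    rw [h] at this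
    exact this hs

/-- The iterates grow, and each change adds an entry to one of the tables. -/
theorem isLeast_iterate (e : Exp) {K : ℕ} (hK : 6 * e.size ^ 3 ≤ K) :
    IsLeast (Function.fixedPoints (transfer mono e)) ((transfer mono e)^[K] ⊥) := by
  constructor
  · rw [Function.mem_fixedPoints, Function.IsFixedPt,
      ← Function.iterate_succ_apply' (transfer mono e) K ⊥]
    refine iterate_stable (C := fun i => entries e ((transfer mono e)^[i] ⊥))
      (fun i => entries_mono (iterate_le_succ e i)) (fun i h => ?_) ?_
    · exact le_antisymm (le_of_entries (nodeSys_iterate e _) h.ge) (iterate_le_succ e i)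
    · simp only [Fintype.card_prod, Fintype.card_fin]
      calc _ = 6 * e.size ^ 3 := by ring
        _ ≤ K := hK
  · intro t ht
    have : (transfer mono e)^[K] t = t := Function.iterate_fixed ht K
    rw [← this]
    exact (transfer_mono e).iterate K bot_le

/-! ### The iteration on the machine -/

/-- Replace the tables of the analysis so far by the new ones. -/
def copyDefs : List Def :=
  [⟨2, [(0, [tb 32 [0]])]⟩, ⟨3, [(0, [tb 33 [0, 1]])]⟩, ⟨4, [(0, [tb 34 [0, 1, 2]])]⟩,
   ⟨5, [(0, [tb 35 [0, 1, 2]])]⟩, ⟨6, [(0, [tb 36 [0, 1]])]⟩, ⟨7, [(0, [tb 37 [0, 1]])]⟩]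

/-- One iteration: compute the new tables, and count down. -/
def iterCmd : Cmd := .seq (defsCmd iterDefs) (.seq (defsCmd copyDefs) (.sub 6 6 1))

theorem copyDefs_agree {s : System Var} {D : DB}
    (h : ∀ p ∈ [32, 33, 34, 35, 36, 37], Agree e.size D (tabs e s) p) :
    ∀ p ∈ [2, 3, 4, 5, 6, 7],
      Agree e.size (defsSem (ctx e) copyDefs D) (sysTab e (transfer mono e s)) p := by
  set T : DB := fun p xs => if p < 32 then sysTab e (transfer mono e s) p xs else
    sysTab e (transfer mono e s) (p - 30) xs with hT
  have key := defsSem_agree (c := ctx e) (T := T) (ds := copyDefs) (ok := [32, 33, 34, 35, 36, 37])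
    (D := D) (by decide) (by decide) (fun p hp xs hx => by
      have hp' := h p hp xs hx
      simp only [List.mem_cons, List.not_mem_nil, or_false] at hp
      rcases hp with rfl | rfl | rfl | rfl | rfl | rfl <;> exact hp') (by
    simp only [copyDefs, List.mem_cons, List.not_mem_nil, or_false, forall_eq_or_imp, forall_eq]
    refine ⟨?_, ?_, ?_, ?_, ?_, ?_⟩ <;> intro xs hx
    · obtain ⟨i, rfl, -⟩ := (valid_one rfl).1 hx
      simp [Def.sem, ClauseHolds, ExN, Lit.Holds, Atm.Holds, hT]
    · obtain ⟨i, j, rfl, -⟩ := (valid_two rfl).1 hx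
      simp [Def.sem, ClauseHolds, ExN, Lit.Holds, Atm.Holds, hT]
    · obtain ⟨i, j, k, rfl, -⟩ := (valid_three rfl).1 hx
      simp [Def.sem, ClauseHolds, ExN, Lit.Holds, Atm.Holds, hT]
    · obtain ⟨i, j, k, rfl, -⟩ := (valid_three rfl).1 hx
      simp [Def.sem, ClauseHolds, ExN, Lit.Holds, Atm.Holds, hT]
    · obtain ⟨i, j, rfl, -⟩ := (valid_two rfl).1 hx
      simp [Def.sem, ClauseHolds, ExN, Lit.Holds, Atm.Holds, hT]
    · obtain ⟨i, j, rfl, -⟩ := (valid_two rfl).1 hx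
      simp [Def.sem, ClauseHolds, ExN, Lit.Holds, Atm.Holds, hT])
  intro p hp xs hx
  have hlt : ∀ p ∈ [2, 3, 4, 5, 6, 7], p < 32 ∧ p ∈ copyDefs.map Def.head := by decide
  rw [key p (.inr (hlt p hp).2) xs hx, hT]
  simp only [(hlt p hp).1, if_true]

/-- The memory holds the system after `i` iterations, and the static tables; the counter says how
many of the `8 * n ^ 3` iterations are left. -/
def Good (e : Exp) (i : ℕ) (m : Mem) : Prop :=
  ∃ D, Rep (ctx e) m D ∧ (∀ p ∈ [10, 16, 17, 18, 19, 20, 21], Agree e.size D (stat e) p) ∧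
    (∀ p ∈ [2, 3, 4, 5, 6, 7], Agree e.size D (sysTab e ((transfer mono e)^[i] ⊥)) p) ∧
    m.reg 6 = 8 * e.size ^ 3 - i

theorem Good.holds {i : ℕ} {m : Mem} (h : Good e i m) : Holds e ((transfer mono e)^[i] ⊥) m :=
  let ⟨_, hm, _, hs, _⟩ := h
  holds_of_rep (nodeSys_iterate e i) hm hs

/-- The empty tables left by the set-up are those of the empty system. -/
theorem exists_good_zero : ∃ C, ∀ e : Exp, ∃ m, Runs setupCmd (input e) m (C * e.size ^ 6) ∧
    Good e 0 m := by
  obtain ⟨C, hC⟩ := setup_runs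
  refine ⟨C, fun e => ?_⟩
  obtain ⟨m, D, r, hm, k, hs, h0⟩ := hC e
  refine ⟨m, r, D, hm, hs, fun p hp xs _ => ?_, k⟩
  rw [h0 p hp, Function.iterate_zero_apply, false_iff]
  intro h
  unfold sysTab at h
  split at h
  · exact h
  · exact h
  · exact h.2
  · exact h.2
  · exact h
  · exact h.2.2
  · exact h

theorem Good.succ : ∃ C, ∀ (e : Exp) (i : ℕ) (m : Mem), Good e i m →
    ∃ m', Runs iterCmd m m' (C * e.size ^ 3) ∧ Good e (i + 1) m' := by
  obtain ⟨C₁, h₁⟩ := defs_runs (ds := iterDefs) (q := 3) (by decide)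
  obtain ⟨C₂, h₂⟩ := defs_runs (ds := copyDefs) (q := 3) (by decide)
  refine ⟨C₁ + (C₂ + 1), fun e i m ⟨D, hm, hst, hsys, k⟩ => ?_⟩
  have hn : 0 < (ctx e).n := e.size_pos
  set s := (transfer mono e)^[i] ⊥ with hs
  obtain ⟨m₁, r₁, hm₁, k₁⟩ := h₁ _ hn _ _ hm
  obtain ⟨m₂, r₂, hm₂, k₂⟩ := h₂ _ hn _ _ hm₁
  have key := defsSem_agree (c := ctx e) (T := tabs e s) (ds := iterDefs) (D := D)
    (ok := [2, 3, 4, 5, 6, 7, 10, 16, 17, 18, 19, 20, 21]) (by decide) (by decide)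
    (fun p hp => by
      rcases List.mem_append.1 (show p ∈ [2, 3, 4, 5, 6, 7] ++ [10, 16, 17, 18, 19, 20, 21] from hp)
        with hp | hp
      · have h := hsys p hp
        simp only [List.mem_cons, List.not_mem_nil, or_false] at hp
        rcases hp with rfl | rfl | rfl | rfl | rfl | rfl <;> exact h
      · have h := hst p hp
        simp only [List.mem_cons, List.not_mem_nil, or_false] at hp
        rcases hp with rfl | rfl | rfl | rfl | rfl | rfl | rfl <;> exact h)
    (iterDefs_sem (nodeSys_iterate e i) (by
      rw [← Function.iterate_succ_apply' (transfer mono e)]; exact iterate_le_succ e i))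
  have hnew : ∀ p ∈ [32, 33, 34, 35, 36, 37], p ∈ iterDefs.map Def.head := by decide
  have hold : ∀ p ∈ [10, 16, 17, 18, 19, 20, 21],
      p ∉ iterDefs.map Def.head ∧ p ∉ copyDefs.map Def.head := by decide
  refine ⟨_, (r₁.seq (r₂.seq (Exec.sub 6 6 1 m₂).runs)).mono ?_, _,
    hm₂.setReg (r := 6) (by omega) _, fun p hp xs hx => ?_, ?_, ?_⟩
  · have := Nat.pow_pos (n := 3) hn
    rw [Nat.add_mul, Nat.add_mul, Nat.one_mul]
    exact Nat.add_le_add_left (Nat.add_le_add_left this _) _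
  · rw [defsSem_of_notMem (hold p hp).2, defsSem_of_notMem (hold p hp).1]
    exact hst p hp xs hx
  · rw [Function.iterate_succ_apply', ← hs]
    exact copyDefs_agree fun p hp => key p (.inr (hnew p hp))
  · simp only [Mem.setReg, Function.update_self]
    rw [hm₂.one, k₂ 6 (by omega) (by omega), k₁ 6 (by omega) (by omega), k]
    omega

theorem exists_run : ∃ C, ∀ e : Exp, ∃ m : ℕ → Mem,
    Runs setupCmd (input e) (m 0) (C * e.size ^ 6) ∧
    ∀ i, Good e i (m i) ∧ Runs iterCmd (m i) (m (i + 1)) (C * e.size ^ 3) := by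
  obtain ⟨C₁, h₁⟩ := exists_good_zero
  obtain ⟨C₂, h₂⟩ := Good.succ
  refine ⟨C₁ + C₂, fun e => ?_⟩
  obtain ⟨m₀, r₀, g₀⟩ := h₁ e
  choose f hf hg using h₂ e
  let m : ∀ i, {m // Good e i m} := fun i =>
    Nat.rec ⟨m₀, g₀⟩ (fun i p => ⟨f i p.1 p.2, hg i p.1 p.2⟩) i
  refine ⟨fun i => (m i).1, r₀.mono (Nat.mul_le_mul_right _ (by omega)), fun i => ⟨(m i).2, ?_⟩⟩
  exact (hf i (m i).1 (m i).2).mono (Nat.mul_le_mul_right _ (by omega))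

/-- The rule for a loop over a counter that `c` itself counts down. -/
theorem loop_runs {c : Cmd} {x B K : ℕ} {m : ℕ → Mem} (hx : ∀ i, (m i).reg x = K - i)
    (hc : ∀ i, Runs c (m i) (m (i + 1)) B) :
    Runs (.loop x c) (m 0) (m K) (K * (B + 1) + 1) := by
  have key : ∀ j ≤ K, Runs (.loop x c) (m (K - j)) (m K) (j * (B + 1) + 1) := by
    intro j
    induction j with
    | zero =>
      have h : (m K).reg x = 0 := by rw [hx]; omega
      simpa using fun _ : 0 ≤ K => (Exec.loopStop (c := c) h).runs
    | succ j ih =>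
      intro hj
      obtain ⟨t, ht, h⟩ := hc (K - (j + 1))
      rw [show K - (j + 1) + 1 = K - j by omega] at h
      obtain ⟨u, hu, h'⟩ := ih (by omega)
      refine ⟨_, ?_, .loopStep (by rw [hx]; omega) h h'⟩
      rw [Nat.add_mul]; omega
  simpa using key K le_rfl

end PDCFA

open PDCFA in
theorem mainTheorem1 :
    ∃ (setup iter : Cmd) (flag C : ℕ), ∀ e : Exp, ∃ (K T : ℕ) (m : ℕ → Mem),
      -- at most a cubic number of iterations, and they reach the least fixed point
      K ≤ C * e.size ^ 3 ∧
      IsLeast (Function.fixedPoints (transfer mono e)) ((transfer mono e)^[K] ⊥) ∧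
      -- after the set-up, the machine performs these iterations, each in cubic time
      (∃ t, Exec setup (input e) (m 0) t) ∧
      (∀ i < K, ∃ t ≤ C * e.size ^ 3, Exec iter (m i) (m (i + 1)) t) ∧
      (∀ i ≤ K, Holds e ((transfer mono e)^[i] ⊥) (m i)) ∧
      -- the whole computation takes time of order `n ^ 6`
      Exec (.seq setup (.loop flag iter)) (input e) (m K) T ∧
      T ≤ C * e.size ^ 6 ∧
      -- its result is the store-widened pushdown 0CFA
      ∃ (Q : Set (PConf Var)) (τ : Store Var),
        IsLeast (Function.fixedPoints (wideStep mono e)) (Q, τ) ∧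
        ((transfer mono e)^[K] ⊥).1.1 = {ψ | ∃ κ, (ψ.1, ψ.2, κ) ∈ Q} ∧
        ((transfer mono e)^[K] ⊥).2.2 = τ := by
  obtain ⟨C, hC⟩ := exists_run
  refine ⟨setupCmd, iterCmd, 6, 9 * C + 9, fun e => ?_⟩
  obtain ⟨m, r₀, hm⟩ := hC e
  have hloop := loop_runs (K := 8 * e.size ^ 3) (x := 6) (m := m)
    (fun i => (hm i).1.elim fun _ h => h.2.2.2) (fun i => (hm i).2)
  obtain ⟨T, hT, hexec⟩ := r₀.seq hloop
  have hleast := isLeast_iterate e (K := 8 * e.size ^ 3) (by omega)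
  refine ⟨8 * e.size ^ 3, T, m, Nat.mul_le_mul_right _ (by omega), hleast,
    r₀.imp fun _ h => h.2, fun i _ => ?_, fun i _ => (hm i).1.holds, hexec, ?_,
    exists_wide_eq hleast⟩
  · obtain ⟨t, ht, h⟩ := (hm i).2
    exact ⟨t, ht.trans (Nat.mul_le_mul_right _ (by omega)), h⟩
  · have h1 : 1 ≤ e.size ^ 3 := Nat.pow_pos e.size_pos
    calc T ≤ C * (e.size ^ 3 * e.size ^ 3) +
          (8 * e.size ^ 3 * (C * e.size ^ 3 + 1) + 1) := by rwa [← pow_add]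
      _ ≤ C * (e.size ^ 3 * e.size ^ 3) + (8 * e.size ^ 3 * (C * e.size ^ 3 + e.size ^ 3) +
          e.size ^ 3 * e.size ^ 3) := by gcongr; exact Nat.mul_pos h1 h1
      _ = (9 * C + 9) * e.size ^ 6 := by ring
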